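/- Let $n,d\ge 0$ be integers, let $(\Phi_0,\dots,\Phi_n)$ be a basis of $H^0(\mathbb P^n,\mathcal O(1))$, where $\mathbb P^n$ is complex projective space and $H^0$ denotes the space of global holomorphic sections, and put $r=\sum_i|\Phi_i|^2$. Let $\Omega$ be the volume form of the Fubini--Study Kähler form $i\partial\bar\partial\log r$ (the curvature of the metric $|s|^2/r$ on $\mathcal O(1)$), normalized so that $\int_{\mathbb P^n}\Omega=1$. Let $p$ be a Hermitian metric on $\mathcal O(d)\to\mathbb P^n$ that is globalizable: there are complex constants $a_{\alpha\beta}$, indexed by multiindices with $|\alpha|=|\beta|=d$, such that $p(s,\bar s)=|s|^2/\sum_{|\alpha|=|\beta|=d}a_{\alpha\beta}\Phi^\alpha\overline{\Phi}^\beta$. For $m\ge 0$ write $$(r^mp)(x,\bar y)=\Big(\sum_i\Phi_i(x)\overline{\Phi_i(y)}\Big)^m\sum_{|\alpha|=|\beta|=d}a_{\alpha\beta}\Phi^\alpha(x)\overline{\Phi^\beta(y)},$$ and for $s,s_1,s_2\in H^0(\mathbb P^n,\mathcal O(m+d))$ put $$(s_1,s_2)=\int_{\mathbb P^n}\frac{s_1(x)\overline{s_2(x)}}{(r^mp)(x,\bar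 x)}\,\Omega(x),\qquad \|s\|=\sqrt{(s,s)},$$ $$K_{r^mp}(s_1,s_2)=\int_{\mathbb P^n}\int_{\mathbb P^n}\frac{(r^mp)(x,\bar y)\,\overline{s_2(x)}\,s_1(y)}{(r^mp)(x,\bar x)\,(r^mp)(y,\bar y)}\,\Omega(y)\,\Omega(x).$$ Then $\Omega$ is a probability measure; for every $m$ the integrands of both expressions are integrable (over $\mathbb P^n$ and $\mathbb P^n\times\mathbb P^n$ respectively), and $(\cdot,\cdot)$ is an inner product. Moreover, as $m\to\infty$, $$K_{r^mp}(s,s)=\Big\{\frac{n!}{m^n}+O\Big(\frac{(\log m)^{n+2}}{m^{n+1}}\Big)\Big\}\|s\|^2$$ uniformly in $s\in H^0(\mathbb P^n,\mathcal O(m+d))$: there are $C$ and $M$, independent of $m$ and $s$, such that for all $m\ge M$ and all $s\in H^0(\mathbb P^n,\mathcal O(m+d))$ there is a real $\varepsilon$ with $|\varepsilon|\le C(\log m)^{n+2}/m^{n+1}$ and $K_{r^mp}(s,s)=(n!/m^n+\varepsilon)\|s\|^2$. In particular, for all sufficiently large $m$, the form $K_{r^mp}$ is Hermitian sesquilinear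 and positive definite. -/

import Mathlib

open MeasureTheory Filter Topology
open scoped LinearAlgebra.Projectivization ComplexConjugate ComplexOrder ContDiff Nat

noncomputable section

/-- Complex projective space `P^n`, the space of lines in `ℂ^(n+1)`. -/
abbrev CPn (n : ℕ) : Type := ℙ ℂ (Fin (n + 1) → ℂ)

/-- The quotient topology from `ℂ^(n+1) ∖ {0}`. -/
instance CPn.instTopologicalSpace (n : ℕ) : TopologicalSpace (CPn n) :=
  TopologicalSpace.coinduced
    (fun v : {v : Fin (n + 1) → ℂ // v ≠ 0} => Projectivization.mk ℂ v.1 v.2) inferInstance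

instance CPn.instMeasurableSpace (n : ℕ) : MeasurableSpace (CPn n) := borel (CPn n)

instance CPn.instBorelSpace (n : ℕ) : BorelSpace (CPn n) := ⟨rfl⟩

/-- A nonzero vector lies on the line that it spans. -/
theorem CPn.mem_submodule_mk {n : ℕ} (v : Fin (n + 1) → ℂ) (hv : v ≠ 0) :
    v ∈ (Projectivization.mk ℂ v hv).submodule := by
  rw [Projectivization.submodule_mk]
  exact Submodule.mem_span_singleton_self v

/-- The fibre of the line bundle `O(k)` at a point `x` of `P^n`: the homogeneous functions of
degree `k` on the line `x ⊆ ℂ^(n+1)` (the `k`-th symmetric power of the dual of the line `x`). -/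
def OFibre {n : ℕ} (k : ℕ) (x : CPn n) : Submodule ℂ (x.submodule → ℂ) where
  carrier := {f | ∀ (c : ℂ) (v : x.submodule), f (c • v) = c ^ k * f v}
  add_mem' := by
    intro f g hf hg c v
    simp only [Pi.add_apply, hf c v, hg c v, mul_add]
  zero_mem' := by
    intro c v
    simp
  smul_mem' := by
    intro a f hf c v
    simp only [Pi.smul_apply, smul_eq_mul, hf c v]
    ring

/-- The value at `v ∈ ℂ^(n+1) ∖ {0}` of a (set-theoretic) section `s` of `O(k)`, i.e. the value
of the homogeneous function `s [v]` at the point `v` of the line `[v]`. The value at `0` is a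
dummy value and is never used. -/
def sectionLift {n k : ℕ} (s : ∀ x : CPn n, OFibre k x) (v : Fin (n + 1) → ℂ) : ℂ :=
  open Classical in
  if hv : v ≠ 0 then
    (s (Projectivization.mk ℂ v hv)).1 ⟨v, CPn.mem_submodule_mk v hv⟩
  else 0

/-- The space `H^0(P^n, O(k))` of global holomorphic sections of `O(k)`: a section is holomorphic
when the corresponding homogeneous function on `ℂ^(n+1) ∖ {0}` is holomorphic. -/
def H0 (n k : ℕ) : Submodule ℂ (∀ x : CPn n, OFibre k x) where
  carrier := {s | DifferentiableOn ℂ (sectionLift s) {0}ᶜ}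
  add_mem' := by
    intro s t hs ht
    refine (DifferentiableOn.add hs ht).congr ?_
    intro v hv
    have hv' : v ≠ 0 := hv
    simp only [sectionLift, hv', ne_eq, not_false_eq_true, dif_pos, Pi.add_apply]
    rfl
  zero_mem' := by
    refine (differentiableOn_const (0 : ℂ)).congr ?_
    intro v hv
    have hv' : v ≠ 0 := hv
    simp only [sectionLift, hv', ne_eq, not_false_eq_true, dif_pos]
    rfl
  smul_mem' := by
    intro c s hs
    refine (DifferentiableOn.const_smul hs c).congr ?_
    intro v hv
    have hv' : v ≠ 0 := hv
    simp only [sectionLift, hv', ne_eq, not_false_eq_true, dif_pos, Pi.smul_apply]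
    rfl

/-- The value `s(v)` of a global holomorphic section at `v ∈ ℂ^(n+1) ∖ {0}`. -/
def H0val {n k : ℕ} (s : H0 n k) (v : Fin (n + 1) → ℂ) : ℂ := sectionLift s.1 v

/-- A (smooth) Hermitian metric on `O(d) → P^n`: a positive definite Hermitian form on every
fibre, linear in the first and conjugate-linear in the second variable, which varies smoothly.
Smoothness is tested on global holomorphic sections (they generate every fibre, as `d ≥ 0`) and
after pulling back to `ℂ^(n+1) ∖ {0}`. -/
structure HermitianMetric (n d : ℕ) where
  form : ∀ x : CPn n, OFibre d x →ₗ[ℂ] OFibre d x →ₗ⋆[ℂ] ℂ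
  conj_symm : ∀ (x : CPn n) (s t : OFibre d x), conj (form x s t) = form x t s
  pos : ∀ (x : CPn n) (s : OFibre d x), s ≠ 0 → 0 < form x s s
  smooth : ∀ s t : H0 n d, ContDiffOn ℝ ∞
    (fun v : Fin (n + 1) → ℂ =>
      open Classical in
      if hv : v ≠ 0 then
        form (Projectivization.mk ℂ v hv) (s.1 (Projectivization.mk ℂ v hv))
          (t.1 (Projectivization.mk ℂ v hv))
      else 0) {0}ᶜ

/-- The multiindices `α = (α_0, …, α_n)` of length `d`. -/
def multiIndices (n d : ℕ) : Finset (Fin (n + 1) → ℕ) := Finset.piAntidiag Finset.univ d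

/-- The monomial `Φ^α = Φ_0^(α_0) ⋯ Φ_n^(α_n)`, evaluated at `v ∈ ℂ^(n+1) ∖ {0}`. -/
def monomialVal {n : ℕ} (Φ : Fin (n + 1) → H0 n 1) (α : Fin (n + 1) → ℕ)
    (v : Fin (n + 1) → ℂ) : ℂ :=
  ∏ i, H0val (Φ i) v ^ α i

/-- `r(v, w̄) = ∑ i, Φ_i(v) conj(Φ_i(w))`, the polarization of `r = ∑ i, |Φ_i|²`. -/
def rPol {n : ℕ} (Φ : Fin (n + 1) → H0 n 1) (v w : Fin (n + 1) → ℂ) : ℂ :=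
  ∑ i, H0val (Φ i) v * conj (H0val (Φ i) w)

/-- `p(v, w̄) = ∑_{|α| = |β| = d} a_{αβ} Φ^α(v) conj(Φ^β(w))`, the polarization of
`∑_{|α| = |β| = d} a_{αβ} Φ^α conj(Φ^β)`. -/
def pPol {n : ℕ} (d : ℕ) (Φ : Fin (n + 1) → H0 n 1)
    (a : (Fin (n + 1) → ℕ) → (Fin (n + 1) → ℕ) → ℂ) (v w : Fin (n + 1) → ℂ) : ℂ :=
  ∑ α ∈ multiIndices n d, ∑ β ∈ multiIndices n d,
    a α β * monomialVal Φ α v * conj (monomialVal Φ β w)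

/-- The Hermitian metric `p` on `O(d)` is globalized by the coefficients `a`:
`p(s, s̄) = |s|² / ∑_{|α| = |β| = d} a_{αβ} Φ^α conj(Φ^β)` for all `s` in all fibres of `O(d)`.
The metric is globalizable if such coefficients exist. -/
def HermitianMetric.IsGlobalizedBy {n d : ℕ} (p : HermitianMetric n d)
    (Φ : Fin (n + 1) → H0 n 1) (a : (Fin (n + 1) → ℕ) → (Fin (n + 1) → ℕ) → ℂ) : Prop :=
  ∀ (v : Fin (n + 1) → ℂ) (hv : v ≠ 0) (s : OFibre d (Projectivization.mk ℂ v hv)),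
    p.form (Projectivization.mk ℂ v hv) s s =
      (‖s.1 ⟨v, CPn.mem_submodule_mk v hv⟩‖ ^ 2 : ℝ) / pPol d Φ a v v

/-- The kernel `(r^m p)(v, w̄) = r(v, w̄)^m p(v, w̄)`. -/
def rpPol {n : ℕ} (d : ℕ) (Φ : Fin (n + 1) → H0 n 1)
    (a : (Fin (n + 1) → ℕ) → (Fin (n + 1) → ℕ) → ℂ) (m : ℕ) (v w : Fin (n + 1) → ℂ) : ℂ :=
  rPol Φ v w ^ m * pPol d Φ a v w

/-- The Wirtinger derivative `∂f/∂z_j = (∂f/∂x_j - i ∂f/∂y_j) / 2` on `ℂ^n`. -/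
def dz {n : ℕ} (j : Fin n) (f : (Fin n → ℂ) → ℂ) (z : Fin n → ℂ) : ℂ :=
  (fderiv ℝ f z (Pi.single j 1) - Complex.I * fderiv ℝ f z (Pi.single j Complex.I)) / 2

/-- The Wirtinger derivative `∂f/∂z̄_k = (∂f/∂x_k + i ∂f/∂y_k) / 2` on `ℂ^n`. -/
def dzbar {n : ℕ} (k : Fin n) (f : (Fin n → ℂ) → ℂ) (z : Fin n → ℂ) : ℂ :=
  (fderiv ℝ f z (Pi.single k 1) + Complex.I * fderiv ℝ f z (Pi.single k Complex.I)) / 2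

/-- The vector `(1, z_1, …, z_n)`. -/
def affineVec {n : ℕ} (z : Fin n → ℂ) : Fin (n + 1) → ℂ := Fin.cons 1 z

theorem affineVec_ne_zero {n : ℕ} (z : Fin n → ℂ) : affineVec z ≠ 0 := by
  intro h
  simpa [affineVec] using congrFun h 0

/-- The affine chart `z ↦ [1 : z_1 : … : z_n]` of `P^n`. -/
def affineChart {n : ℕ} (z : Fin n → ℂ) : CPn n :=
  Projectivization.mk ℂ (affineVec z) (affineVec_ne_zero z)

/-- The local potential `log r(1, z)` of the curvature form of the metric `|s|²/r` on `O(1)`. -/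
def fsPotential {n : ℕ} (Φ : Fin (n + 1) → H0 n 1) (z : Fin n → ℂ) : ℂ :=
  (Real.log (∑ i, ‖H0val (Φ i) (affineVec z)‖ ^ 2) : ℝ)

/-- The coefficient matrix `g_{jk̄} = ∂²(log r)/∂z_j ∂z̄_k` of the Fubini-Study Kähler form
`ω = i ∑ g_{jk̄} dz_j ∧ dz̄_k = i ∂∂̄ log r`, the curvature form of the metric `|s|²/r` on `O(1)`,
in the affine chart. -/
def fsMatrix {n : ℕ} (Φ : Fin (n + 1) → H0 n 1) (z : Fin n → ℂ) : Matrix (Fin n) (Fin n) ℂ :=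
  Matrix.of fun j k => dz j (dzbar k (fsPotential Φ)) z

/-- The Fubini-Study volume `ω^n` as a measure on `P^n`, up to a constant factor: its density
in the affine chart with respect to Lebesgue measure is `det (g_{jk̄})`, and the hyperplane outside
the chart is a null set. -/
def fsVolume {n : ℕ} (Φ : Fin (n + 1) → H0 n 1) : Measure (CPn n) :=
  ((volume : Measure (Fin n → ℂ)).withDensity
    fun z => ENNReal.ofReal (fsMatrix Φ z).det.re).map affineChart

/-- The Fubini-Study volume form `Ω` on `P^n`, normalized to have total mass `1`. -/
def fubiniStudy {n : ℕ} (Φ : Fin (n + 1) → H0 n 1) : Measure (CPn n) :=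
  (fsVolume Φ Set.univ)⁻¹ • fsVolume Φ

/-- The integrand `s₁ conj(s₂) / (r^m p)`, a function on `P^n` (the value does not depend on the
representative of `x`). -/
def innerIntegrand {n d : ℕ} (Φ : Fin (n + 1) → H0 n 1)
    (a : (Fin (n + 1) → ℕ) → (Fin (n + 1) → ℕ) → ℂ) (m : ℕ) (s₁ s₂ : H0 n (m + d))
    (x : CPn n) : ℂ :=
  H0val s₁ x.rep * conj (H0val s₂ x.rep) / rpPol d Φ a m x.rep x.rep

/-- The inner product `(s₁, s₂) = ∫ s₁ conj(s₂) / (r^m p) Ω` on `H^0(P^n, O(m+d))`. -/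
def sectionInner {n d : ℕ} (Φ : Fin (n + 1) → H0 n 1)
    (a : (Fin (n + 1) → ℕ) → (Fin (n + 1) → ℕ) → ℂ) (m : ℕ) (s₁ s₂ : H0 n (m + d)) : ℂ :=
  ∫ x, innerIntegrand Φ a m s₁ s₂ x ∂(fubiniStudy Φ)

/-- The norm `‖s‖ = √(s, s)` on `H^0(P^n, O(m+d))`. -/
def sectionNorm {n d : ℕ} (Φ : Fin (n + 1) → H0 n 1)
    (a : (Fin (n + 1) → ℕ) → (Fin (n + 1) → ℕ) → ℂ) (m : ℕ) (s : H0 n (m + d)) : ℝ :=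
  Real.sqrt (sectionInner Φ a m s s).re

/-- The integrand
`(r^m p)(x, ȳ) conj(s₂(x)) s₁(y) / ((r^m p)(x, x̄) (r^m p)(y, ȳ))`, a function on `P^n × P^n`
(the value does not depend on the representatives of `x` and `y`). -/
def kernelIntegrand {n d : ℕ} (Φ : Fin (n + 1) → H0 n 1)
    (a : (Fin (n + 1) → ℕ) → (Fin (n + 1) → ℕ) → ℂ) (m : ℕ) (s₁ s₂ : H0 n (m + d))
    (x y : CPn n) : ℂ :=
  rpPol d Φ a m x.rep y.rep * conj (H0val s₂ x.rep) * H0val s₁ y.rep /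
    (rpPol d Φ a m x.rep x.rep * rpPol d Φ a m y.rep y.rep)

/-- The form `K_{r^m p}(s₁, s₂)` on `H^0(P^n, O(m+d))`. -/
def kernelForm {n d : ℕ} (Φ : Fin (n + 1) → H0 n 1)
    (a : (Fin (n + 1) → ℕ) → (Fin (n + 1) → ℕ) → ℂ) (m : ℕ) (s₁ s₂ : H0 n (m + d)) : ℂ :=
  ∫ x, ∫ y, kernelIntegrand Φ a m s₁ s₂ x y ∂(fubiniStudy Φ) ∂(fubiniStudy Φ)

/-- `K` is a positive definite Hermitian form on the complex vector space `H`, linear in the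
first and conjugate-linear in the second variable. -/
structure IsPosDefForm {H : Type*} [AddCommGroup H] [Module ℂ H] (K : H → H → ℂ) : Prop where
  add_left : ∀ s₁ s₂ t, K (s₁ + s₂) t = K s₁ t + K s₂ t
  smul_left : ∀ (c : ℂ) s t, K (c • s) t = c * K s t
  conj_symm : ∀ s t, conj (K s t) = K t s
  pos : ∀ s, s ≠ 0 → 0 < K s s

end

/-! In the linear coordinates `A v = (Φ_i(v))` the function `r` becomes the squared Euclidean norm,
and by `fubiniStudy_eq_map` the measure Ω is the image of the standard Gaussian on ℂ^(n+1) under u ↦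
[A⁻¹u]. Sections become homogeneous holomorphic functions S of degree m + d on ℂ^(n+1) ∖ {0}, and
both forms become Gaussian integrals of functions of degree 0. Unitary invariance of the Gaussian
then replaces local geometry on projective space.

Fix a unit vector x and rescale y to w = y/⟨y,x⟩, so that ⟨w,x⟩ = 1. The operator with kernel r^m P
applied to S integrates |w|^(-2m) S(w) P(x,w̄)/P(w,w̄). The quotient is not holomorphic in w, but to
first order at x its antiholomorphic variations cancel: it equals 2 − P(w,x̄)/P(x,x̄) + O(|w−x|²
|w|^d) (`norm_quotRem_le`). The main part is holomorphic in w, and averaging over rotations of the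
orthogonal complement of x replaces it by its value at w = x (`integral_meanFun`). This yields S(x)
times the m-th moment of the squared cosine, which is m! n!/(m+n)! = n!/m^n + O(m^(-n-1)).

For the remainder, |w−x|² = |w|² − 1. With t = |w|^(-2) the squared cosine of the angle between x
and y, the remainder is bounded by the fibre norm of S at y times t^j(1−t), as long as 2j + 2d + 2 ≤
m (`norm_integral_opIntegrand_sub_le`). Pairing with S and applying Schur's test
(`integral_fibreNorm_profile_le`) costs only the row integral of this kernel, a difference of
consecutive moments, which is O(j^(-n-1)); j is taken about m/2. Since P is bounded above and below
on the unit sphere, fibre norms and the weighted norm are comparable uniformly in m. No cut-off near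
the diagonal is made, so the error is O(m^(-n-1)) without logarithms, which is stronger than
required. Positivity for large m follows because the main term dominates. -/

/-! ### Hermitian algebra and the Gaussian measure on ℂ^k. -/

/-- The squared Euclidean norm `∑ i, |v_i|²` on `ℂ^k`. -/
noncomputable def nsq {k : ℕ} (v : Fin k → ℂ) : ℝ := ∑ i, ‖v i‖ ^ 2

/-- The standard Hermitian form `∑ i, v_i conj(w_i)` on `ℂ^k`. -/
noncomputable def herm {k : ℕ} (v w : Fin k → ℂ) : ℂ := ∑ i, v i * conj (w i)

/-- The standard complex Gaussian probability measure on `ℂ^k`. -/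
noncomputable def gauss (k : ℕ) : Measure (Fin k → ℂ) :=
  volume.withDensity fun v => ENNReal.ofReal (Real.exp (-nsq v) / Real.pi ^ k)

theorem continuous_nsq {k : ℕ} : Continuous (nsq : (Fin k → ℂ) → ℝ) := by
  unfold nsq; fun_prop

theorem nsq_nonneg {k : ℕ} (v : Fin k → ℂ) : 0 ≤ nsq v :=
  Finset.sum_nonneg fun i _ => by positivity

theorem nsq_smul {k : ℕ} (c : ℂ) (v : Fin k → ℂ) : nsq (c • v) = ‖c‖ ^ 2 * nsq v := by
  simp [nsq, mul_pow, Finset.mul_sum]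

theorem nsq_eq_zero {k : ℕ} {v : Fin k → ℂ} : nsq v = 0 ↔ v = 0 := by
  rw [nsq, Finset.sum_eq_zero_iff_of_nonneg fun i _ => by positivity]
  simp [funext_iff]

theorem nsq_pos {k : ℕ} {v : Fin k → ℂ} (hv : v ≠ 0) : 0 < nsq v :=
  lt_of_le_of_ne (nsq_nonneg v) fun h => hv (nsq_eq_zero.1 h.symm)

theorem norm_sq_le_nsq {k : ℕ} (v : Fin k → ℂ) (i : Fin k) : ‖v i‖ ^ 2 ≤ nsq v :=
  Finset.single_le_sum (f := fun i => ‖v i‖ ^ 2) (fun i _ => by positivity) (Finset.mem_univ i)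

theorem herm_self {k : ℕ} (v : Fin k → ℂ) : herm v v = nsq v := by
  simp [herm, nsq, Complex.mul_conj, Complex.normSq_eq_norm_sq]

theorem conj_herm {k : ℕ} (v w : Fin k → ℂ) : conj (herm v w) = herm w v := by
  simp [herm, mul_comm]

theorem herm_smul_left {k : ℕ} (c : ℂ) (v w : Fin k → ℂ) : herm (c • v) w = c * herm v w := by
  simp [herm, Finset.mul_sum, mul_assoc]

theorem herm_add_left {k : ℕ} (u v w : Fin k → ℂ) : herm (u + v) w = herm u w + herm v w := by
  simp [herm, add_mul, Finset.sum_add_distrib]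

theorem herm_sub_left {k : ℕ} (u v w : Fin k → ℂ) : herm (u - v) w = herm u w - herm v w := by
  simp [herm, sub_mul, Finset.sum_sub_distrib]

theorem norm_herm_comm {k : ℕ} (v w : Fin k → ℂ) : ‖herm v w‖ = ‖herm w v‖ := by
  rw [← conj_herm w v, RCLike.norm_conj]

theorem herm_smul_right {k : ℕ} (c : ℂ) (v w : Fin k → ℂ) :
    herm v (c • w) = conj c * herm v w := by
  rw [← conj_herm, herm_smul_left, map_mul, conj_herm]

theorem continuous_herm {k : ℕ} :
    Continuous fun q : (Fin k → ℂ) × (Fin k → ℂ) => herm q.1 q.2 := by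
  unfold herm; fun_prop

theorem continuous_affineVec {n : ℕ} : Continuous (affineVec : (Fin n → ℂ) → Fin (n + 1) → ℂ) := by
  unfold affineVec
  refine continuous_pi fun i => ?_
  refine Fin.cases ?_ (fun j => ?_) i
  · simpa using continuous_const
  · simpa using continuous_apply j

/-! ### Changes of variables and Gaussian integrals. -/

/-- The real determinant of a complex linear map is the squared modulus of its complex determinant.
-/
theorem map_linearEquiv_volume {k : ℕ} (L : (Fin k → ℂ) ≃ₗ[ℂ] (Fin k → ℂ)) :
    Measure.map L volume =
      ENNReal.ofReal (Complex.normSq (LinearMap.det (L : (Fin k → ℂ) →ₗ[ℂ] (Fin k → ℂ))))⁻¹ •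
        (volume : Measure (Fin k → ℂ)) := by
  have hdet : LinearMap.det ((L : (Fin k → ℂ) →ₗ[ℂ] (Fin k → ℂ)).restrictScalars ℝ) =
      Complex.normSq (LinearMap.det (L : (Fin k → ℂ) →ₗ[ℂ] (Fin k → ℂ))) := by
    rw [LinearMap.det_restrictScalars, Algebra.norm_complex_apply]
  have hne : LinearMap.det (L : (Fin k → ℂ) →ₗ[ℂ] (Fin k → ℂ)) ≠ 0 :=
    (LinearEquiv.isUnit_det' L).ne_zero
  have := Measure.map_linearMap_addHaar_eq_smul_addHaar (volume : Measure (Fin k → ℂ))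
    (f := (L : (Fin k → ℂ) →ₗ[ℂ] (Fin k → ℂ)).restrictScalars ℝ)
    (by rw [hdet]; simpa using hne)
  rw [hdet, abs_of_nonneg (inv_nonneg.2 (Complex.normSq_nonneg _))] at this
  exact this

theorem lintegral_smul_comp {n : ℕ} (c : ℂ) (hc : c ≠ 0) (f : (Fin n → ℂ) → ENNReal)
    (hf : Measurable f) :
    ∫⁻ v, f v = ENNReal.ofReal (‖c‖ ^ (2 * n)) * ∫⁻ z, f (c • z) := by
  let L : (Fin n → ℂ) ≃ₗ[ℂ] (Fin n → ℂ) := LinearEquiv.smulOfNeZero ℂ _ c hc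
  have hL : Measurable L := (LinearMap.continuous_of_finiteDimensional
    (L : (Fin n → ℂ) →ₗ[ℂ] (Fin n → ℂ))).measurable
  have hdet : LinearMap.det (L : (Fin n → ℂ) →ₗ[ℂ] (Fin n → ℂ)) = c ^ n := by
    have : (L : (Fin n → ℂ) →ₗ[ℂ] (Fin n → ℂ)) = c • LinearMap.id := rfl
    rw [this, LinearMap.det_smul]; simp
  have h1 : ∫⁻ z, f (c • z) = ∫⁻ v, f v ∂(Measure.map L volume) := (lintegral_map hf hL).symm
  have hpos : 0 < ‖c‖ ^ (2 * n) := by have := norm_pos_iff.2 hc; positivity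
  rw [h1, map_linearEquiv_volume, hdet, lintegral_smul_measure, smul_eq_mul, ← mul_assoc,
    Complex.normSq_eq_norm_sq, norm_pow, ← pow_mul, mul_comm n 2,
    ← ENNReal.ofReal_mul hpos.le, mul_inv_cancel₀ hpos.ne']
  simp

/-- For fixed c ≠ 0, the substitution z ↦ cz in the last n coordinates has real Jacobian |c|^(2n);
Tonelli then moves the integral along each line inside. -/
theorem lintegral_eq_lintegral_affineVec {n : ℕ} (f : (Fin (n + 1) → ℂ) → ENNReal)
    (hf : Measurable f) :
    ∫⁻ v, f v = ∫⁻ z : Fin n → ℂ, ∫⁻ c : ℂ, ENNReal.ofReal (‖c‖ ^ (2 * n)) *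
      f (c • affineVec z) := by
  have hmp := volume_preserving_piFinSuccAbove (fun _ : Fin (n + 1) => ℂ) 0
  have hcons : ∀ p : ℂ × (Fin n → ℂ),
      (MeasurableEquiv.piFinSuccAbove (fun _ : Fin (n + 1) => ℂ) 0).symm p = Fin.cons p.1 p.2 := by
    intro p
    rw [MeasurableEquiv.piFinSuccAbove_symm_apply]
    simp [Fin.insertNthEquiv]
  have hfm := hf.comp (MeasurableEquiv.piFinSuccAbove (fun _ : Fin (n + 1) => ℂ) 0).symm.measurable
  have h1 : ∫⁻ v, f v = ∫⁻ p : ℂ × (Fin n → ℂ), f (Fin.cons p.1 p.2) := by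
    rw [← (hmp.symm).lintegral_comp hf]
    exact lintegral_congr fun p => by rw [hcons]
  have hfm' : Measurable fun p : ℂ × (Fin n → ℂ) => f (Fin.cons p.1 p.2) := by
    simpa only [Function.comp_def, hcons] using hfm
  have hme : Measurable fun p : ℂ × (Fin n → ℂ) => p.1 • affineVec p.2 :=
    (continuous_fst.smul (continuous_affineVec.comp continuous_snd)).measurable
  rw [h1, Measure.volume_eq_prod, lintegral_prod _ hfm'.aemeasurable]
  trans ∫⁻ c : ℂ, ∫⁻ z : Fin n → ℂ, ENNReal.ofReal (‖c‖ ^ (2 * n)) * f (c • affineVec z)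
  · have hae : ∀ᵐ c : ℂ, c ≠ 0 := by simp [ae_iff]
    refine lintegral_congr_ae ?_
    filter_upwards [hae] with c hc
    have hfc : Measurable fun z : Fin n → ℂ => f (Fin.cons c z) :=
      hfm'.comp (measurable_const.prodMk measurable_id)
    have hfc' : Measurable fun z : Fin n → ℂ => f (Fin.cons c (c • z)) :=
      hfc.comp (measurable_const_smul c)
    rw [lintegral_smul_comp c hc _ hfc, ← lintegral_const_mul _ hfc']
    · refine lintegral_congr fun z => ?_
      congr 2
      ext i
      refine Fin.cases ?_ (fun j => ?_) i <;> simp [affineVec]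
  · refine lintegral_lintegral_swap (Measurable.aemeasurable ?_)
    refine Measurable.mul ?_ ?_
    · exact (ENNReal.continuous_ofReal.comp (by fun_prop)).measurable
    · exact hf.comp hme

theorem integral_norm_pow_mul_exp (j : ℕ) {b : ℝ} (hb : 0 < b) :
    ∫ c : ℂ, ‖c‖ ^ (2 * j) * Real.exp (-(b * ‖c‖ ^ 2)) = Real.pi * j ! / b ^ (j + 1) := by
  have h := Complex.integral_rpow_mul_exp_neg_mul_rpow (p := 2) (q := (2 * j : ℕ)) (b := b)
    (by norm_num) (by have : (0 : ℝ) ≤ ((2 * j : ℕ) : ℝ) := by positivity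
                      linarith) hb
  have e1 : (((2 * j : ℕ) : ℝ) + 2) / 2 = (j : ℝ) + 1 := by push_cast; ring
  have e2 : -(((2 * j : ℕ) : ℝ) + 2) / 2 = -((j + 1 : ℕ) : ℝ) := by push_cast; ring
  rw [e1, e2, Real.Gamma_nat_eq_factorial, Real.rpow_neg hb.le, Real.rpow_natCast] at h
  simp only [Real.rpow_natCast, Real.rpow_two, neg_mul] at h
  rw [h]
  field_simp

theorem lintegral_norm_pow_mul_exp (j : ℕ) {b : ℝ} (hb : 0 < b) :
    ∫⁻ c : ℂ, ENNReal.ofReal (‖c‖ ^ (2 * j) * Real.exp (-(b * ‖c‖ ^ 2))) =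
      ENNReal.ofReal (Real.pi * j ! / b ^ (j + 1)) := by
  have h := integral_norm_pow_mul_exp j hb
  rw [← ofReal_integral_eq_lintegral_ofReal _ (ae_of_all _ fun c => by positivity), h]
  -- A nonintegrable function has Bochner integral 0 by convention, so the positive value already
  -- computed forces integrability.
  by_contra hi
  rw [integral_undef hi] at h
  have : 0 < Real.pi * j ! / b ^ (j + 1) := by positivity
  exact absurd h this.ne

/-- Integration in the coordinates `v = c (1, z)` of a homogeneous function times a Gaussian. -/
theorem lintegral_homogeneous_mul_exp {n : ℕ} (m : ℕ) (G : (Fin (n + 1) → ℂ) → ENNReal)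
    (hG : Measurable G) (hGh : ∀ (c : ℂ) (v : Fin (n + 1) → ℂ), c ≠ 0 → G (c • v) = G v)
    (q : (Fin (n + 1) → ℂ) → ℝ) (hq : Measurable q) (hqh : ∀ (c : ℂ) v, q (c • v) = ‖c‖ ^ 2 * q v)
    (hqp : ∀ z, 0 < q (affineVec z)) :
    ∫⁻ v, G v * ENNReal.ofReal (‖v 0‖ ^ (2 * m) * Real.exp (-q v)) =
      ∫⁻ z : Fin n → ℂ, G (affineVec z) *
        ENNReal.ofReal (Real.pi * (n + m)! / q (affineVec z) ^ (n + m + 1)) := by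
  have hmeas : Measurable fun v : Fin (n + 1) → ℂ =>
      G v * ENNReal.ofReal (‖v 0‖ ^ (2 * m) * Real.exp (-q v)) :=
    hG.mul (((((continuous_apply (0 : Fin (n + 1))).norm).pow (2 * m)).measurable.mul
      (Real.measurable_exp.comp hq.neg)).ennreal_ofReal)
  -- On the line through (1, z) the factor `G` is constant and the Jacobian |c|^(2n) joins |c|^(2m),
  -- so the inner integral is the one-variable Gaussian moment of order n + m.
  rw [lintegral_eq_lintegral_affineVec _ hmeas]
  refine lintegral_congr fun z => ?_
  rw [← lintegral_norm_pow_mul_exp (n + m) (hqp z), ← lintegral_const_mul]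
  · have hae : ∀ᵐ c : ℂ, c ≠ 0 := by simp [ae_iff]
    refine lintegral_congr_ae ?_
    filter_upwards [hae] with c hc
    rw [hGh c _ hc, hqh, mul_left_comm, ← ENNReal.ofReal_mul (by positivity)]
    congr 2
    simp only [affineVec, Pi.smul_apply, Fin.cons_zero, smul_eq_mul, mul_one]
    ring_nf
  · exact ENNReal.measurable_ofReal.comp (by fun_prop)

theorem lintegral_exp_nsq (n m : ℕ) :
    ∫⁻ v : Fin (n + 1) → ℂ, ENNReal.ofReal (‖v 0‖ ^ (2 * m) * Real.exp (-nsq v)) =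
      ENNReal.ofReal (Real.pi ^ (n + 1) * m !) := by
  have h : ∫ v : Fin (n + 1) → ℂ, ‖v 0‖ ^ (2 * m) * Real.exp (-nsq v) =
      Real.pi ^ (n + 1) * m ! := by
    -- The extra power sits in coordinate 0 only; every other factor is a plain Gaussian integral.
    have h1 := integral_fintype_prod_volume_eq_prod (𝕜 := ℝ) (ι := Fin (n + 1))
      (E := fun _ => ℂ)
      (fun i c => ‖c‖ ^ (2 * (if i = 0 then m else 0)) * Real.exp (-(1 * ‖c‖ ^ 2)))
    simp only [integral_norm_pow_mul_exp _ one_pos] at h1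
    rw [Fin.prod_univ_succ] at h1
    simp only [Finset.prod_mul_distrib, ← Real.exp_sum, Fin.prod_univ_succ] at h1
    simp only [Fin.succ_ne_zero, if_true, if_false, mul_zero, pow_zero, one_pow, div_one,
      one_mul, Finset.prod_const_one, mul_one, Nat.factorial_zero, Nat.cast_one,
      Finset.prod_const, Finset.card_univ, Fintype.card_fin, Finset.sum_neg_distrib] at h1
    unfold nsq
    rw [h1]; ring
  rw [← ofReal_integral_eq_lintegral_ofReal _ (ae_of_all _ fun c => by positivity), h]
  by_contra hi
  rw [integral_undef hi] at h
  have : 0 < Real.pi ^ (n + 1) * m ! := by positivity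
  exact absurd h this.ne

theorem lintegral_gauss {k : ℕ} (f : (Fin k → ℂ) → ENNReal) (hf : Measurable f) :
    ∫⁻ v, f v ∂(gauss k) = ENNReal.ofReal (Real.pi ^ k)⁻¹ *
      ∫⁻ v, f v * ENNReal.ofReal (Real.exp (-nsq v)) := by
  have hm : Measurable fun v : Fin k → ℂ => ENNReal.ofReal (Real.exp (-nsq v)) :=
    (ENNReal.continuous_ofReal.comp (Real.continuous_exp.comp continuous_nsq.neg)).measurable
  rw [gauss, lintegral_withDensity_eq_lintegral_mul _ ?_ hf]
  · trans ∫⁻ v, ENNReal.ofReal (Real.pi ^ k)⁻¹ * (f v * ENNReal.ofReal (Real.exp (-nsq v)))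
    swap
    · exact lintegral_const_mul _ (hf.mul hm)
    refine lintegral_congr fun v => ?_
    rw [Pi.mul_apply, div_eq_inv_mul, ENNReal.ofReal_mul (by positivity)]
    ring
  · exact (ENNReal.continuous_ofReal.comp
      ((Real.continuous_exp.comp continuous_nsq.neg).div_const _)).measurable

instance isProbabilityMeasure_gauss (n : ℕ) : IsProbabilityMeasure (gauss (n + 1)) := by
  constructor
  rw [← lintegral_one, lintegral_gauss _ measurable_const]
  have h := lintegral_exp_nsq n 0
  simp only [mul_zero, pow_zero, one_mul, Nat.factorial_zero, Nat.cast_one, mul_one] at h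
  have hp : 0 < Real.pi ^ (n + 1) := by positivity
  simp only [one_mul, h]
  rw [← ENNReal.ofReal_mul (by positivity), inv_mul_cancel₀ hp.ne']
  simp

/-- The image measure is only shown to be a multiple of the Gaussian; comparing total masses makes
the factor 1, so |det L| = 1 need not be proved separately. -/
theorem measurePreserving_gauss {n : ℕ} (L : (Fin (n + 1) → ℂ) ≃ₗ[ℂ] (Fin (n + 1) → ℂ))
    (hL : ∀ v, nsq (L v) = nsq v) :
    MeasurePreserving L (gauss (n + 1)) (gauss (n + 1)) := by
  have hLm : Measurable L := (LinearMap.continuous_of_finiteDimensional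
    (L : (Fin (n + 1) → ℂ) →ₗ[ℂ] (Fin (n + 1) → ℂ))).measurable
  refine ⟨hLm, ?_⟩
  obtain ⟨K, hK⟩ : ∃ K : ENNReal, Measure.map L (gauss (n + 1)) = K • gauss (n + 1) := by
    refine ⟨ENNReal.ofReal (Complex.normSq (LinearMap.det
      (L : (Fin (n + 1) → ℂ) →ₗ[ℂ] (Fin (n + 1) → ℂ))))⁻¹,
      Measure.ext_of_lintegral _ fun f hf => ?_⟩
    · rw [lintegral_map hf hLm, lintegral_gauss (fun v => f (L v)) (hf.comp hLm), lintegral_smul_measure,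
        lintegral_gauss _ hf]
      have hm : Measurable fun v : Fin (n + 1) → ℂ =>
          f v * ENNReal.ofReal (Real.exp (-nsq v)) :=
        hf.mul (ENNReal.continuous_ofReal.comp
          (Real.continuous_exp.comp continuous_nsq.neg)).measurable
      have h1 : ∫⁻ v, f (L v) * ENNReal.ofReal (Real.exp (-nsq v)) =
          ∫⁻ v, f v * ENNReal.ofReal (Real.exp (-nsq v)) ∂(Measure.map L volume) := by
        rw [lintegral_map hm hLm]
        exact lintegral_congr fun v => by rw [hL]
      rw [h1, map_linearEquiv_volume, lintegral_smul_measure, smul_eq_mul, smul_eq_mul,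
        mul_left_comm]
  have h1 : Measure.map L (gauss (n + 1)) Set.univ = 1 := by
    rw [Measure.map_apply hLm MeasurableSet.univ]; simp
  rw [hK] at h1
  simp only [Measure.smul_apply, measure_univ, smul_eq_mul, mul_one] at h1
  rw [hK, h1, one_smul]

/-- Extending x to an orthonormal basis gives a unitary map. It moves integrals centred at x to ones
centred at the first coordinate vector. -/
theorem exists_linearEquiv_nsq {n : ℕ} (x : Fin (n + 1) → ℂ) (hx : nsq x = 1) :
    ∃ L : (Fin (n + 1) → ℂ) ≃ₗ[ℂ] (Fin (n + 1) → ℂ), L (Pi.single 0 1) = x ∧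
      (∀ v, nsq (L v) = nsq v) ∧ ∀ v w, herm (L v) (L w) = herm v w := by
  let E := EuclideanSpace ℂ (Fin (n + 1))
  have hin : ∀ v w : E, herm (WithLp.ofLp v) (WithLp.ofLp w) = inner ℂ w v := by
    intro v w
    rw [PiLp.inner_apply]
    simp [herm]
  have hno : ‖(WithLp.toLp 2 x : E)‖ = 1 := by
    rw [EuclideanSpace.norm_eq]
    simpa [nsq] using hx
  obtain ⟨b, hb⟩ := Orthonormal.exists_orthonormalBasis_extension_of_card_eq (𝕜 := ℂ) (E := E)
    (ι := Fin (n + 1)) (by simp [E]) (v := fun _ => WithLp.toLp 2 x) (s := {0})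
    (by
      rw [orthonormal_iff_ite]
      intro i j
      have : i = j := Subsingleton.elim _ _
      rw [if_pos this]
      simp [inner_self_eq_norm_sq_to_K, hno])
  let L : (Fin (n + 1) → ℂ) ≃ₗ[ℂ] (Fin (n + 1) → ℂ) :=
    (WithLp.linearEquiv 2 ℂ (Fin (n + 1) → ℂ)).symm ≪≫ₗ b.repr.symm.toLinearEquiv ≪≫ₗ
      WithLp.linearEquiv 2 ℂ (Fin (n + 1) → ℂ)
  have hLap : ∀ v, L v = WithLp.ofLp (b.repr.symm (WithLp.toLp 2 v)) := fun v => rfl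
  have hh : ∀ v w, herm (L v) (L w) = herm v w := by
    intro v w
    rw [hLap, hLap, hin, LinearIsometryEquiv.inner_map_map, ← hin]
  refine ⟨L, ?_, ?_, hh⟩
  · rw [hLap]
    have h0 := hb 0 rfl
    have : b.repr.symm (EuclideanSpace.single 0 1) = b 0 := b.repr_symm_single 0
    rw [h0] at this
    have h2 : (WithLp.toLp 2 (Pi.single 0 1) : E) = EuclideanSpace.single 0 1 := by
      rfl
    rw [h2, this]
  · intro v
    have := hh v v
    rw [herm_self, herm_self] at this
    exact_mod_cast this

/-! ### Moments of the squared cosine. -/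

/-- The squared cosine of the angle between the lines spanned by `x` and `y`. -/
noncomputable def cosSq {k : ℕ} (x y : Fin k → ℂ) : ℝ := ‖herm x y‖ ^ 2 / (nsq x * nsq y)

/-- The moment `m! n! / (m + n)!`. -/
noncomputable def betaMoment (n m : ℕ) : ℝ := (m ! * n ! : ℝ) / (m + n)!

theorem measurable_cosSq_right {k : ℕ} (x : Fin k → ℂ) : Measurable (cosSq x) :=
  (((continuous_herm.comp (Continuous.prodMk_right x)).norm.pow 2).measurable).div
    (continuous_const.mul continuous_nsq).measurable

/-- In the chart (1, z) the squared cosine with the first coordinate vector is 1/|(1,z)|², so the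
m-th moment is an integral of a power of |(1,z)|². The Gaussian integral of |v_0|^(2m) reduces to
the same integral and has a known value. -/
theorem lintegral_cosSq_single (n m : ℕ) :
    ∫⁻ v, ENNReal.ofReal (cosSq (Pi.single 0 1) v ^ m) ∂(gauss (n + 1)) =
      ENNReal.ofReal (betaMoment n m) := by
  have hG : Measurable fun v : Fin (n + 1) → ℂ =>
      ENNReal.ofReal (cosSq (Pi.single 0 1) v ^ m) :=
    ((measurable_cosSq_right _).pow_const m).ennreal_ofReal
  have hpos : ∀ z : Fin n → ℂ, 0 < nsq (affineVec z) := fun z => nsq_pos (affineVec_ne_zero z)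
  have h1 := lintegral_homogeneous_mul_exp 0 _ hG
    (fun c v hc => by
      have : ‖c‖ ≠ 0 := by simpa using hc
      congr 2
      rw [cosSq, cosSq, herm_smul_right, nsq_smul, norm_mul, RCLike.norm_conj]
      field_simp) nsq continuous_nsq.measurable nsq_smul hpos
  have h2 := lintegral_homogeneous_mul_exp m (fun _ : Fin (n + 1) → ℂ => 1) measurable_const
    (fun c v hc => rfl) nsq continuous_nsq.measurable nsq_smul hpos
  simp only [one_mul, lintegral_exp_nsq] at h2
  simp only [mul_zero, pow_zero, one_mul, add_zero] at h1
  rw [lintegral_gauss _ hG, h1]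
  have h3 : ∫⁻ z : Fin n → ℂ, ENNReal.ofReal (cosSq (Pi.single 0 1) (affineVec z) ^ m) *
      ENNReal.ofReal (Real.pi * n ! / nsq (affineVec z) ^ (n + 1)) =
      ENNReal.ofReal ((n ! : ℝ) / (n + m)!) * ∫⁻ z : Fin n → ℂ,
        ENNReal.ofReal (Real.pi * (n + m)! / nsq (affineVec z) ^ (n + m + 1)) := by
    rw [← lintegral_const_mul]
    · refine lintegral_congr fun z => ?_
      have hp := hpos z
      have h4 : cosSq (Pi.single 0 1) (affineVec z) = (nsq (affineVec z))⁻¹ := by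
        have e1 : herm (Pi.single 0 1) (affineVec z) = 1 := by
          simp [herm, Fin.sum_univ_succ, affineVec]
        have e2 : nsq (Pi.single 0 1 : Fin (n + 1) → ℂ) = 1 := by
          simp [nsq, Fin.sum_univ_succ]
        rw [cosSq, e1, e2]; simp
      rw [h4, ← ENNReal.ofReal_mul (by positivity), ← ENNReal.ofReal_mul (by positivity)]
      congr 1
      rw [inv_pow]
      field_simp
      ring
    · refine ((continuous_const.div ((continuous_nsq.comp continuous_affineVec).pow _)
        fun z => ?_).measurable).ennreal_ofReal
      exact (pow_pos (hpos z) _).ne'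
  rw [h3, ← h2, ← ENNReal.ofReal_mul (by positivity), ← ENNReal.ofReal_mul (by positivity)]
  congr 1
  rw [betaMoment, add_comm m n]
  field_simp

theorem herm_sq_le {k : ℕ} (x y : Fin k → ℂ) : ‖herm x y‖ ^ 2 ≤ nsq x * nsq y := by
  have h1 : ‖herm x y‖ ≤ ∑ i, ‖x i‖ * ‖y i‖ :=
    (norm_sum_le _ _).trans (le_of_eq (Finset.sum_congr rfl fun i _ => by simp))
  calc ‖herm x y‖ ^ 2 ≤ (∑ i, ‖x i‖ * ‖y i‖) ^ 2 := by gcongr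
    _ ≤ nsq x * nsq y := Finset.sum_mul_sq_le_sq_mul_sq _ _ _

theorem cosSq_nonneg {k : ℕ} (x y : Fin k → ℂ) : 0 ≤ cosSq x y :=
  div_nonneg (by positivity) (mul_nonneg (nsq_nonneg x) (nsq_nonneg y))

theorem cosSq_le_one {k : ℕ} (x y : Fin k → ℂ) : cosSq x y ≤ 1 :=
  div_le_one_of_le₀ (herm_sq_le x y) (mul_nonneg (nsq_nonneg x) (nsq_nonneg y))

theorem cosSq_comm {k : ℕ} (x y : Fin k → ℂ) : cosSq x y = cosSq y x := by
  rw [cosSq, cosSq, norm_herm_comm, mul_comm (nsq x)]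

theorem integrable_cosSq_pow {n : ℕ} (x : Fin (n + 1) → ℂ) (m : ℕ) :
    Integrable (fun y => cosSq x y ^ m) (gauss (n + 1)) := by
  refine Integrable.of_bound ((measurable_cosSq_right x).pow_const m).aestronglyMeasurable 1
    (ae_of_all _ fun y => ?_)
  rw [Real.norm_of_nonneg (pow_nonneg (cosSq_nonneg x y) m)]
  exact pow_le_one₀ (cosSq_nonneg x y) (cosSq_le_one x y)

theorem integral_cosSq_of_nsq_eq_one {n : ℕ} {x : Fin (n + 1) → ℂ} (hx : nsq x = 1) (m : ℕ) :
    ∫ y, cosSq x y ^ m ∂(gauss (n + 1)) = betaMoment n m := by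
  obtain ⟨L, hL0, hLn, hLh⟩ := exists_linearEquiv_nsq x hx
  have hmp := measurePreserving_gauss L hLn
  have hm := ((measurable_cosSq_right x).pow_const m)
  rw [integral_eq_lintegral_of_nonneg_ae (ae_of_all _ fun y => pow_nonneg (cosSq_nonneg x y) m)
    hm.aestronglyMeasurable, ← hmp.lintegral_comp hm.ennreal_ofReal]
  have : ∀ v, cosSq x (L v) = cosSq (Pi.single 0 1) v := by
    intro v
    have hx' : nsq (Pi.single 0 1 : Fin (n + 1) → ℂ) = nsq x := by rw [← hL0, hLn]
    rw [cosSq, cosSq, hLn, hx', ← hLh (Pi.single 0 1), hL0]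
  simp only [this]
  rw [lintegral_cosSq_single, ENNReal.toReal_ofReal (by unfold betaMoment; positivity)]

theorem cosSq_smul_left {k : ℕ} {c : ℂ} (hc : c ≠ 0) (x y : Fin k → ℂ) :
    cosSq (c • x) y = cosSq x y := by
  have : ‖c‖ ≠ 0 := by simpa using hc
  rw [cosSq, cosSq, herm_smul_left, nsq_smul, norm_mul]
  field_simp

theorem exists_unit_smul {k : ℕ} {x : Fin k → ℂ} (hx : x ≠ 0) :
    ∃ (c : ℝ) (u : Fin k → ℂ), 0 < c ∧ c ^ 2 = nsq x ∧ nsq u = 1 ∧ x = (c : ℂ) • u := by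
  have hp := nsq_pos hx
  have hs : 0 < Real.sqrt (nsq x) := Real.sqrt_pos.2 hp
  refine ⟨Real.sqrt (nsq x), ((Real.sqrt (nsq x) : ℂ))⁻¹ • x, hs, Real.sq_sqrt hp.le, ?_, ?_⟩
  · rw [nsq_smul, norm_inv, Complex.norm_real, Real.norm_of_nonneg hs.le, inv_pow,
      Real.sq_sqrt hp.le, inv_mul_cancel₀ hp.ne']
  · rw [smul_smul, mul_inv_cancel₀ (by exact_mod_cast hs.ne'), one_smul]

theorem integral_cosSq {n : ℕ} {x : Fin (n + 1) → ℂ} (hx : x ≠ 0) (m : ℕ) :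
    ∫ y, cosSq x y ^ m ∂(gauss (n + 1)) = betaMoment n m := by
  obtain ⟨c, u, hc, -, hu, rfl⟩ := exists_unit_smul hx
  simp only [cosSq_smul_left (Complex.ofReal_ne_zero.2 hc.ne')]
  exact integral_cosSq_of_nsq_eq_one hu m

/-! ### Bihomogeneous polynomials and the Taylor remainder of their quotients. -/

/-- The monomial `v^α`. -/
def monom {k : ℕ} (α : Fin k → ℕ) (v : Fin k → ℂ) : ℂ := ∏ i, v i ^ α i

/-- The bihomogeneous polynomial `∑ a_{αβ} v^α conj(w^β)` of bidegree `(d, d)`. -/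
def biPol {n : ℕ} (d : ℕ) (a : (Fin (n + 1) → ℕ) → (Fin (n + 1) → ℕ) → ℂ)
    (v w : Fin (n + 1) → ℂ) : ℂ :=
  ∑ α ∈ multiIndices n d, ∑ β ∈ multiIndices n d, a α β * monom α v * conj (monom β w)

/-- The sum of the absolute values of the coefficients of a bihomogeneous polynomial. -/
noncomputable def coeffSum (n d : ℕ) (a : (Fin (n + 1) → ℕ) → (Fin (n + 1) → ℕ) → ℂ) : ℝ :=
  ∑ α ∈ multiIndices n d, ∑ β ∈ multiIndices n d, ‖a α β‖

/-- The Euclidean norm on `ℂ^k`. -/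
noncomputable def enorm2 {k : ℕ} (v : Fin k → ℂ) : ℝ := Real.sqrt (nsq v)

theorem enorm2_nonneg {k : ℕ} (v : Fin k → ℂ) : 0 ≤ enorm2 v := Real.sqrt_nonneg _

theorem enorm2_sq {k : ℕ} (v : Fin k → ℂ) : enorm2 v ^ 2 = nsq v := Real.sq_sqrt (nsq_nonneg v)

theorem enorm2_pos {k : ℕ} {v : Fin k → ℂ} (hv : v ≠ 0) : 0 < enorm2 v :=
  Real.sqrt_pos.2 (nsq_pos hv)

theorem enorm2_smul {k : ℕ} (c : ℂ) (v : Fin k → ℂ) : enorm2 (c • v) = ‖c‖ * enorm2 v := by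
  rw [enorm2, nsq_smul, Real.sqrt_mul (by positivity), Real.sqrt_sq (norm_nonneg c), enorm2]

theorem continuous_enorm2 {k : ℕ} : Continuous (enorm2 : (Fin k → ℂ) → ℝ) :=
  continuous_nsq.sqrt

theorem norm_le_enorm2 {k : ℕ} (v : Fin k → ℂ) (i : Fin k) : ‖v i‖ ≤ enorm2 v :=
  Real.le_sqrt_of_sq_le (norm_sq_le_nsq v i)

theorem norm_herm_le {k : ℕ} (x y : Fin k → ℂ) : ‖herm x y‖ ≤ enorm2 x * enorm2 y := by
  refine abs_le_of_sq_le_sq' ?_ (mul_nonneg (enorm2_nonneg x) (enorm2_nonneg y)) |>.2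
  rw [mul_pow, enorm2_sq, enorm2_sq]
  exact herm_sq_le x y

theorem sum_of_mem_multiIndices {n d : ℕ} {α : Fin (n + 1) → ℕ} (h : α ∈ multiIndices n d) :
    ∑ i, α i = d := (Finset.mem_piAntidiag.1 h).1

theorem monom_smul {n d : ℕ} {α : Fin (n + 1) → ℕ} (h : α ∈ multiIndices n d) (c : ℂ)
    (v : Fin (n + 1) → ℂ) : monom α (c • v) = c ^ d * monom α v := by
  simp [monom, mul_pow, Finset.prod_mul_distrib, Finset.prod_pow_eq_pow_sum,
    sum_of_mem_multiIndices h]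

theorem differentiable_monom {k : ℕ} (α : Fin k → ℕ) : Differentiable ℂ (monom α) := by
  unfold monom; fun_prop

theorem norm_monom_le {n d : ℕ} {α : Fin (n + 1) → ℕ} (h : α ∈ multiIndices n d)
    (v : Fin (n + 1) → ℂ) : ‖monom α v‖ ≤ enorm2 v ^ d := by
  rw [monom, norm_prod, ← sum_of_mem_multiIndices h, ← Finset.prod_pow_eq_pow_sum]
  refine Finset.prod_le_prod (fun i _ => norm_nonneg _) fun i _ => ?_
  rw [norm_pow]
  exact pow_le_pow_left₀ (norm_nonneg _) (norm_le_enorm2 v i) _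

/-- Telescoping. The exponent of ρ is j rather than j − 1; this is harmless as ρ ≥ 1, and makes the
exponents add up to the total degree for products of powers. -/
theorem norm_pow_sub_pow_le {ρ ε : ℝ} (hρ : 1 ≤ ρ) {a b : ℂ} (ha : ‖a‖ ≤ ρ) (hb : ‖b‖ ≤ ρ)
    (hab : ‖a - b‖ ≤ ε) (j : ℕ) : ‖a ^ j - b ^ j‖ ≤ j * ε * ρ ^ j := by
  have hε : 0 ≤ ε := (norm_nonneg _).trans hab
  have hρ0 : 0 ≤ ρ := zero_le_one.trans hρ
  induction j with
  | zero => simp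
  | succ j ih =>
    have e : a ^ (j + 1) - b ^ (j + 1) = a ^ j * (a - b) + (a ^ j - b ^ j) * b := by ring
    rw [e]
    refine (norm_add_le _ _).trans ?_
    rw [norm_mul, norm_mul, norm_pow]
    have h1 : ‖a‖ ^ j * ‖a - b‖ ≤ ρ ^ j * ε := by gcongr
    have h2 : ‖a ^ j - b ^ j‖ * ‖b‖ ≤ j * ε * ρ ^ j * ρ := by gcongr
    have h3 : ρ ^ j * ε ≤ ε * ρ ^ (j + 1) := by
      rw [mul_comm, pow_succ]
      exact mul_le_mul_of_nonneg_left (le_mul_of_one_le_right (by positivity) hρ) hε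
    push_cast
    calc ‖a‖ ^ j * ‖a - b‖ + ‖a ^ j - b ^ j‖ * ‖b‖
        ≤ ε * ρ ^ (j + 1) + j * ε * ρ ^ j * ρ := by linarith
      _ = (j + 1) * ε * ρ ^ (j + 1) := by ring

theorem norm_prod_pow_sub_le {ι : Type*} (s : Finset ι) (α : ι → ℕ) {ρ ε : ℝ} (hρ : 1 ≤ ρ)
    {v w : ι → ℂ} (hv : ∀ i, ‖v i‖ ≤ ρ) (hw : ∀ i, ‖w i‖ ≤ ρ) (hvw : ∀ i, ‖v i - w i‖ ≤ ε) :
    ‖∏ i ∈ s, v i ^ α i - ∏ i ∈ s, w i ^ α i‖ ≤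
      (∑ i ∈ s, α i : ℕ) * ε * ρ ^ (∑ i ∈ s, α i) := by
  classical
  have hρ0 : 0 ≤ ρ := zero_le_one.trans hρ
  induction s using Finset.induction_on with
  | empty => simp
  | insert i s hi ih =>
    have hε : 0 ≤ ε := (norm_nonneg _).trans (hvw i)
    rw [Finset.prod_insert hi, Finset.prod_insert hi, Finset.sum_insert hi]
    have hb : ‖∏ i ∈ s, w i ^ α i‖ ≤ ρ ^ (∑ i ∈ s, α i) := by
      rw [norm_prod, ← Finset.prod_pow_eq_pow_sum]
      refine Finset.prod_le_prod (fun i _ => norm_nonneg _) fun i _ => ?_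
      rw [norm_pow]
      exact pow_le_pow_left₀ (norm_nonneg _) (hw i) _
    have e : v i ^ α i * ∏ i ∈ s, v i ^ α i - w i ^ α i * ∏ i ∈ s, w i ^ α i =
      v i ^ α i * (∏ i ∈ s, v i ^ α i - ∏ i ∈ s, w i ^ α i) +
        (v i ^ α i - w i ^ α i) * ∏ i ∈ s, w i ^ α i := by ring
    rw [e]
    refine (norm_add_le _ _).trans ?_
    rw [norm_mul, norm_mul, norm_pow]
    have h1 : ‖v i‖ ^ α i * ‖∏ i ∈ s, v i ^ α i - ∏ i ∈ s, w i ^ α i‖ ≤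
        ρ ^ α i * ((∑ i ∈ s, α i : ℕ) * ε * ρ ^ (∑ i ∈ s, α i)) := by
      gcongr
      exact hv i
    have h2 : ‖v i ^ α i - w i ^ α i‖ * ‖∏ i ∈ s, w i ^ α i‖ ≤
        (α i * ε * ρ ^ α i) * ρ ^ (∑ i ∈ s, α i) := by
      have := norm_pow_sub_pow_le hρ (hv i) (hw i) (hvw i) (α i)
      gcongr
    refine (add_le_add h1 h2).trans (le_of_eq ?_)
    push_cast
    ring

theorem norm_monom_sub_le {n d : ℕ} {α : Fin (n + 1) → ℕ} (h : α ∈ multiIndices n d)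
    {x w : Fin (n + 1) → ℂ} (hx : enorm2 x = 1) (hw : 1 ≤ enorm2 w) :
    ‖monom α w - monom α x‖ ≤ d * enorm2 (w - x) * enorm2 w ^ d := by
  have := norm_prod_pow_sub_le Finset.univ α hw (v := w) (w := x) (norm_le_enorm2 w)
    (fun i => (norm_le_enorm2 x i).trans (hx.le.trans hw)) (fun i => norm_le_enorm2 (w - x) i)
  rwa [sum_of_mem_multiIndices h] at this

section bounds

variable {n d : ℕ} (a : (Fin (n + 1) → ℕ) → (Fin (n + 1) → ℕ) → ℂ)

theorem coeffSum_nonneg : 0 ≤ coeffSum n d a :=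
  Finset.sum_nonneg fun _ _ => Finset.sum_nonneg fun _ _ => norm_nonneg _

theorem norm_sum_sum_le {f g : (Fin (n + 1) → ℕ) → ℂ} {F G : ℝ} (hF : 0 ≤ F)
    (hf : ∀ α ∈ multiIndices n d, ‖f α‖ ≤ F) (hg : ∀ β ∈ multiIndices n d, ‖g β‖ ≤ G) :
    ‖∑ α ∈ multiIndices n d, ∑ β ∈ multiIndices n d, a α β * f α * conj (g β)‖ ≤
      coeffSum n d a * (F * G) := by
  rw [coeffSum, Finset.sum_mul]
  refine (norm_sum_le _ _).trans (Finset.sum_le_sum fun α hα => ?_)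
  rw [Finset.sum_mul]
  refine (norm_sum_le _ _).trans (Finset.sum_le_sum fun β hβ => ?_)
  rw [norm_mul, norm_mul, RCLike.norm_conj, mul_assoc]
  have h1 := hf α hα
  have h2 := hg β hβ
  gcongr

theorem norm_biPol_le (v w : Fin (n + 1) → ℂ) :
    ‖biPol d a v w‖ ≤ coeffSum n d a * (enorm2 v ^ d * enorm2 w ^ d) :=
  norm_sum_sum_le a (pow_nonneg (enorm2_nonneg v) d) (fun _ h => norm_monom_le h v)
    fun _ h => norm_monom_le h w

theorem biPol_smul_left (c : ℂ) (v w : Fin (n + 1) → ℂ) :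
    biPol d a (c • v) w = c ^ d * biPol d a v w := by
  simp only [biPol, Finset.mul_sum]
  refine Finset.sum_congr rfl fun α hα => Finset.sum_congr rfl fun β _ => ?_
  rw [monom_smul hα]; ring

theorem biPol_smul_right (c : ℂ) (v w : Fin (n + 1) → ℂ) :
    biPol d a v (c • w) = conj c ^ d * biPol d a v w := by
  simp only [biPol, Finset.mul_sum]
  refine Finset.sum_congr rfl fun α _ => Finset.sum_congr rfl fun β hβ => ?_
  rw [monom_smul hβ, map_mul, map_pow]; ring

theorem differentiable_biPol_left (w : Fin (n + 1) → ℂ) :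
    Differentiable ℂ fun v => biPol d a v w := by
  unfold biPol
  refine Differentiable.fun_sum fun α _ => Differentiable.fun_sum fun β _ => ?_
  exact ((differentiable_monom α).const_mul _).mul_const _

theorem continuous_biPol :
    Continuous fun q : (Fin (n + 1) → ℂ) × (Fin (n + 1) → ℂ) => biPol d a q.1 q.2 := by
  unfold biPol monom
  fun_prop

theorem norm_biPol_sub_left_le {x w : Fin (n + 1) → ℂ} (hx : enorm2 x = 1)
    (hw : 1 ≤ enorm2 w) :
    ‖biPol d a w x - biPol d a x x‖ ≤ coeffSum n d a * (d * enorm2 (w - x) * enorm2 w ^ d) := by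
  have e : biPol d a w x - biPol d a x x = ∑ α ∈ multiIndices n d, ∑ β ∈ multiIndices n d,
      a α β * (monom α w - monom α x) * conj (monom β x) := by
    simp only [biPol, ← Finset.sum_sub_distrib]
    refine Finset.sum_congr rfl fun α _ => Finset.sum_congr rfl fun β _ => by ring
  rw [e]
  have h0 := enorm2_nonneg w
  have h1 := enorm2_nonneg (w - x)
  refine (norm_sum_sum_le a (by positivity) (fun α h => norm_monom_sub_le h hx hw)
    (fun β h => norm_monom_le h x)).trans (le_of_eq ?_)
  simp [hx]

theorem norm_biPol_sub_right_le {x w : Fin (n + 1) → ℂ} (hx : enorm2 x = 1)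
    (hw : 1 ≤ enorm2 w) :
    ‖biPol d a w w - biPol d a w x‖ ≤
      coeffSum n d a * (d * enorm2 (w - x) * enorm2 w ^ (2 * d)) := by
  have e : biPol d a w w - biPol d a w x = ∑ α ∈ multiIndices n d, ∑ β ∈ multiIndices n d,
      a α β * monom α w * conj (monom β w - monom β x) := by
    simp only [biPol, ← Finset.sum_sub_distrib, map_sub]
    refine Finset.sum_congr rfl fun α _ => Finset.sum_congr rfl fun β _ => by ring
  rw [e]
  have h0 := enorm2_nonneg w
  have h1 := enorm2_nonneg (w - x)
  refine (norm_sum_sum_le a (by positivity) (fun α h => norm_monom_le h w)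
    (fun β h => norm_monom_sub_le h hx hw)).trans (le_of_eq ?_)
  ring

/-- The mixed second difference factors termwise into a difference of monomials times a conjugated
difference of monomials, hence is quadratic in w − x. -/
theorem norm_biPol_sub_sub_le {x w : Fin (n + 1) → ℂ} (hx : enorm2 x = 1)
    (hw : 1 ≤ enorm2 w) :
    ‖biPol d a w w - biPol d a w x - biPol d a x w + biPol d a x x‖ ≤
      coeffSum n d a * (d * enorm2 (w - x) * enorm2 w ^ d) ^ 2 := by
  have e : biPol d a w w - biPol d a w x - biPol d a x w + biPol d a x x =
      ∑ α ∈ multiIndices n d, ∑ β ∈ multiIndices n d,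
      a α β * (monom α w - monom α x) * conj (monom β w - monom β x) := by
    simp only [biPol, ← Finset.sum_sub_distrib, ← Finset.sum_add_distrib, map_sub]
    refine Finset.sum_congr rfl fun α _ => Finset.sum_congr rfl fun β _ => by ring
  rw [e]
  have h0 := enorm2_nonneg w
  have h1 := enorm2_nonneg (w - x)
  refine (norm_sum_sum_le a (by positivity) (fun α h => norm_monom_sub_le h hx hw)
    (fun β h => norm_monom_sub_le h hx hw)).trans (le_of_eq ?_)
  ring

theorem isCompact_unitSphere (k : ℕ) : IsCompact {v : Fin k → ℂ | nsq v = 1} := by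
  refine Metric.isCompact_of_isClosed_isBounded (isClosed_eq continuous_nsq continuous_const) ?_
  refine (Metric.isBounded_closedBall (x := (0 : Fin k → ℂ)) (r := 1)).subset fun v hv => ?_
  rw [mem_closedBall_zero_iff, pi_norm_le_iff_of_nonneg zero_le_one]
  intro i
  refine (norm_le_enorm2 v i).trans ?_
  rw [enorm2, show nsq v = 1 from hv, Real.sqrt_one]

theorem ne_zero_of_nsq_eq_one {k : ℕ} {v : Fin k → ℂ} (h : nsq v = 1) : v ≠ 0 := by
  rintro rfl
  rw [nsq_eq_zero.2 rfl] at h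
  exact zero_ne_one h

/-- Compactness of the unit sphere together with homogeneity. -/
theorem exists_lower_bound_biPol (hpos : ∀ v : Fin (n + 1) → ℂ, v ≠ 0 → 0 < biPol d a v v) :
    ∃ c : ℝ, 0 < c ∧ ∀ v : Fin (n + 1) → ℂ, c * enorm2 v ^ (2 * d) ≤ ‖biPol d a v v‖ ∨ v = 0 := by
  have hne : {v : Fin (n + 1) → ℂ | nsq v = 1}.Nonempty :=
    ⟨Pi.single 0 1, by simp [nsq, Fin.sum_univ_succ]⟩
  have hc : Continuous fun v : Fin (n + 1) → ℂ => ‖biPol d a v v‖ :=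
    ((continuous_biPol a).comp (continuous_id.prodMk continuous_id)).norm
  obtain ⟨u, hu, hmin⟩ := (isCompact_unitSphere (n + 1)).exists_isMinOn hne hc.continuousOn
  refine ⟨‖biPol d a u u‖, norm_pos_iff.2 (hpos u (ne_zero_of_nsq_eq_one hu)).ne', fun v => ?_⟩
  by_cases hv : v = 0
  · exact Or.inr hv
  left
  obtain ⟨c, w, hc0, hcv, hw, rfl⟩ := exists_unit_smul hv
  have h1 : ‖biPol d a u u‖ ≤ ‖biPol d a w w‖ := hmin hw
  have hw1 : enorm2 w = 1 := by rw [enorm2, hw, Real.sqrt_one]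
  rw [biPol_smul_left, biPol_smul_right, enorm2_smul, hw1, mul_one, norm_mul, norm_mul,
    norm_pow, norm_pow, RCLike.norm_conj, ← mul_assoc, ← pow_add, ← two_mul, mul_comm]
  gcongr

/-- The Taylor remainder of the quotient `P(x, w̄) / P(w, w̄)`, up to the holomorphic term. -/
noncomputable def quotRem (d : ℕ) (x w : Fin (n + 1) → ℂ) : ℂ :=
  biPol d a x w / biPol d a w w - (2 - biPol d a w x / biPol d a x x)

/-- To first order at w = x, the antiholomorphic variations of P(x,w̄) and P(w,w̄) cancel in the
quotient. Only the holomorphic variation of the denominator survives, and 2 − P(w,x̄)/P(x,x̄)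
accounts for it. -/
theorem norm_quotRem_le (hpos : ∀ v : Fin (n + 1) → ℂ, v ≠ 0 → 0 < biPol d a v v) :
    ∃ C : ℝ, 0 ≤ C ∧ ∀ x w : Fin (n + 1) → ℂ, enorm2 x = 1 → 1 ≤ enorm2 w →
      ‖quotRem a d x w‖ ≤ C * enorm2 (w - x) ^ 2 * enorm2 w ^ d := by
  obtain ⟨c, hc, hcl⟩ := exists_lower_bound_biPol a hpos
  have hA := coeffSum_nonneg (d := d) a
  -- Of the factor 3, one part comes from the mixed second difference and two from the product of
  -- first differences; c² comes from the lower bounds for P(x,x̄) and P(w,w̄).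
  refine ⟨3 * coeffSum n d a ^ 2 * d ^ 2 / c ^ 2, by positivity, fun x w hx hw => ?_⟩
  set A := coeffSum n d a with hAdef
  have hx0 : x ≠ 0 := by
    rintro rfl
    simp [enorm2, nsq] at hx
  have hw0 : w ≠ 0 := by
    rintro rfl
    simp [enorm2, nsq] at hw
    linarith
  have hax : biPol d a x x ≠ 0 := (hpos x hx0).ne'
  have hbw : biPol d a w w ≠ 0 := (hpos w hw0).ne'
  set ρ := enorm2 w with hρ
  set ζ := enorm2 (w - x) with hζ
  have hζ0 : 0 ≤ ζ := enorm2_nonneg _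
  have h1 := norm_biPol_sub_left_le (d := d) a hx hw
  have h2 := norm_biPol_sub_right_le (d := d) a hx hw
  have h3 := norm_biPol_sub_sub_le (d := d) a hx hw
  have h4 : ‖biPol d a x x‖ ≤ A := by
    have := norm_biPol_le (d := d) a x x
    simpa [hx] using this
  have h5 : c ≤ ‖biPol d a x x‖ := by
    have := (hcl x).resolve_right hx0
    simpa [hx] using this
  have h6 : c * ρ ^ (2 * d) ≤ ‖biPol d a w w‖ := (hcl w).resolve_right hw0
  -- The numerator is arranged as a mixed second difference plus a product of two first differences,
  -- so each summand is O(|w − x|²).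
  have e : quotRem a d x w = (-(biPol d a x x *
      (biPol d a w w - biPol d a w x - biPol d a x w + biPol d a x x)) +
      (biPol d a w x - biPol d a x x) * ((biPol d a w w - biPol d a w x) +
        (biPol d a w x - biPol d a x x))) / (biPol d a x x * biPol d a w w) := by
    rw [quotRem]
    field_simp
    ring
  rw [← hζ, ← hρ, ← hAdef] at h1 h2 h3
  have hρd : ρ ^ d ≤ ρ ^ (2 * d) := pow_le_pow_right₀ hw (by omega)
  have hρ1 : 1 ≤ ρ ^ d := one_le_pow₀ hw
  have hnum : ‖-(biPol d a x x *
      (biPol d a w w - biPol d a w x - biPol d a x w + biPol d a x x)) +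
      (biPol d a w x - biPol d a x x) * ((biPol d a w w - biPol d a w x) +
        (biPol d a w x - biPol d a x x))‖ ≤ 3 * A ^ 2 * d ^ 2 * ζ ^ 2 * (ρ ^ d * ρ ^ (2 * d)) := by
    refine (norm_add_le _ _).trans ?_
    rw [norm_neg, norm_mul, norm_mul]
    have i1 : ‖biPol d a w w - biPol d a w x + (biPol d a w x - biPol d a x x)‖ ≤
        2 * (A * (d * ζ * ρ ^ (2 * d))) := by
      refine (norm_add_le _ _).trans ?_
      have : A * (d * ζ * ρ ^ d) ≤ A * (d * ζ * ρ ^ (2 * d)) := by gcongr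
      linarith
    have i2 : ‖biPol d a x x‖ *
        ‖biPol d a w w - biPol d a w x - biPol d a x w + biPol d a x x‖ ≤
        A * (A * (d * ζ * ρ ^ d) ^ 2) := by gcongr
    have i3 : ‖biPol d a w x - biPol d a x x‖ *
        ‖biPol d a w w - biPol d a w x + (biPol d a w x - biPol d a x x)‖ ≤
        A * (d * ζ * ρ ^ d) * (2 * (A * (d * ζ * ρ ^ (2 * d)))) := by gcongr
    have i4 : A * (A * (d * ζ * ρ ^ d) ^ 2) ≤ A ^ 2 * d ^ 2 * ζ ^ 2 * (ρ ^ d * ρ ^ (2 * d)) := by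
      have : A * (A * (d * ζ * ρ ^ d) ^ 2) = A ^ 2 * d ^ 2 * ζ ^ 2 * (1 * ρ ^ (2 * d)) := by ring
      rw [this]
      gcongr
    calc _ ≤ A ^ 2 * d ^ 2 * ζ ^ 2 * (ρ ^ d * ρ ^ (2 * d)) +
          A * (d * ζ * ρ ^ d) * (2 * (A * (d * ζ * ρ ^ (2 * d)))) := add_le_add (i2.trans i4) i3
      _ = _ := by ring
  rw [e, norm_div, norm_mul]
  have hρp : 0 < ρ ^ (2 * d) := by positivity
  calc _ ≤ 3 * A ^ 2 * d ^ 2 * ζ ^ 2 * (ρ ^ d * ρ ^ (2 * d)) / (c * (c * ρ ^ (2 * d))) := by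
        gcongr
    _ = _ := by field_simp

end bounds

/-! ### Homogeneous holomorphic functions and the mean value property. -/

/-- `S` is a holomorphic homogeneous function of degree `N` on `ℂ^(n+1) ∖ {0}`, extended by `0`. -/
structure IsHomogHol {n : ℕ} (N : ℕ) (S : (Fin (n + 1) → ℂ) → ℂ) : Prop where
  diff : DifferentiableOn ℂ S {0}ᶜ
  smul : ∀ (c : ℂ) v, c ≠ 0 → v ≠ 0 → S (c • v) = c ^ N * S v
  zero : S 0 = 0

theorem IsHomogHol.measurable {n N : ℕ} {S : (Fin (n + 1) → ℂ) → ℂ} (hS : IsHomogHol N S) :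
    Measurable S :=
  measurable_of_continuousOn_compl_singleton 0 hS.diff.continuousOn

theorem IsHomogHol.smul' {n N : ℕ} {S : (Fin (n + 1) → ℂ) → ℂ} (hS : IsHomogHol N S) {c : ℂ}
    (hc : c ≠ 0) (v : Fin (n + 1) → ℂ) : S (c • v) = c ^ N * S v := by
  by_cases hv : v = 0
  · simp [hv, hS.zero]
  · exact hS.smul c v hc hv

theorem IsHomogHol.exists_bound {n N : ℕ} {S : (Fin (n + 1) → ℂ) → ℂ} (hS : IsHomogHol N S) :
    ∃ C : ℝ, 0 ≤ C ∧ ∀ v, ‖S v‖ ≤ C * enorm2 v ^ N := by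
  have hsub : {v : Fin (n + 1) → ℂ | nsq v = 1} ⊆ {0}ᶜ := fun v hv => ne_zero_of_nsq_eq_one hv
  obtain ⟨C, hC⟩ := (isCompact_unitSphere (n + 1)).exists_bound_of_continuousOn
    (hS.diff.continuousOn.mono hsub)
  refine ⟨max C 0, le_max_right _ _, fun v => ?_⟩
  by_cases hv : v = 0
  · rw [hv, hS.zero, norm_zero]
    have := enorm2_nonneg (0 : Fin (n + 1) → ℂ)
    positivity
  obtain ⟨c, w, hc0, -, hw, rfl⟩ := exists_unit_smul hv
  have hw1 : enorm2 w = 1 := by rw [enorm2, hw, Real.sqrt_one]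
  rw [hS.smul' (Complex.ofReal_ne_zero.2 hc0.ne'), enorm2_smul, hw1, mul_one, norm_mul, norm_pow,
    mul_comm]
  have := (hC w hw).trans (le_max_left C 0)
  gcongr

/-- The linear map `y ↦ c y + (1 - c) ⟨y, x⟩ x`, which multiplies the orthogonal complement of the
unit vector `x` by `c`. -/
noncomputable def complDilation {k : ℕ} (x : Fin k → ℂ) (c : ℂ) : (Fin k → ℂ) →ₗ[ℂ] (Fin k → ℂ) where
  toFun y := c • y + ((1 - c) * herm y x) • x
  map_add' y z := by
    rw [herm_add_left, smul_add, mul_add, add_smul]; abel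
  map_smul' r y := by
    simp only [herm_smul_left, RingHom.id_apply, smul_add, smul_smul]
    ring_nf

theorem complDilation_apply {k : ℕ} (x : Fin k → ℂ) (c : ℂ) (y : Fin k → ℂ) :
    complDilation x c y = c • y + ((1 - c) * herm y x) • x := rfl

theorem herm_complDilation {k : ℕ} {x : Fin k → ℂ} (hx : nsq x = 1) (c : ℂ) (y : Fin k → ℂ) :
    herm (complDilation x c y) x = herm y x := by
  rw [complDilation_apply, herm_add_left, herm_smul_left, herm_smul_left, herm_self, hx]
  push_cast; ring

theorem complDilation_comp {k : ℕ} {x : Fin k → ℂ} (hx : nsq x = 1) {c e : ℂ} (h : c * e = 1)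
    (y : Fin k → ℂ) : complDilation x c (complDilation x e y) = y := by
  rw [complDilation_apply, herm_complDilation hx, complDilation_apply, smul_add, smul_smul,
    smul_smul, h, one_smul, add_assoc, ← add_smul]
  have : c * ((1 - e) * herm y x) + (1 - c) * herm y x = 0 := by linear_combination (-herm y x) * h
  rw [this, zero_smul, add_zero]

theorem nsq_complDilation {k : ℕ} {x : Fin k → ℂ} (hx : nsq x = 1) {c : ℂ} (hc : ‖c‖ = 1)
    (y : Fin k → ℂ) : nsq (complDilation x c y) = nsq y := by
  have hcc : c * conj c = 1 := by
    rw [Complex.mul_conj, Complex.normSq_eq_norm_sq, hc]; simp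
  have h : herm (complDilation x c y) (complDilation x c y) = herm y y := by
    have e1 : ∀ u, herm u (complDilation x c y) = conj c * herm u y +
        (1 - conj c) * herm x y * herm u x := by
      intro u
      rw [← conj_herm, complDilation_apply, herm_add_left, herm_smul_left, herm_smul_left]
      simp only [map_add, map_mul, map_sub, map_one, conj_herm]
    rw [e1, herm_complDilation hx, complDilation_apply, herm_add_left, herm_smul_left,
      herm_smul_left]
    linear_combination (herm y y - herm x y * herm y x) * hcc
  rw [herm_self, herm_self] at h
  exact_mod_cast h

theorem measurePreserving_complDilation {n : ℕ} {x : Fin (n + 1) → ℂ} (hx : nsq x = 1) {c : ℂ}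
    (hc : ‖c‖ = 1) :
    MeasurePreserving (complDilation x c) (gauss (n + 1)) (gauss (n + 1)) := by
  have hc0 : c ≠ 0 := by rintro rfl; simp at hc
  let L : (Fin (n + 1) → ℂ) ≃ₗ[ℂ] (Fin (n + 1) → ℂ) :=
    LinearEquiv.ofLinearMap (complDilation x c) (complDilation x c⁻¹)
      (LinearMap.ext fun y => complDilation_comp hx (mul_inv_cancel₀ hc0) y)
      (LinearMap.ext fun y => complDilation_comp hx (inv_mul_cancel₀ hc0) y)
  exact measurePreserving_gauss L (nsq_complDilation hx hc)

theorem circleAverage_of_differentiable {f : ℂ → ℂ} (hf : Differentiable ℂ f) :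
    Real.circleAverage f 0 1 = f 0 :=
  DiffContOnCl.circleAverage hf.diffContOnCl

theorem cosSq_eq_of_nsq_eq_one {k : ℕ} {x : Fin k → ℂ} (hx : nsq x = 1) {y : Fin k → ℂ}
    (hc : herm y x ≠ 0) : cosSq x y = (enorm2 ((herm y x)⁻¹ • y) ^ 2)⁻¹ := by
  rw [cosSq, hx, enorm2_smul, mul_pow, enorm2_sq, norm_inv, norm_herm_comm]
  have : ‖herm y x‖ ≠ 0 := by simpa using hc
  by_cases hy : nsq y = 0
  · simp [hy]
  · field_simp

theorem one_le_enorm2_of_herm_eq_one {k : ℕ} {x w : Fin k → ℂ} (hx : nsq x = 1)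
    (hw : herm w x = 1) : 1 ≤ enorm2 w := by
  have := norm_herm_le w x
  rw [hw] at this
  have h1 : enorm2 x = 1 := by rw [enorm2, hx, Real.sqrt_one]
  simpa [h1] using this

theorem herm_inv_smul_self {k : ℕ} {x y : Fin k → ℂ} (hc : herm y x ≠ 0) :
    herm ((herm y x)⁻¹ • y) x = 1 := by
  rw [herm_smul_left, inv_mul_cancel₀ hc]

/-- The function `|⟨x,y⟩|^(2m) |y|^(-2m) T(y/⟨y,x⟩)`. -/
noncomputable def meanFun {k : ℕ} (x : Fin k → ℂ) (m : ℕ) (T : (Fin k → ℂ) → ℂ)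
    (y : Fin k → ℂ) : ℂ :=
  (cosSq x y : ℂ) ^ m * T ((herm y x)⁻¹ • y)

theorem measurable_herm_left {k : ℕ} (x : Fin k → ℂ) : Measurable fun y : Fin k → ℂ => herm y x :=
  (continuous_herm.comp (Continuous.prodMk_left x)).measurable

theorem measurable_meanFun {k : ℕ} (x : Fin k → ℂ) (m : ℕ) {T : (Fin k → ℂ) → ℂ}
    (hT : Measurable T) : Measurable (meanFun x m T) := by
  refine ((Complex.measurable_ofReal.comp (measurable_cosSq_right x)).pow_const m).mul
    (hT.comp ?_)
  exact (measurable_herm_left x).inv.smul measurable_id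

/-- The weight equals |w|^(-2m) with |w| ≥ 1, so it absorbs growth of degree up to 2m. Where ⟨y,x⟩ =
0 the weight vanishes because m > 0. -/
theorem norm_meanFun_le {k : ℕ} {x : Fin k → ℂ} (hx : nsq x = 1) {m M : ℕ} (hm : 0 < m)
    (hM : M ≤ 2 * m) {T : (Fin k → ℂ) → ℂ} {C : ℝ} (hC : 0 ≤ C)
    (hT : ∀ w, herm w x = 1 → ‖T w‖ ≤ C * enorm2 w ^ M) (y : Fin k → ℂ) :
    ‖meanFun x m T y‖ ≤ C := by
  by_cases hc : herm y x = 0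
  · have : cosSq x y = 0 := by rw [cosSq, norm_herm_comm, hc]; simp
    rw [meanFun, this]
    simpa [hm.ne'] using hC
  have hw := herm_inv_smul_self hc
  have h1 := one_le_enorm2_of_herm_eq_one hx hw
  rw [meanFun, cosSq_eq_of_nsq_eq_one hx hc, norm_mul, norm_pow, Complex.norm_real, norm_inv,
    Real.norm_of_nonneg (by positivity), inv_pow, ← pow_mul, inv_mul_le_iff₀ (by positivity),
    mul_comm]
  exact (hT _ hw).trans (mul_le_mul_of_nonneg_left (pow_le_pow_right₀ h1 hM) hC)

/-- Multiplying the complement of x by a unit scalar c preserves the Gaussian and the squared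
cosine, and moves w = y/⟨y,x⟩ to x + c(w − x). Averaging over c, with Fubini and the mean value
property, replaces T(w) by T(x) for each y; what is left is the moment of the squared cosine. -/
theorem integral_meanFun {n : ℕ} {x : Fin (n + 1) → ℂ} (hx : nsq x = 1) {m M : ℕ} (hm : 0 < m)
    (hM : M ≤ 2 * m) {T : (Fin (n + 1) → ℂ) → ℂ} (hTm : Measurable T) {C : ℝ} (hC : 0 ≤ C)
    (hT : ∀ w, herm w x = 1 → ‖T w‖ ≤ C * enorm2 w ^ M)
    (hTd : ∀ w, herm w x = 1 → Differentiable ℂ fun c : ℂ => T (x + c • (w - x))) :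
    ∫ y, meanFun x m T y ∂(gauss (n + 1)) = T x * betaMoment n m := by
  set f := meanFun x m T with hf
  have hfm : Measurable f := measurable_meanFun x m hTm
  have hbd : ∀ y, ‖f y‖ ≤ C := norm_meanFun_le hx hm hM hC hT
  have hrot : ∀ c : ℂ, ‖c‖ = 1 →
      ∫ y, f (complDilation x c y) ∂(gauss (n + 1)) = ∫ y, f y ∂(gauss (n + 1)) := by
    intro c hc
    have hmp := measurePreserving_complDilation hx hc
    rw [← integral_map hmp.measurable.aemeasurable
      (by rw [hmp.map_eq]; exact hfm.aestronglyMeasurable), hmp.map_eq]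
  have hcirc : ∀ θ : ℝ, ‖circleMap 0 1 θ‖ = 1 := by intro θ; simp
  have hpt : ∀ y, (2 * Real.pi)⁻¹ • ∫ θ in (0 : ℝ)..2 * Real.pi,
      f (complDilation x (circleMap 0 1 θ) y) = ((cosSq x y ^ m : ℝ) : ℂ) * T x := by
    intro y
    by_cases hc : herm y x = 0
    · have h0 : ∀ c : ℂ, f (complDilation x c y) = 0 := by
        intro c
        have : cosSq x (complDilation x c y) = 0 := by
          rw [cosSq, norm_herm_comm, herm_complDilation hx, hc]; simp
        rw [hf, meanFun, this]; simp [hm.ne']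
      have : cosSq x y = 0 := by rw [cosSq, norm_herm_comm, hc]; simp
      simp [h0, this, hm.ne']
    · set w := (herm y x)⁻¹ • y with hw
      have hwx : herm w x = 1 := herm_inv_smul_self hc
      have h0 : ∀ c : ℂ, ‖c‖ = 1 → f (complDilation x c y) =
          (cosSq x y : ℂ) ^ m * T (x + c • (w - x)) := by
        intro c hc1
        have e1 : cosSq x (complDilation x c y) = cosSq x y := by
          rw [cosSq, cosSq, norm_herm_comm, herm_complDilation hx, nsq_complDilation hx hc1,
            norm_herm_comm x y]
        have e2 : (herm y x)⁻¹ • complDilation x c y = x + c • (w - x) := by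
          rw [complDilation_apply, smul_add, smul_smul, smul_smul, hw, smul_sub, smul_smul,
            mul_comm c (herm y x)⁻¹, mul_left_comm, inv_mul_cancel₀ hc, mul_one, sub_smul,
            one_smul]
          abel
        rw [hf, meanFun, e1, herm_complDilation hx, e2]
      have h1 := circleAverage_of_differentiable (hTd w hwx)
      rw [Real.circleAverage_def] at h1
      simp only [h0 _ (hcirc _), intervalIntegral.integral_const_mul]
      rw [← mul_smul_comm, h1, zero_smul, add_zero]
      push_cast
      rfl
  have hpi : (0 : ℝ) ≤ 2 * Real.pi := by positivity
  have hint : Integrable (fun q : ℝ × (Fin (n + 1) → ℂ) =>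
      f (complDilation x (circleMap 0 1 q.1) q.2))
      ((volume.restrict (Set.Ioc 0 (2 * Real.pi))).prod (gauss (n + 1))) := by
    refine Integrable.of_bound (Measurable.aestronglyMeasurable (hfm.comp ?_)) C
      (ae_of_all _ fun q => hbd _)
    simp only [complDilation_apply]
    have h1 : Measurable fun q : ℝ × (Fin (n + 1) → ℂ) => circleMap 0 1 q.1 :=
      (continuous_circleMap 0 1).measurable.comp measurable_fst
    refine (h1.smul measurable_snd).add (Measurable.smul_const ?_ _)
    exact (measurable_const.sub h1).mul ((measurable_herm_left x).comp measurable_snd)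
  have hswap := integral_integral_swap
    (f := fun (θ : ℝ) y => f (complDilation x (circleMap 0 1 θ) y)) hint
  simp only [hrot _ (hcirc _)] at hswap
  have hL : ∫ y, f y ∂(gauss (n + 1)) = (2 * Real.pi)⁻¹ •
      ∫ _ in Set.Ioc 0 (2 * Real.pi), ∫ y, f y ∂(gauss (n + 1)) := by
    rw [← intervalIntegral.integral_of_le hpi, intervalIntegral.integral_const, smul_smul,
      sub_zero, inv_mul_cancel₀ (by positivity), one_smul]
  rw [hL, hswap, ← integral_smul]
  simp only [← intervalIntegral.integral_of_le hpi, hpt]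
  rw [integral_mul_const, integral_complex_ofReal, integral_cosSq_of_nsq_eq_one hx, mul_comm]

/-! ### The integral operator with kernel r^m P. -/

/-- The kernel `⟨x, y⟩^m P(x, ȳ)`. -/
noncomputable def rpk {n : ℕ} (d : ℕ) (a : (Fin (n + 1) → ℕ) → (Fin (n + 1) → ℕ) → ℂ) (m : ℕ)
    (x y : Fin (n + 1) → ℂ) : ℂ := herm x y ^ m * biPol d a x y

/-- The norm `|S(y)| / |y|^N` of a homogeneous function of degree `N`. -/
noncomputable def fibreNorm {k : ℕ} (N : ℕ) (S : (Fin k → ℂ) → ℂ) (y : Fin k → ℂ) : ℝ :=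
  ‖S y‖ / enorm2 y ^ N

theorem fibreNorm_nonneg {k : ℕ} (N : ℕ) (S : (Fin k → ℂ) → ℂ) (y : Fin k → ℂ) :
    0 ≤ fibreNorm N S y := div_nonneg (norm_nonneg _) (pow_nonneg (enorm2_nonneg y) _)

/-- The decreasing profile `t^j (1 - t)` in `t = cosSq x y`. -/
noncomputable def profile {k : ℕ} (j : ℕ) (x y : Fin k → ℂ) : ℝ :=
  cosSq x y ^ j * (1 - cosSq x y)

theorem profile_nonneg {k : ℕ} (j : ℕ) (x y : Fin k → ℂ) : 0 ≤ profile j x y :=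
  mul_nonneg (pow_nonneg (cosSq_nonneg x y) j) (sub_nonneg.2 (cosSq_le_one x y))

theorem profile_le_one {k : ℕ} (j : ℕ) (x y : Fin k → ℂ) : profile j x y ≤ 1 := by
  have h0 := cosSq_nonneg x y
  have h1 := cosSq_le_one x y
  exact mul_le_one₀ (pow_le_one₀ h0 h1) (sub_nonneg.2 h1) (by linarith)

theorem profile_comm {k : ℕ} (j : ℕ) (x y : Fin k → ℂ) : profile j x y = profile j y x := by
  rw [profile, profile, cosSq_comm]

theorem integral_profile {n : ℕ} (j : ℕ) {x : Fin (n + 1) → ℂ} (hx : x ≠ 0) :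
    ∫ y, profile j x y ∂(gauss (n + 1)) = betaMoment n j - betaMoment n (j + 1) := by
  have : ∀ y, profile j x y = cosSq x y ^ j - cosSq x y ^ (j + 1) := fun y => by
    rw [profile]; ring
  simp only [this]
  rw [integral_sub (integrable_cosSq_pow x j) (integrable_cosSq_pow x (j + 1)),
    integral_cosSq hx, integral_cosSq hx]

theorem measurable_cosSq {k : ℕ} :
    Measurable fun q : (Fin k → ℂ) × (Fin k → ℂ) => cosSq q.1 q.2 := by
  unfold cosSq
  exact (continuous_herm.norm.pow 2).measurable.div
    ((continuous_nsq.comp continuous_fst).mul (continuous_nsq.comp continuous_snd)).measurable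

theorem measurable_profile {k : ℕ} (j : ℕ) :
    Measurable fun q : (Fin k → ℂ) × (Fin k → ℂ) => profile j q.1 q.2 :=
  (measurable_cosSq.pow_const j).mul (measurable_const.sub measurable_cosSq)

theorem IsHomogHol.measurable_fibreNorm {n N : ℕ} {S : (Fin (n + 1) → ℂ) → ℂ}
    (hS : IsHomogHol N S) : Measurable (fibreNorm N S) :=
  hS.measurable.norm.div (continuous_enorm2.pow N).measurable

theorem IsHomogHol.exists_fibreNorm_le {n N : ℕ} {S : (Fin (n + 1) → ℂ) → ℂ}
    (hS : IsHomogHol N S) : ∃ C : ℝ, 0 ≤ C ∧ ∀ v, fibreNorm N S v ≤ C := by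
  obtain ⟨C, hC, h⟩ := hS.exists_bound
  exact ⟨C, hC, fun v => div_le_of_le_mul₀ (pow_nonneg (enorm2_nonneg v) _) hC (h v)⟩

theorem IsHomogHol.fibreNorm_smul {n N : ℕ} {S : (Fin (n + 1) → ℂ) → ℂ}
    (hS : IsHomogHol N S) {c : ℂ} (hc : c ≠ 0) (v : Fin (n + 1) → ℂ) :
    fibreNorm N S (c • v) = fibreNorm N S v := by
  have : ‖c‖ ≠ 0 := by simpa using hc
  rw [fibreNorm, fibreNorm, hS.smul' hc, enorm2_smul, norm_mul, norm_pow, mul_pow,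
    mul_div_mul_left _ _ (pow_ne_zero _ this)]

/-- Pythagoras: w − x is orthogonal to x. -/
theorem nsq_sub_of_herm_eq_one {k : ℕ} {x w : Fin k → ℂ} (hx : nsq x = 1) (hw : herm w x = 1) :
    nsq (w - x) = nsq w - 1 := by
  have hw' : herm x w = 1 := by rw [← conj_herm, hw, map_one]
  have h : herm (w - x) (w - x) = herm w w - 1 := by
    have e : ∀ u, herm u (w - x) = herm u w - herm u x := by
      intro u
      rw [← conj_herm, herm_sub_left, map_sub, conj_herm, conj_herm]
    rw [e, herm_sub_left, herm_sub_left, hw, hw', herm_self x, hx]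
    simp
  rw [herm_self, herm_self] at h
  exact_mod_cast h

section kernel

variable {n d : ℕ} (a : (Fin (n + 1) → ℕ) → (Fin (n + 1) → ℕ) → ℂ)

theorem rpk_smul_left (m : ℕ) (c : ℂ) (x y : Fin (n + 1) → ℂ) :
    rpk d a m (c • x) y = c ^ (m + d) * rpk d a m x y := by
  rw [rpk, rpk, herm_smul_left, biPol_smul_left]; ring

theorem rpk_smul_right (m : ℕ) (c : ℂ) (x y : Fin (n + 1) → ℂ) :
    rpk d a m x (c • y) = conj c ^ (m + d) * rpk d a m x y := by
  rw [rpk, rpk, herm_smul_right, biPol_smul_right]; ring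

theorem continuous_rpk (m : ℕ) :
    Continuous fun q : (Fin (n + 1) → ℂ) × (Fin (n + 1) → ℂ) => rpk d a m q.1 q.2 :=
  (continuous_herm.pow m).mul (continuous_biPol a)

theorem continuous_rpk_self (m : ℕ) : Continuous fun x : Fin (n + 1) → ℂ => rpk d a m x x :=
  (continuous_rpk (d := d) a m).comp (f := fun x => (x, x)) (continuous_id.prodMk continuous_id)

theorem norm_rpk_le (m : ℕ) (x y : Fin (n + 1) → ℂ) :
    ‖rpk d a m x y‖ ≤ coeffSum n d a * (enorm2 x ^ (m + d) * enorm2 y ^ (m + d)) := by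
  rw [rpk, norm_mul, norm_pow]
  have h1 := norm_herm_le x y
  have h2 := norm_biPol_le (d := d) a x y
  have h3 := coeffSum_nonneg (d := d) a
  have hx := enorm2_nonneg x
  have hy := enorm2_nonneg y
  calc ‖herm x y‖ ^ m * ‖biPol d a x y‖
      ≤ (enorm2 x * enorm2 y) ^ m * (coeffSum n d a * (enorm2 x ^ d * enorm2 y ^ d)) := by gcongr
    _ = _ := by ring

theorem exists_lower_bound_rpk (hpos : ∀ v : Fin (n + 1) → ℂ, v ≠ 0 → 0 < biPol d a v v) :
    ∃ c : ℝ, 0 < c ∧ ∀ (m : ℕ) (v : Fin (n + 1) → ℂ), v ≠ 0 →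
      c * enorm2 v ^ (2 * (m + d)) ≤ ‖rpk d a m v v‖ := by
  obtain ⟨c, hc, h⟩ := exists_lower_bound_biPol a hpos
  refine ⟨c, hc, fun m v hv => ?_⟩
  have h1 := (h v).resolve_right hv
  rw [rpk, norm_mul, norm_pow, herm_self, Complex.norm_real, Real.norm_of_nonneg (nsq_nonneg v),
    ← enorm2_sq]
  have := enorm2_nonneg v
  calc _ = (enorm2 v ^ 2) ^ m * (c * enorm2 v ^ (2 * d)) := by ring
    _ ≤ _ := by gcongr

theorem rpk_self_pos (hpos : ∀ v : Fin (n + 1) → ℂ, v ≠ 0 → 0 < biPol d a v v) (m : ℕ)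
    {v : Fin (n + 1) → ℂ} (hv : v ≠ 0) : 0 < rpk d a m v v := by
  have h1 : (0 : ℂ) < (nsq v : ℂ) := by exact_mod_cast nsq_pos hv
  rw [rpk, herm_self]
  exact mul_pos (pow_pos h1 m) (hpos v hv)

/-- The integrand of the integral operator with kernel `rpk`. -/
noncomputable def opIntegrand (d : ℕ) (m : ℕ) (S : (Fin (n + 1) → ℂ) → ℂ)
    (x y : Fin (n + 1) → ℂ) : ℂ := rpk d a m x y * S y / rpk d a m y y

theorem opIntegrand_smul_right (m : ℕ) {S : (Fin (n + 1) → ℂ) → ℂ} (hS : IsHomogHol (m + d) S)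
    {c : ℂ} (hc : c ≠ 0) (x y : Fin (n + 1) → ℂ) :
    opIntegrand a d m S x (c • y) = opIntegrand a d m S x y := by
  have hcc : conj c ≠ 0 := by simpa using hc
  rw [opIntegrand, opIntegrand, rpk_smul_right, rpk_smul_right, rpk_smul_left, hS.smul' hc]
  rw [show conj c ^ (m + d) * rpk d a m x y * (c ^ (m + d) * S y) =
    (conj c ^ (m + d) * c ^ (m + d)) * (rpk d a m x y * S y) by ring,
    ← mul_assoc (conj c ^ (m + d)) (c ^ (m + d)) (rpk d a m y y), mul_div_mul_left _ _ (mul_ne_zero (pow_ne_zero _ hcc) (pow_ne_zero _ hc))]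

theorem opIntegrand_smul_left (m : ℕ) (S : (Fin (n + 1) → ℂ) → ℂ) (c : ℂ)
    (x y : Fin (n + 1) → ℂ) :
    opIntegrand a d m S (c • x) y = c ^ (m + d) * opIntegrand a d m S x y := by
  rw [opIntegrand, opIntegrand, rpk_smul_left]; ring

theorem norm_opIntegrand_le (hpos : ∀ v : Fin (n + 1) → ℂ, v ≠ 0 → 0 < biPol d a v v) (m : ℕ)
    {S : (Fin (n + 1) → ℂ) → ℂ} (hS : IsHomogHol (m + d) S) :
    ∃ C : ℝ, 0 ≤ C ∧ ∀ x y, ‖opIntegrand a d m S x y‖ ≤ C * enorm2 x ^ (m + d) := by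
  obtain ⟨c, hc, hcl⟩ := exists_lower_bound_rpk a hpos
  obtain ⟨B, hB, hSB⟩ := hS.exists_bound
  have hA := coeffSum_nonneg (d := d) a
  refine ⟨coeffSum n d a * B / c, by positivity, fun x y => ?_⟩
  have hx := enorm2_nonneg x
  by_cases hy : y = 0
  · rw [opIntegrand, hy, hS.zero]
    simp only [mul_zero, zero_div, norm_zero]
    positivity
  have hyp := enorm2_pos hy
  rw [opIntegrand, norm_div, norm_mul]
  have h1 := norm_rpk_le (d := d) a m x y
  have h2 := hSB y
  have h3 := hcl m y hy
  calc _ ≤ (coeffSum n d a * (enorm2 x ^ (m + d) * enorm2 y ^ (m + d))) *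
        (B * enorm2 y ^ (m + d)) / (c * enorm2 y ^ (2 * (m + d))) := by gcongr
    _ = _ := by
      generalize m + d = N
      rw [two_mul, pow_add (enorm2 y)]
      field_simp

theorem measurable_opIntegrand (m : ℕ) {S : (Fin (n + 1) → ℂ) → ℂ} (hS : Measurable S) :
    Measurable fun q : (Fin (n + 1) → ℂ) × (Fin (n + 1) → ℂ) => opIntegrand a d m S q.1 q.2 :=
  ((continuous_rpk a m).measurable.mul (hS.comp measurable_snd)).div
    ((continuous_rpk_self a m).measurable.comp measurable_snd)

theorem integrable_opIntegrand (hpos : ∀ v : Fin (n + 1) → ℂ, v ≠ 0 → 0 < biPol d a v v) (m : ℕ)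
    {S : (Fin (n + 1) → ℂ) → ℂ} (hS : IsHomogHol (m + d) S) (x : Fin (n + 1) → ℂ) :
    Integrable (opIntegrand a d m S x) (gauss (n + 1)) := by
  obtain ⟨C, -, hC⟩ := norm_opIntegrand_le a hpos m hS
  exact Integrable.of_bound ((measurable_opIntegrand a m hS.measurable).comp
    measurable_prodMk_left).aestronglyMeasurable _ (ae_of_all _ (hC x))

theorem integrable_fibreNorm_mul_profile {N : ℕ} {S : (Fin (n + 1) → ℂ) → ℂ}
    (hS : IsHomogHol N S) (j : ℕ) (x : Fin (n + 1) → ℂ) :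
    Integrable (fun y => fibreNorm N S y * profile j x y) (gauss (n + 1)) := by
  obtain ⟨C, hC0, hC⟩ := hS.exists_fibreNorm_le
  refine Integrable.of_bound (hS.measurable_fibreNorm.mul ((measurable_profile j).comp
    measurable_prodMk_left)).aestronglyMeasurable (C * 1) (ae_of_all _ fun y => ?_)
  rw [Real.norm_of_nonneg (mul_nonneg (fibreNorm_nonneg _ _ _) (profile_nonneg _ _ _))]
  exact mul_le_mul (hC y) (profile_le_one j x y) (profile_nonneg _ _ _) hC0

/-- The holomorphic part of `S(w) P(x, w̄) / P(w, w̄)` near the unit vector `x`. -/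
noncomputable def holPart (d : ℕ) (S : (Fin (n + 1) → ℂ) → ℂ) (x w : Fin (n + 1) → ℂ) : ℂ :=
  S w * (2 - biPol d a w x / biPol d a x x)

/-- The holomorphic part has growth of degree m + 2d, which stays within 2m because 2d ≤ m; at w = x
its second factor is 2 − 1 = 1. -/
theorem integral_meanFun_holPart
    (hpos : ∀ v : Fin (n + 1) → ℂ, v ≠ 0 → 0 < biPol d a v v) {m : ℕ} (hm : 0 < m)
    (hmd : 2 * d ≤ m) {S : (Fin (n + 1) → ℂ) → ℂ} (hS : IsHomogHol (m + d) S)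
    {x : Fin (n + 1) → ℂ} (hx : nsq x = 1) :
    Integrable (meanFun x m (holPart a d S x)) (gauss (n + 1)) ∧
    ∫ y, meanFun x m (holPart a d S x) y ∂(gauss (n + 1)) = S x * betaMoment n m := by
  have hx0 := ne_zero_of_nsq_eq_one hx
  have hx1 : enorm2 x = 1 := by rw [enorm2, hx, Real.sqrt_one]
  have hTm : Measurable (holPart a d S x) :=
    hS.measurable.mul (measurable_const.sub
      (((differentiable_biPol_left a x).continuous.measurable).div_const _))
  obtain ⟨B, hB, hSB⟩ := hS.exists_bound
  have hA := coeffSum_nonneg (d := d) a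
  have hTb : ∀ w, herm w x = 1 → ‖holPart a d S x w‖ ≤
      B * (2 + coeffSum n d a / ‖biPol d a x x‖) * enorm2 w ^ (m + 2 * d) := by
    intro w hw
    have hρ := one_le_enorm2_of_herm_eq_one hx hw
    have h1 : ‖2 - biPol d a w x / biPol d a x x‖ ≤
        (2 + coeffSum n d a / ‖biPol d a x x‖) * enorm2 w ^ d := by
      refine (norm_sub_le _ _).trans ?_
      rw [norm_div, add_mul]
      have h2 := norm_biPol_le (d := d) a w x
      rw [hx1, one_pow, mul_one] at h2
      have h3 : ‖(2 : ℂ)‖ ≤ 2 * enorm2 w ^ d := by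
        simpa using one_le_pow₀ (n := d) hρ
      refine add_le_add h3 ?_
      rw [div_mul_eq_mul_div]
      gcongr
    rw [holPart, norm_mul]
    calc _ ≤ (B * enorm2 w ^ (m + d)) *
          ((2 + coeffSum n d a / ‖biPol d a x x‖) * enorm2 w ^ d) := by
          have := hSB w
          gcongr
      _ = _ := by ring
  have hTd : ∀ w, herm w x = 1 →
      Differentiable ℂ fun c : ℂ => holPart a d S x (x + c • (w - x)) := by
    intro w hw
    have hg : Differentiable ℂ fun c : ℂ => x + c • (w - x) := by fun_prop
    -- S is holomorphic only away from 0; the complex line stays in the affine hyperplane ⟨·,x⟩ = 1,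
    -- which misses 0.
    have hne : ∀ c : ℂ, x + c • (w - x) ≠ 0 := by
      intro c h0
      have : herm (x + c • (w - x)) x = 1 := by
        rw [herm_add_left, herm_smul_left, herm_sub_left, hw, herm_self, hx]; simp
      rw [h0] at this
      simp [herm] at this
    refine Differentiable.mul ?_ ?_
    · intro c
      have := (hS.diff.differentiableAt (isOpen_compl_singleton.mem_nhds (hne c)))
      exact this.comp c (hg c)
    · exact (differentiable_const _).sub (((differentiable_biPol_left a x).comp hg).div_const _)
  have hC : 0 ≤ B * (2 + coeffSum n d a / ‖biPol d a x x‖) := by positivity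
  refine ⟨Integrable.of_bound (measurable_meanFun x m hTm).aestronglyMeasurable _
    (ae_of_all _ (norm_meanFun_le hx hm (by omega) hC hTb)), ?_⟩
  rw [integral_meanFun hx hm (by omega) hTm hC hTb hTd]
  have : biPol d a x x ≠ 0 := (hpos x hx0).ne'
  rw [holPart, div_self this]
  norm_num

/-- The integrand has degree 0 in y, so y may be replaced by w. There ⟨x,w⟩ = 1 and r^m contributes
only |w|^(-2m), the m-th power of the squared cosine. -/
theorem opIntegrand_sub_meanFun (hpos : ∀ v : Fin (n + 1) → ℂ, v ≠ 0 → 0 < biPol d a v v) {m : ℕ}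
    {S : (Fin (n + 1) → ℂ) → ℂ} (hS : IsHomogHol (m + d) S)
    {x : Fin (n + 1) → ℂ} (hx : nsq x = 1) {y : Fin (n + 1) → ℂ} (hc : herm y x ≠ 0) :
    opIntegrand a d m S x y - meanFun x m (holPart a d S x) y =
      (cosSq x y : ℂ) ^ m * (S ((herm y x)⁻¹ • y) * quotRem a d x ((herm y x)⁻¹ • y)) := by
  set w := (herm y x)⁻¹ • y with hw
  have hwx : herm w x = 1 := herm_inv_smul_self hc
  have hxw : herm x w = 1 := by rw [← conj_herm, hwx, map_one]
  have hw0 : w ≠ 0 := by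
    rintro h0
    rw [h0] at hwx
    simp [herm] at hwx
  have hb : biPol d a w w ≠ 0 := (hpos w hw0).ne'
  rw [← opIntegrand_smul_right a m hS (inv_ne_zero hc), ← hw, meanFun, ← hw, holPart, quotRem,
    cosSq_eq_of_nsq_eq_one hx hc, ← hw, enorm2_sq, opIntegrand, rpk, rpk, hxw, herm_self]
  have hn : (nsq w : ℂ) ≠ 0 := by exact_mod_cast (nsq_pos hw0).ne'
  push_cast
  rw [inv_pow]
  field_simp
  ring

/-- The mean value identity leaves only the Taylor remainder. Since |w − x|² = |w|² − 1 and |S(w)|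
is the fibre norm times |w|^(m+d), the powers combine to |w|^(2d+2−m)(1 − t) with t = |w|^(-2). The
condition on j says exactly that this is at most t^j(1 − t). -/
theorem norm_integral_opIntegrand_sub_le
    (hpos : ∀ v : Fin (n + 1) → ℂ, v ≠ 0 → 0 < biPol d a v v) :
    ∃ C : ℝ, 0 ≤ C ∧ ∀ (m j : ℕ), 2 * j + 2 * d + 2 ≤ m → ∀ S : (Fin (n + 1) → ℂ) → ℂ,
      IsHomogHol (m + d) S → ∀ x : Fin (n + 1) → ℂ,
      ‖∫ y, opIntegrand a d m S x y ∂(gauss (n + 1)) - S x * betaMoment n m‖ ≤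
        C * enorm2 x ^ (m + d) *
          ∫ y, fibreNorm (m + d) S y * profile j x y ∂(gauss (n + 1)) := by
  obtain ⟨C, hC, hR⟩ := norm_quotRem_le a hpos
  refine ⟨C, hC, fun m j hmj S hS => ?_⟩
  have key : ∀ x : Fin (n + 1) → ℂ, nsq x = 1 →
      ‖∫ y, opIntegrand a d m S x y ∂(gauss (n + 1)) - S x * betaMoment n m‖ ≤
        C * ∫ y, fibreNorm (m + d) S y * profile j x y ∂(gauss (n + 1)) := by
    intro x hx
    have hx1 : enorm2 x = 1 := by rw [enorm2, hx, Real.sqrt_one]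
    obtain ⟨hi, he⟩ := integral_meanFun_holPart a hpos (by omega) (by omega) hS hx
    rw [← he, ← integral_sub (integrable_opIntegrand a hpos m hS x) hi, ← integral_const_mul]
    refine norm_integral_le_of_norm_le ((integrable_fibreNorm_mul_profile hS j x).const_mul C)
      (ae_of_all _ fun y => ?_)
    have hnn : 0 ≤ C * (fibreNorm (m + d) S y * profile j x y) :=
      mul_nonneg hC (mul_nonneg (fibreNorm_nonneg _ _ _) (profile_nonneg _ _ _))
    -- The rescaled vector w makes no sense here, but both integrands vanish because m > 0.
    by_cases hc : herm y x = 0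
    · have h1 : cosSq x y = 0 := by rw [cosSq, norm_herm_comm, hc]; simp
      have h2 : herm x y = 0 := by rw [← conj_herm, hc, map_zero]
      have hm0 : m ≠ 0 := by omega
      rw [meanFun, h1, opIntegrand, rpk, h2]
      simpa [hm0] using hnn
    rw [opIntegrand_sub_meanFun a hpos hS hx hc, ← hS.fibreNorm_smul (inv_ne_zero hc) y, profile,
      cosSq_eq_of_nsq_eq_one hx hc]
    set w := (herm y x)⁻¹ • y with hw
    have hwx : herm w x = 1 := herm_inv_smul_self hc
    have hρ := one_le_enorm2_of_herm_eq_one hx hwx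
    have hRw := hR x w hx1 hρ
    rw [enorm2_sq (w - x), nsq_sub_of_herm_eq_one hx hwx, ← enorm2_sq] at hRw
    set ρ := enorm2 w with hρd
    have hρ0 : 0 < ρ := by linarith
    rw [norm_mul, norm_mul, norm_pow, Complex.norm_real, norm_inv, Real.norm_of_nonneg
      (by positivity : 0 ≤ ρ ^ 2), fibreNorm, ← hρd]
    have hq : 0 ≤ ρ ^ 2 - 1 := by nlinarith
    calc (ρ ^ 2)⁻¹ ^ m * (‖S w‖ * ‖quotRem a d x w‖)
        ≤ (ρ ^ 2)⁻¹ ^ m * (‖S w‖ * (C * (ρ ^ 2 - 1) * ρ ^ d)) := by gcongr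
      _ = (C * ‖S w‖ * (ρ ^ 2 - 1)) * (ρ ^ d / ρ ^ (2 * m)) := by
        rw [inv_pow, ← pow_mul]; ring
      _ ≤ (C * ‖S w‖ * (ρ ^ 2 - 1)) * (1 / ρ ^ (m + d + 2 * j + 2)) := by
        refine mul_le_mul_of_nonneg_left ?_ (by positivity)
        rw [div_le_div_iff₀ (by positivity) (by positivity), ← pow_add, one_mul]
        exact pow_le_pow_right₀ hρ (by omega)
      _ = _ := by
        have e : 1 - (ρ ^ 2)⁻¹ = (ρ ^ 2 - 1) / ρ ^ 2 := by field_simp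
        rw [e, inv_pow, ← pow_mul, pow_add ρ (m + d + 2 * j) 2, pow_add ρ (m + d) (2 * j)]
        field_simp
  intro x
  by_cases hx : x = 0
  · have hm0 : m ≠ 0 := by omega
    have h0 : ∀ y, opIntegrand a d m S x y = 0 := by
      intro y
      have : herm x y = 0 := by simp [hx, herm]
      rw [opIntegrand, rpk, this]; simp [hm0]
    simp only [h0, integral_zero, zero_sub, norm_neg]
    rw [hx, hS.zero]
    simp [enorm2, nsq, hm0]
  -- Both sides scale with degree m + d in |x|, so unit vectors suffice.
  obtain ⟨c, u, hc, -, hu, rfl⟩ := exists_unit_smul hx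
  have hc0 : (c : ℂ) ≠ 0 := Complex.ofReal_ne_zero.2 hc.ne'
  have hu1 : enorm2 u = 1 := by rw [enorm2, hu, Real.sqrt_one]
  simp only [opIntegrand_smul_left, profile, cosSq_smul_left hc0, integral_const_mul]
  rw [hS.smul' hc0, mul_assoc, ← mul_sub, norm_mul, norm_pow, enorm2_smul, hu1, mul_one,
    mul_right_comm, mul_comm]
  exact mul_le_mul_of_nonneg_right (key u hu) (by positivity)

end kernel

/-! ### Schur's test and the weighted forms. -/

/-- Schur's test for the kernel `profile j`. -/
theorem integral_fibreNorm_profile_le {n N : ℕ} {S : (Fin (n + 1) → ℂ) → ℂ}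
    (hS : IsHomogHol N S) (j : ℕ) :
    Integrable (fun x => fibreNorm N S x *
        ∫ y, fibreNorm N S y * profile j x y ∂(gauss (n + 1))) (gauss (n + 1)) ∧
    ∫ x, fibreNorm N S x * ∫ y, fibreNorm N S y * profile j x y ∂(gauss (n + 1))
        ∂(gauss (n + 1)) ≤
      (betaMoment n j - betaMoment n (j + 1)) * ∫ x, fibreNorm N S x ^ 2 ∂(gauss (n + 1)) := by
  set γ := gauss (n + 1)
  set σ := fibreNorm N S with hσ
  set κ := betaMoment n j - betaMoment n (j + 1)
  obtain ⟨B, hB0, hB⟩ := hS.exists_fibreNorm_le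
  have hσ0 : ∀ x, 0 ≤ σ x := fibreNorm_nonneg N S
  have hσm : Measurable σ := hS.measurable_fibreNorm
  have hm1 : Measurable fun q : (Fin (n + 1) → ℂ) × (Fin (n + 1) → ℂ) => σ q.1 :=
    hσm.comp measurable_fst
  have hm2 : Measurable fun q : (Fin (n + 1) → ℂ) × (Fin (n + 1) → ℂ) => σ q.2 :=
    hσm.comp measurable_snd
  have hbd : ∀ (f : (Fin (n + 1) → ℂ) × (Fin (n + 1) → ℂ) → ℝ), Measurable f →
      (∀ q, 0 ≤ f q ∧ f q ≤ B * B) → Integrable (fun q => f q * profile j q.1 q.2) (γ.prod γ) := by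
    intro f hf h
    refine Integrable.of_bound (hf.mul (measurable_profile j)).aestronglyMeasurable (B * B * 1)
      (ae_of_all _ fun q => ?_)
    rw [Real.norm_of_nonneg (mul_nonneg (h q).1 (profile_nonneg _ _ _))]
    exact mul_le_mul (h q).2 (profile_le_one _ _ _) (profile_nonneg _ _ _) (by positivity)
  have i12 := hbd (fun q => σ q.1 * σ q.2) (hm1.mul hm2)
    fun q => ⟨mul_nonneg (hσ0 _) (hσ0 _), mul_le_mul (hB _) (hB _) (hσ0 _) hB0⟩
  have i11 := hbd (fun q => σ q.1 * σ q.1) (hm1.mul hm1)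
    fun q => ⟨mul_nonneg (hσ0 _) (hσ0 _), mul_le_mul (hB _) (hB _) (hσ0 _) hB0⟩
  have i22 := hbd (fun q => σ q.2 * σ q.2) (hm2.mul hm2)
    fun q => ⟨mul_nonneg (hσ0 _) (hσ0 _), mul_le_mul (hB _) (hB _) (hσ0 _) hB0⟩
  have e11 : ∫ q, σ q.1 * σ q.1 * profile j q.1 q.2 ∂(γ.prod γ) = κ * ∫ x, σ x ^ 2 ∂γ := by
    rw [integral_prod _ i11, ← integral_const_mul]
    refine integral_congr_ae (ae_of_all _ fun x => ?_)
    simp only [integral_const_mul]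
    -- The row integral has the constant value κ for x ≠ 0; at the origin the factor σ vanishes
    -- instead.
    by_cases hx : x = 0
    · have : σ x = 0 := by rw [hσ, fibreNorm, hx, hS.zero]; simp
      simp [this]
    · rw [integral_profile j hx]; ring
  have e22 : ∫ q, σ q.2 * σ q.2 * profile j q.1 q.2 ∂(γ.prod γ) = κ * ∫ x, σ x ^ 2 ∂γ := by
    rw [← e11, ← integral_prod_swap]
    simp only [Prod.fst_swap, Prod.snd_swap, profile_comm j]
  have e12 : ∫ x, σ x * ∫ y, σ y * profile j x y ∂γ ∂γ =
      ∫ q, σ q.1 * σ q.2 * profile j q.1 q.2 ∂(γ.prod γ) := by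
    rw [integral_prod _ i12]
    simp only [mul_assoc, integral_const_mul]
  constructor
  · have := i12.integral_prod_left
    simpa only [mul_assoc, integral_const_mul] using this
  rw [e12]
  -- Use σ(x)σ(y) ≤ (σ(x)² + σ(y)²)/2; by symmetry of the kernel both halves have the same integral.
  calc ∫ q, σ q.1 * σ q.2 * profile j q.1 q.2 ∂(γ.prod γ)
      ≤ ∫ q, (1 / 2 * (σ q.1 * σ q.1 * profile j q.1 q.2) +
          1 / 2 * (σ q.2 * σ q.2 * profile j q.1 q.2)) ∂(γ.prod γ) := by
        refine integral_mono i12 ((i11.const_mul _).add (i22.const_mul _)) fun q => ?_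
        have h1 := profile_nonneg j q.1 q.2
        have h2 : 0 ≤ (σ q.1 - σ q.2) ^ 2 * profile j q.1 q.2 := by positivity
        simp only
        nlinarith
    _ = κ * ∫ x, σ x ^ 2 ∂γ := by
        rw [integral_add (i11.const_mul _) (i22.const_mul _), integral_const_mul,
          integral_const_mul, e11, e22]
        ring

section forms

variable {n d : ℕ} (a : (Fin (n + 1) → ℕ) → (Fin (n + 1) → ℕ) → ℂ)

/-- The integrand of the weighted inner product of homogeneous functions. -/
noncomputable def innerFun (d m : ℕ) (S₁ S₂ : (Fin (n + 1) → ℂ) → ℂ) (x : Fin (n + 1) → ℂ) : ℂ :=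
  S₁ x * conj (S₂ x) / rpk d a m x x

/-- The integrand of the kernel form of homogeneous functions. -/
noncomputable def kernelFun (d m : ℕ) (S₁ S₂ : (Fin (n + 1) → ℂ) → ℂ)
    (x y : Fin (n + 1) → ℂ) : ℂ :=
  rpk d a m x y * conj (S₂ x) * S₁ y / (rpk d a m x x * rpk d a m y y)

/-- The weighted squared norm of a homogeneous function. -/
noncomputable def weightedNormSq (d m : ℕ) (S : (Fin (n + 1) → ℂ) → ℂ) : ℝ :=
  ∫ x, ‖S x‖ ^ 2 / ‖rpk d a m x x‖ ∂(gauss (n + 1))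

theorem kernelFun_eq (m : ℕ) (S₁ S₂ : (Fin (n + 1) → ℂ) → ℂ) (x y : Fin (n + 1) → ℂ) :
    kernelFun a d m S₁ S₂ x y = conj (S₂ x) / rpk d a m x x * opIntegrand a d m S₁ x y := by
  rw [kernelFun, opIntegrand, div_mul_div_comm]
  ring

/-- The operator estimate carries a factor |x|^(m+d); multiplied by it, the dual weight is bounded
by a fibre norm, with a constant independent of m. -/
theorem norm_conj_div_rpk_le {c : ℝ} (hc : 0 < c) (hcl : ∀ (m : ℕ) (v : Fin (n + 1) → ℂ), v ≠ 0 →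
      c * enorm2 v ^ (2 * (m + d)) ≤ ‖rpk d a m v v‖) (m : ℕ)
    {S : (Fin (n + 1) → ℂ) → ℂ} (hS : IsHomogHol (m + d) S) (x : Fin (n + 1) → ℂ) :
    ‖conj (S x) / rpk d a m x x‖ * enorm2 x ^ (m + d) ≤ fibreNorm (m + d) S x / c := by
  by_cases hx : x = 0
  · rw [hx, hS.zero, map_zero, zero_div, norm_zero, zero_mul]
    exact div_nonneg (fibreNorm_nonneg _ _ _) hc.le
  have hxp := enorm2_pos hx
  rw [norm_div, RCLike.norm_conj, fibreNorm]
  calc _ ≤ ‖S x‖ / (c * enorm2 x ^ (2 * (m + d))) * enorm2 x ^ (m + d) := by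
        have := hcl m x hx
        gcongr
    _ = _ := by
      generalize m + d = N
      rw [two_mul, pow_add (enorm2 x)]
      field_simp

theorem measurable_innerFun (m : ℕ) {S₁ S₂ : (Fin (n + 1) → ℂ) → ℂ} (h₁ : Measurable S₁)
    (h₂ : Measurable S₂) : Measurable (innerFun a d m S₁ S₂) :=
  (h₁.mul (Complex.continuous_conj.measurable.comp h₂)).div (continuous_rpk_self a m).measurable

theorem measurable_kernelFun (m : ℕ) {S₁ S₂ : (Fin (n + 1) → ℂ) → ℂ} (h₁ : Measurable S₁)
    (h₂ : Measurable S₂) :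
    Measurable fun q : (Fin (n + 1) → ℂ) × (Fin (n + 1) → ℂ) =>
      kernelFun a d m S₁ S₂ q.1 q.2 := by
  simp only [kernelFun_eq]
  exact (((Complex.continuous_conj.measurable.comp h₂).div
    (continuous_rpk_self a m).measurable).comp measurable_fst).mul (measurable_opIntegrand a m h₁)

theorem integrable_innerFun
    (hpos : ∀ v : Fin (n + 1) → ℂ, v ≠ 0 → 0 < biPol d a v v) (m : ℕ) {S₁ S₂ : (Fin (n + 1) → ℂ) → ℂ} (h₁ : IsHomogHol (m + d) S₁)
    (h₂ : IsHomogHol (m + d) S₂) : Integrable (innerFun a d m S₁ S₂) (gauss (n + 1)) := by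
  obtain ⟨c, hc, hcl⟩ := exists_lower_bound_rpk a hpos
  obtain ⟨B₁, hB₁, h₁b⟩ := h₁.exists_bound
  obtain ⟨B₂, hB₂, h₂b⟩ := h₂.exists_fibreNorm_le
  refine Integrable.of_bound (measurable_innerFun a m h₁.measurable
    h₂.measurable).aestronglyMeasurable (B₁ * (B₂ / c)) (ae_of_all _ fun x => ?_)
  have h3 := norm_conj_div_rpk_le a hc hcl m h₂ x
  have h4 : fibreNorm (m + d) S₂ x / c ≤ B₂ / c := by
    have := h₂b x
    gcongr
  rw [innerFun, mul_div_assoc, norm_mul]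
  calc _ ≤ B₁ * enorm2 x ^ (m + d) * ‖conj (S₂ x) / rpk d a m x x‖ := by
        have := h₁b x
        gcongr
    _ = B₁ * (‖conj (S₂ x) / rpk d a m x x‖ * enorm2 x ^ (m + d)) := by ring
    _ ≤ _ := mul_le_mul_of_nonneg_left (h3.trans h4) hB₁

theorem integrable_kernelFun
    (hpos : ∀ v : Fin (n + 1) → ℂ, v ≠ 0 → 0 < biPol d a v v) (m : ℕ) {S₁ S₂ : (Fin (n + 1) → ℂ) → ℂ} (h₁ : IsHomogHol (m + d) S₁)
    (h₂ : IsHomogHol (m + d) S₂) :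
    Integrable (fun q : (Fin (n + 1) → ℂ) × (Fin (n + 1) → ℂ) =>
      kernelFun a d m S₁ S₂ q.1 q.2) ((gauss (n + 1)).prod (gauss (n + 1))) := by
  obtain ⟨c, hc, hcl⟩ := exists_lower_bound_rpk a hpos
  obtain ⟨B₁, hB₁, h₁b⟩ := norm_opIntegrand_le a hpos m h₁
  obtain ⟨B₂, hB₂, h₂b⟩ := h₂.exists_fibreNorm_le
  refine Integrable.of_bound (measurable_kernelFun a m h₁.measurable
    h₂.measurable).aestronglyMeasurable (B₁ * (B₂ / c)) (ae_of_all _ fun q => ?_)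
  have h3 := norm_conj_div_rpk_le a hc hcl m h₂ q.1
  have h4 : fibreNorm (m + d) S₂ q.1 / c ≤ B₂ / c := by
    have := h₂b q.1
    gcongr
  rw [kernelFun_eq, norm_mul]
  calc _ ≤ ‖conj (S₂ q.1) / rpk d a m q.1 q.1‖ * (B₁ * enorm2 q.1 ^ (m + d)) := by
        have := h₁b q.1 q.2
        gcongr
    _ = B₁ * (‖conj (S₂ q.1) / rpk d a m q.1 q.1‖ * enorm2 q.1 ^ (m + d)) := by ring
    _ ≤ _ := mul_le_mul_of_nonneg_left (h3.trans h4) hB₁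

theorem innerFun_self
    (hpos : ∀ v : Fin (n + 1) → ℂ, v ≠ 0 → 0 < biPol d a v v) (m : ℕ) {S : (Fin (n + 1) → ℂ) → ℂ} (hS : IsHomogHol (m + d) S)
    (x : Fin (n + 1) → ℂ) :
    innerFun a d m S S x = ((‖S x‖ ^ 2 / ‖rpk d a m x x‖ : ℝ) : ℂ) := by
  by_cases hx : x = 0
  · simp [innerFun, hx, hS.zero]
  have h := rpk_self_pos a hpos m hx
  have h1 : ((‖rpk d a m x x‖ : ℝ) : ℂ) = rpk d a m x x := by
    rw [Complex.pos_iff] at h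
    have h2 : rpk d a m x x = ((rpk d a m x x).re : ℂ) := Complex.ext (by simp) (by simp [← h.2])
    rw [h2, Complex.norm_real, Real.norm_of_nonneg h.1.le]
  rw [innerFun, Complex.mul_conj, Complex.normSq_eq_norm_sq]
  push_cast
  rw [h1]

theorem integral_innerFun_self
    (hpos : ∀ v : Fin (n + 1) → ℂ, v ≠ 0 → 0 < biPol d a v v) (m : ℕ) {S : (Fin (n + 1) → ℂ) → ℂ} (hS : IsHomogHol (m + d) S) :
    ∫ x, innerFun a d m S S x ∂(gauss (n + 1)) = (weightedNormSq a d m S : ℂ) := by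
  simp only [innerFun_self a hpos m hS]
  rw [integral_complex_ofReal]; rfl

theorem integrable_weightedNormSq
    (hpos : ∀ v : Fin (n + 1) → ℂ, v ≠ 0 → 0 < biPol d a v v) (m : ℕ) {S : (Fin (n + 1) → ℂ) → ℂ}
    (hS : IsHomogHol (m + d) S) :
    Integrable (fun x => ‖S x‖ ^ 2 / ‖rpk d a m x x‖) (gauss (n + 1)) := by
  have := (integrable_innerFun a hpos m hS hS).re
  refine this.congr (ae_of_all _ fun x => ?_)
  simp only [innerFun_self a hpos m hS]
  exact Complex.ofReal_re _

/-- On the diagonal |r^m P| is at most the coefficient sum times |x|^(2(m+d)), and the coefficient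
sum does not depend on m. -/
theorem integral_fibreNorm_sq_le
    (hpos : ∀ v : Fin (n + 1) → ℂ, v ≠ 0 → 0 < biPol d a v v) (m : ℕ) {S : (Fin (n + 1) → ℂ) → ℂ}
    (hS : IsHomogHol (m + d) S) :
    ∫ x, fibreNorm (m + d) S x ^ 2 ∂(gauss (n + 1)) ≤
      coeffSum n d a * weightedNormSq a d m S := by
  rw [weightedNormSq, ← integral_const_mul]
  refine integral_mono_of_nonneg (ae_of_all _ fun x => by positivity)
    ((integrable_weightedNormSq a hpos m hS).const_mul _) (ae_of_all _ fun x => ?_)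
  simp only
  have hA := coeffSum_nonneg (d := d) a
  by_cases hx : x = 0
  · simp [fibreNorm, hx, hS.zero]
  have hxp := enorm2_pos hx
  have h1 := norm_rpk_le (d := d) a m x x
  have h2 : 0 < ‖rpk d a m x x‖ := norm_pos_iff.2 (rpk_self_pos a hpos m hx).ne'
  rw [fibreNorm, div_pow, ← mul_div_assoc, div_le_div_iff₀ (by positivity) h2]
  calc ‖S x‖ ^ 2 * ‖rpk d a m x x‖ ≤
        ‖S x‖ ^ 2 * (coeffSum n d a * (enorm2 x ^ (m + d) * enorm2 x ^ (m + d))) := by gcongr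
    _ = _ := by ring

theorem betaMoment_sub (n j : ℕ) :
    betaMoment n j - betaMoment n (j + 1) = betaMoment n j * (n / (j + n + 1)) := by
  rw [betaMoment, betaMoment, show j + 1 + n = j + n + 1 by ring, Nat.factorial_succ,
    Nat.factorial_succ]
  push_cast
  field_simp
  ring

theorem betaMoment_sub_nonneg (n j : ℕ) : 0 ≤ betaMoment n j - betaMoment n (j + 1) := by
  rw [betaMoment_sub, betaMoment]; positivity

/-- The pointwise operator estimate is paired with the conjugate of S(x) divided by (r^m P)(x,x̄).
The lower bound on P turns this into a double integral of fibre norms, Schur's test bounds that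
integral, and the upper bound on P returns to the weighted norm. The constant depends on neither m
nor j. -/
theorem norm_integral_kernelFun_sub_le
    (hpos : ∀ v : Fin (n + 1) → ℂ, v ≠ 0 → 0 < biPol d a v v) :
    ∃ C : ℝ, 0 ≤ C ∧ ∀ (m j : ℕ), 2 * j + 2 * d + 2 ≤ m → ∀ S : (Fin (n + 1) → ℂ) → ℂ,
      IsHomogHol (m + d) S →
      ‖∫ x, ∫ y, kernelFun a d m S S x y ∂(gauss (n + 1)) ∂(gauss (n + 1)) -
          betaMoment n m * weightedNormSq a d m S‖ ≤
        C * (betaMoment n j - betaMoment n (j + 1)) * weightedNormSq a d m S := by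
  obtain ⟨C, hC, hJ⟩ := norm_integral_opIntegrand_sub_le a hpos
  obtain ⟨c, hc, hcl⟩ := exists_lower_bound_rpk a hpos
  have hA := coeffSum_nonneg (d := d) a
  refine ⟨C / c * coeffSum n d a, by positivity, fun m j hmj S hS => ?_⟩
  obtain ⟨hi, hle⟩ := integral_fibreNorm_profile_le hS j
  have hK := (integrable_kernelFun a hpos m hS hS).integral_prod_left
  rw [← integral_innerFun_self a hpos m hS, ← integral_const_mul,
    ← integral_sub hK ((integrable_innerFun a hpos m hS hS).const_mul _)]
  calc _ ≤ ∫ x, C / c * (fibreNorm (m + d) S x *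
        ∫ y, fibreNorm (m + d) S y * profile j x y ∂(gauss (n + 1))) ∂(gauss (n + 1)) := by
        refine norm_integral_le_of_norm_le (hi.const_mul _) (ae_of_all _ fun x => ?_)
        have e : ∫ y, kernelFun a d m S S x y ∂(gauss (n + 1)) -
            betaMoment n m * innerFun a d m S S x = conj (S x) / rpk d a m x x *
              (∫ y, opIntegrand a d m S x y ∂(gauss (n + 1)) - S x * betaMoment n m) := by
          simp only [kernelFun_eq, integral_const_mul, innerFun]
          ring
        have hI : 0 ≤ ∫ y, fibreNorm (m + d) S y * profile j x y ∂(gauss (n + 1)) :=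
          integral_nonneg fun y => mul_nonneg (fibreNorm_nonneg _ _ _) (profile_nonneg _ _ _)
        simp only
        rw [e, norm_mul]
        calc _ ≤ ‖conj (S x) / rpk d a m x x‖ * (C * enorm2 x ^ (m + d) *
              ∫ y, fibreNorm (m + d) S y * profile j x y ∂(gauss (n + 1))) := by
              have := hJ m j hmj S hS x
              gcongr
          _ = (‖conj (S x) / rpk d a m x x‖ * enorm2 x ^ (m + d)) * (C *
              ∫ y, fibreNorm (m + d) S y * profile j x y ∂(gauss (n + 1))) := by ring
          _ ≤ fibreNorm (m + d) S x / c * (C *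
              ∫ y, fibreNorm (m + d) S y * profile j x y ∂(gauss (n + 1))) :=
              mul_le_mul_of_nonneg_right (norm_conj_div_rpk_le a hc hcl m hS x) (by positivity)
          _ = _ := by ring
    _ ≤ C / c * ((betaMoment n j - betaMoment n (j + 1)) *
          (coeffSum n d a * weightedNormSq a d m S)) := by
        rw [integral_const_mul]
        refine mul_le_mul_of_nonneg_left (hle.trans ?_) (by positivity)
        exact mul_le_mul_of_nonneg_left (integral_fibreNorm_sq_le a hpos m hS)
          (betaMoment_sub_nonneg n j)
    _ = _ := by ring

end forms

/-! ### Asymptotics of the moments. -/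

theorem pow_mul_betaMoment_le (n j : ℕ) : ((j : ℝ) + 1) ^ n * betaMoment n j ≤ n ! := by
  have h : (j ! * (j + 1) ^ n : ℕ) ≤ (j + n)! := Nat.factorial_mul_pow_le_factorial
  have h' : (j ! : ℝ) * ((j : ℝ) + 1) ^ n ≤ (j + n)! := by exact_mod_cast h
  rw [betaMoment, ← mul_div_assoc, div_le_iff₀ (by positivity)]
  calc _ = (n ! : ℝ) * (j ! * ((j : ℝ) + 1) ^ n) := by ring
    _ ≤ _ := by gcongr

/-- The difference is the moment itself times n/(j+n+1), so it gains one power of j over the moment.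
-/
theorem betaMoment_sub_le (n j : ℕ) :
    betaMoment n j - betaMoment n (j + 1) ≤ n * n ! / ((j : ℝ) + 1) ^ (n + 1) := by
  rw [betaMoment_sub]
  have h1 : betaMoment n j ≤ n ! / ((j : ℝ) + 1) ^ n := by
    rw [le_div_iff₀ (by positivity), mul_comm]
    exact pow_mul_betaMoment_le n j
  have h2 : (n : ℝ) / (j + n + 1) ≤ n / (j + 1) := by
    gcongr
    have : (0 : ℝ) ≤ n := by positivity
    linarith
  calc _ ≤ n ! / ((j : ℝ) + 1) ^ n * (n / (j + 1)) := by gcongr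
    _ = _ := by rw [pow_succ]; field_simp

/-- The ratio (m+n)!/m! lies between (m+1)^n and (m+n)^n, and Bernoulli's inequality bounds
(m/(m+n))^n below by 1 − n²/(m+n). -/
theorem abs_betaMoment_sub_le (n : ℕ) {m : ℕ} (hm : 0 < m) :
    |betaMoment n m - n ! / (m : ℝ) ^ n| ≤ n ^ 2 * n ! / (m : ℝ) ^ (n + 1) := by
  have hm' : (0 : ℝ) < m := by exact_mod_cast hm
  have hup : betaMoment n m ≤ n ! / (m : ℝ) ^ n := by
    rw [le_div_iff₀ (by positivity), mul_comm]
    have h0 : 0 ≤ betaMoment n m := by unfold betaMoment; positivity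
    refine le_trans ?_ (pow_mul_betaMoment_le n m)
    gcongr
    linarith
  have hlow : (n ! : ℝ) / ((m : ℝ) + n) ^ n ≤ betaMoment n m := by
    have h : (m + n)! ≤ m ! * (m + n) ^ n := by
      rw [← Nat.factorial_mul_ascFactorial]
      exact Nat.mul_le_mul_left _ (Nat.ascFactorial_le_pow_add m n)
    have h' : ((m + n)! : ℝ) ≤ m ! * ((m : ℝ) + n) ^ n := by exact_mod_cast h
    rw [betaMoment, div_le_div_iff₀ (by positivity) (by positivity)]
    calc _ ≤ (n ! : ℝ) * (m ! * ((m : ℝ) + n) ^ n) := by gcongr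
      _ = _ := by ring
  have hbern : 1 - (n : ℝ) * (n / (m + n)) ≤ ((m : ℝ) / (m + n)) ^ n := by
    have := one_add_mul_le_pow (a := -((n : ℝ) / (m + n))) (by
      have : (n : ℝ) / (m + n) ≤ 1 := div_le_one_of_le₀ (by linarith) (by positivity)
      linarith) n
    have e : 1 + -((n : ℝ) / (m + n)) = m / (m + n) := by field_simp; ring
    rw [e] at this
    linarith
  rw [abs_le]
  constructor
  · have e : (n ! : ℝ) / ((m : ℝ) + n) ^ n = n ! / (m : ℝ) ^ n * ((m : ℝ) / (m + n)) ^ n := by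
      rw [div_pow]; field_simp
    have h1 : n ! / (m : ℝ) ^ n * (1 - (n : ℝ) * (n / (m + n))) ≤ betaMoment n m := by
      refine le_trans ?_ hlow
      rw [e]
      exact mul_le_mul_of_nonneg_left hbern (by positivity)
    have h2 : n ! / (m : ℝ) ^ n * ((n : ℝ) * (n / (m + n))) ≤ n ^ 2 * n ! / (m : ℝ) ^ (n + 1) := by
      calc _ ≤ n ! / (m : ℝ) ^ n * ((n : ℝ) * (n / m)) := by
            gcongr
            have : (0 : ℝ) ≤ n := by positivity
            linarith
        _ = _ := by field_simp; ring
    linarith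
  · have : (0 : ℝ) ≤ n ^ 2 * n ! / (m : ℝ) ^ (n + 1) := by positivity
    linarith

/-! ### Sections as homogeneous functions, and linear coordinates. -/

theorem H0val_of_ne_zero {n k : ℕ} (s : H0 n k) {v : Fin (n + 1) → ℂ} (hv : v ≠ 0) :
    H0val s v = (s.1 (Projectivization.mk ℂ v hv)).1 ⟨v, CPn.mem_submodule_mk v hv⟩ := by
  simp [H0val, sectionLift, hv]

theorem H0val_zero_vec {n k : ℕ} (s : H0 n k) : H0val s 0 = 0 := by
  simp [H0val, sectionLift]

theorem H0val_add {n k : ℕ} (s t : H0 n k) (v : Fin (n + 1) → ℂ) :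
    H0val (s + t) v = H0val s v + H0val t v := by
  by_cases hv : v = 0
  · simp [hv, H0val_zero_vec]
  · rw [H0val_of_ne_zero _ hv, H0val_of_ne_zero _ hv, H0val_of_ne_zero _ hv]; rfl

theorem H0val_smul {n k : ℕ} (c : ℂ) (s : H0 n k) (v : Fin (n + 1) → ℂ) :
    H0val (c • s) v = c * H0val s v := by
  by_cases hv : v = 0
  · simp [hv, H0val_zero_vec]
  · rw [H0val_of_ne_zero _ hv, H0val_of_ne_zero _ hv]; rfl

theorem section_val_congr {n k : ℕ} (s : ∀ x : CPn n, OFibre k x) {x y : CPn n} (h : x = y)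
    {u : Fin (n + 1) → ℂ} (hx : u ∈ x.submodule) (hy : u ∈ y.submodule) :
    (s x).1 ⟨u, hx⟩ = (s y).1 ⟨u, hy⟩ := by
  subst h; rfl

theorem H0val_smul_vec {n k : ℕ} (s : H0 n k) {c : ℂ} (hc : c ≠ 0) {v : Fin (n + 1) → ℂ}
    (hv : v ≠ 0) : H0val s (c • v) = c ^ k * H0val s v := by
  have hcv : c • v ≠ 0 := smul_ne_zero hc hv
  have hmk : Projectivization.mk ℂ (c • v) hcv = Projectivization.mk ℂ v hv :=
    (Projectivization.mk_eq_mk_iff' ℂ _ _ hcv hv).2 ⟨c, rfl⟩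
  rw [H0val_of_ne_zero _ hcv, H0val_of_ne_zero _ hv, section_val_congr s.1 hmk _
    (Submodule.smul_mem _ c (CPn.mem_submodule_mk v hv))]
  exact (s.1 (Projectivization.mk ℂ v hv)).2 c ⟨v, CPn.mem_submodule_mk v hv⟩

theorem H0_eq_zero {n k : ℕ} {s : H0 n k} (h : ∀ v, v ≠ 0 → H0val s v = 0) : s = 0 := by
  refine Subtype.ext (funext fun x => Subtype.ext (funext fun u => ?_))
  induction x using Projectivization.ind with
  | h v hv =>
    obtain ⟨u, hu⟩ := u
    have hu' := hu
    rw [Projectivization.submodule_mk, Submodule.mem_span_singleton] at hu'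
    obtain ⟨c, rfl⟩ := hu'
    have := (s.1 (Projectivization.mk ℂ v hv)).2 c ⟨v, CPn.mem_submodule_mk v hv⟩
    have h2 := h v hv
    rw [H0val_of_ne_zero _ hv] at h2
    rw [h2, mul_zero] at this
    exact this

theorem isHomogHol_H0val {n k : ℕ} (s : H0 n k)
    (L : (Fin (n + 1) → ℂ) ≃ₗ[ℂ] (Fin (n + 1) → ℂ)) :
    IsHomogHol k fun u => H0val s (L u) where
  diff := by
    have hL : Differentiable ℂ L :=
      (LinearMap.toContinuousLinearMap (L : (Fin (n + 1) → ℂ) →ₗ[ℂ] (Fin (n + 1) → ℂ))).differentiable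
    have hs : DifferentiableOn ℂ (H0val s) {0}ᶜ := s.2
    exact hs.comp hL.differentiableOn fun u hu => by simpa using hu
  smul c v hc hv := by
    rw [map_smul]
    exact H0val_smul_vec s hc (by simpa using hv)
  zero := by rw [map_zero, H0val_zero_vec]

/-- The section of `O(1)` defined by the linear form with coefficients `l`. -/
def linSection (n : ℕ) : (Fin (n + 1) → ℂ) →ₗ[ℂ] H0 n 1 where
  toFun l := ⟨fun x => ⟨fun v => l ⬝ᵥ v.1, fun c v => by simp⟩, by
    have hl : Differentiable ℂ fun v : Fin (n + 1) → ℂ => l ⬝ᵥ v := by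
      unfold dotProduct; fun_prop
    refine hl.differentiableOn.congr fun v hv => ?_
    have hv' : v ≠ 0 := hv
    simp [sectionLift, hv']⟩
  map_add' l l' := by
    refine Subtype.ext (funext fun x => Subtype.ext (funext fun u => ?_))
    exact add_dotProduct l l' u.1
  map_smul' c l := by
    refine Subtype.ext (funext fun x => Subtype.ext (funext fun u => ?_))
    change c • l ⬝ᵥ u.1 = c • (l ⬝ᵥ u.1)
    exact smul_dotProduct c l u.1

theorem H0val_linSection {n : ℕ} (l v : Fin (n + 1) → ℂ) :
    H0val (linSection n l) v = l ⬝ᵥ v := by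
  by_cases hv : v = 0
  · rw [hv, H0val_zero_vec, dotProduct_zero]
  · rw [H0val_of_ne_zero _ hv]; rfl

/-- A dimension count: linear forms inject into the sections of O(1), and the given basis has n + 1
elements. No extension theorem for holomorphic functions is needed. -/
theorem linSection_surjective {n : ℕ} (Φ : Module.Basis (Fin (n + 1)) ℂ (H0 n 1)) :
    Function.Surjective (linSection n) := by
  have hinj : Function.Injective (Φ.equivFun.toLinearMap ∘ₗ linSection n) := by
    refine Φ.equivFun.injective.comp fun l l' h => funext fun i => ?_
    have h' : ∀ v, l ⬝ᵥ v = l' ⬝ᵥ v := fun v => by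
      rw [← H0val_linSection, h, H0val_linSection]
    simpa using h' (Pi.single i 1)
  have h := LinearMap.surjective_of_injective hinj
  exact (Function.Surjective.of_comp_iff' Φ.equivFun.bijective (linSection n)).1 h

/-- A vector at which all basis sections vanish is a zero of every section of O(1), in particular of
all coordinate forms; hence it is 0. -/
theorem exists_linearEquiv_H0val {n : ℕ} (Φ : Module.Basis (Fin (n + 1)) ℂ (H0 n 1)) :
    ∃ A : (Fin (n + 1) → ℂ) ≃ₗ[ℂ] (Fin (n + 1) → ℂ), ∀ v i, H0val (Φ i) v = A v i := by
  choose l hl using fun i => linSection_surjective Φ (Φ i)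
  let A : (Fin (n + 1) → ℂ) →ₗ[ℂ] (Fin (n + 1) → ℂ) := Matrix.mulVecLin (Matrix.of l)
  have hAv : ∀ v i, H0val (Φ i) v = A v i := fun v i => by
    rw [← hl, H0val_linSection]; rfl
  have hA : Function.Injective A := by
    rw [← LinearMap.ker_eq_bot, LinearMap.ker_eq_bot']
    intro v hv
    have h0 : ∀ s : H0 n 1, H0val s v = 0 := by
      intro s
      let ev : H0 n 1 →ₗ[ℂ] ℂ :=
        { toFun := fun s => H0val s v
          map_add' := fun s t => H0val_add s t v
          map_smul' := fun c s => H0val_smul c s v }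
      have : ev = 0 := Φ.ext fun i => by
        change H0val (Φ i) v = 0
        rw [hAv, hv]; rfl
      exact LinearMap.congr_fun this s
    ext i
    have := h0 (linSection n (Pi.single i 1))
    rw [H0val_linSection] at this
    simpa using this
  exact ⟨LinearEquiv.ofInjectiveEndo A hA, hAv⟩

/-! ### The projection to projective space and measurability of the affine chart. -/

/-- The projection `v ↦ [v]`, extended to `0` by an arbitrary value. -/
noncomputable def projMap {n : ℕ} (v : Fin (n + 1) → ℂ) : CPn n :=
  open Classical in if hv : v ≠ 0 then Projectivization.mk ℂ v hv else affineChart 0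

theorem projMap_of_ne_zero {n : ℕ} {v : Fin (n + 1) → ℂ} (hv : v ≠ 0) :
    projMap v = Projectivization.mk ℂ v hv := by
  simp [projMap, hv]

theorem projMap_affineVec {n : ℕ} (z : Fin n → ℂ) : projMap (affineVec z) = affineChart z :=
  projMap_of_ne_zero (affineVec_ne_zero z)

theorem projMap_smul {n : ℕ} {c : ℂ} (hc : c ≠ 0) (v : Fin (n + 1) → ℂ) :
    projMap (c • v) = projMap v := by
  by_cases hv : v = 0
  · simp [hv]
  · rw [projMap_of_ne_zero hv, projMap_of_ne_zero (smul_ne_zero hc hv)]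
    exact (Projectivization.mk_eq_mk_iff' ℂ _ _ _ hv).2 ⟨c, rfl⟩

theorem exists_rep_projMap {n : ℕ} {v : Fin (n + 1) → ℂ} (hv : v ≠ 0) :
    ∃ c : ℂ, c ≠ 0 ∧ (projMap v).rep = c • v := by
  obtain ⟨c, hc⟩ := Projectivization.exists_smul_eq_mk_rep ℂ v hv
  exact ⟨c, c.ne_zero, by rw [projMap_of_ne_zero hv, ← hc]; rfl⟩

theorem continuousOn_projMap {n : ℕ} :
    ContinuousOn (projMap : (Fin (n + 1) → ℂ) → CPn n) {0}ᶜ := by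
  rw [continuousOn_iff_continuous_domRestrict]
  have h : Continuous fun v : {v : Fin (n + 1) → ℂ // v ≠ 0} => Projectivization.mk ℂ v.1 v.2 :=
    continuous_coinduced_rng
  exact h.congr fun v => (projMap_of_ne_zero v.2).symm

theorem measurable_projMap {n : ℕ} : Measurable (projMap : (Fin (n + 1) → ℂ) → CPn n) :=
  measurable_of_continuousOn_compl_singleton 0 continuousOn_projMap

theorem isOpen_of_isOpen_preimage_projMap {n : ℕ} {E : Set (CPn n)}
    (h : IsOpen {v : Fin (n + 1) → ℂ | v ≠ 0 ∧ projMap v ∈ E}) : IsOpen E := by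
  change IsOpen[TopologicalSpace.coinduced _ _] E
  rw [isOpen_coinduced]
  have := h.preimage (continuous_subtype_val (p := fun v : Fin (n + 1) → ℂ => v ≠ 0))
  convert this using 1
  ext v
  simp only [Set.mem_preimage, Set.mem_ofPred_eq]
  rw [projMap_of_ne_zero v.2]
  exact ⟨fun h => ⟨v.2, h⟩, fun h => h.2⟩

/-- The affine coordinates `(x_1 / x_0, …, x_n / x_0)` of a point of projective space. -/
noncomputable def affineCoord {n : ℕ} (x : CPn n) : Fin n → ℂ := fun j => x.rep j.succ / x.rep 0

theorem affineCoord_projMap {n : ℕ} {v : Fin (n + 1) → ℂ} (hv : v ≠ 0) :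
    affineCoord (projMap v) = fun j => v j.succ / v 0 := by
  obtain ⟨c, hc, h⟩ := exists_rep_projMap hv
  funext j
  rw [affineCoord, h, Pi.smul_apply, Pi.smul_apply, smul_eq_mul, smul_eq_mul,
    mul_div_mul_left _ _ hc]

theorem rep_projMap_zero_ne_zero_iff {n : ℕ} {v : Fin (n + 1) → ℂ} (hv : v ≠ 0) :
    (projMap v).rep 0 ≠ 0 ↔ v 0 ≠ 0 := by
  obtain ⟨c, hc, h⟩ := exists_rep_projMap hv
  simp [h, hc]

theorem exists_eq_projMap {n : ℕ} (x : CPn n) : ∃ v, v ≠ 0 ∧ x = projMap v :=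
  ⟨x.rep, x.rep_nonzero, by rw [projMap_of_ne_zero x.rep_nonzero, x.mk_rep]⟩

theorem isOpen_affine_inter {n : ℕ} {W : Set (Fin n → ℂ)} (hW : IsOpen W) :
    IsOpen {x : CPn n | x.rep 0 ≠ 0 ∧ affineCoord x ∈ W} := by
  refine isOpen_of_isOpen_preimage_projMap ?_
  have hU : IsOpen {v : Fin (n + 1) → ℂ | v 0 ≠ 0} :=
    isOpen_ne_fun (continuous_apply 0) continuous_const
  have hc : ContinuousOn (fun v : Fin (n + 1) → ℂ => fun j : Fin n => v j.succ / v 0)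
      {v | v 0 ≠ 0} := by
    refine continuousOn_pi.2 fun j => ?_
    exact (continuous_apply _).continuousOn.div (continuous_apply _).continuousOn fun v hv => hv
  convert hc.isOpen_inter_preimage hU hW using 1
  ext v
  simp only [Set.mem_ofPred_eq, Set.mem_inter_iff, Set.mem_preimage]
  constructor
  · rintro ⟨hv, h1, h2⟩
    rw [affineCoord_projMap hv] at h2
    exact ⟨(rep_projMap_zero_ne_zero_iff hv).1 h1, h2⟩
  · rintro ⟨h1, h2⟩
    have hv : v ≠ 0 := by rintro rfl; exact h1 rfl
    rw [affineCoord_projMap hv]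
    exact ⟨hv, (rep_projMap_zero_ne_zero_iff hv).2 h1, h2⟩

theorem measurableSet_affine (n : ℕ) : MeasurableSet {x : CPn n | x.rep 0 ≠ 0} := by
  have := (isOpen_affine_inter (n := n) isOpen_univ).measurableSet
  simpa using this

theorem measurable_affineCoord {n : ℕ} : Measurable (affineCoord : CPn n → Fin n → ℂ) := by
  refine measurable_of_isOpen fun W hW => ?_
  have h1 := (isOpen_affine_inter hW).measurableSet
  -- Division by zero sends the whole hyperplane x_0 = 0 to the origin, so it contributes either
  -- everything or nothing.
  have h2 : MeasurableSet {x : CPn n | ¬ x.rep 0 ≠ 0 ∧ (0 : Fin n → ℂ) ∈ W} :=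
    (measurableSet_affine n).compl.inter (MeasurableSet.const _)
  convert h1.union h2 using 1
  ext x
  simp only [Set.mem_preimage, Set.mem_union, Set.mem_ofPred_eq]
  by_cases hx : x.rep 0 = 0
  · have : affineCoord x = 0 := by funext j; simp [affineCoord, hx]
    simp [hx, this]
  · simp [hx]

/-- The chart has a measurable left inverse and a measurable image. This matters because the
integrands are written with chosen representatives, so their measurability is tested in the chart.
-/
theorem measurableEmbedding_affineChart {n : ℕ} :
    MeasurableEmbedding (affineChart : (Fin n → ℂ) → CPn n) := by
  have hcoord : ∀ z : Fin n → ℂ, affineCoord (affineChart z) = z := by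
    intro z
    rw [← projMap_affineVec, affineCoord_projMap (affineVec_ne_zero z)]
    funext j
    simp [affineVec]
  have hmeas : Measurable (affineChart : (Fin n → ℂ) → CPn n) := by
    simp only [funext_iff.2 fun z => (projMap_affineVec z).symm]
    exact measurable_projMap.comp continuous_affineVec.measurable
  refine MeasurableEmbedding.of_measurable_inverse hmeas ?_ measurable_affineCoord hcoord
  convert measurableSet_affine n using 1
  ext x
  constructor
  · rintro ⟨z, rfl⟩
    rw [Set.mem_ofPred_eq, ← projMap_affineVec, rep_projMap_zero_ne_zero_iff (affineVec_ne_zero z)]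
    simp [affineVec]
  · intro hx
    obtain ⟨v, hv, rfl⟩ := exists_eq_projMap x
    have h0 : v 0 ≠ 0 := (rep_projMap_zero_ne_zero_iff hv).1 hx
    refine ⟨fun j => v j.succ / v 0, ?_⟩
    rw [← projMap_affineVec, ← projMap_smul h0]
    congr 1
    ext i
    refine Fin.cases ?_ (fun j => ?_) i
    · simp [affineVec]
    · simp [affineVec, mul_div_cancel₀ _ h0]

/-! ### The determinant of the Fubini–Study metric. -/

/-- Allows derivatives to be computed along real lines, on which |u|² is a quadratic polynomial. -/
theorem fderiv_eq_of_hasDerivAt {E F : Type*} [NormedAddCommGroup E] [NormedSpace ℝ E]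
    [NormedAddCommGroup F] [NormedSpace ℝ F] {f : E → F} {z h : E} {f' : F}
    (hf : DifferentiableAt ℝ f z) (hd : HasDerivAt (fun t : ℝ => f (z + t • h)) f' 0) :
    fderiv ℝ f z h = f' := by
  rw [← hf.lineDeriv_eq_fderiv]
  exact HasLineDerivAt.lineDeriv hd

theorem herm_add_right {k : ℕ} (u v w : Fin k → ℂ) : herm u (v + w) = herm u v + herm u w := by
  rw [← conj_herm, herm_add_left, map_add, conj_herm, conj_herm]

theorem nsq_add_smul {k : ℕ} (u b : Fin k → ℂ) (t : ℝ) :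
    nsq (u + t • b) = nsq u + t * (2 * (herm b u).re) + t ^ 2 * nsq b := by
  have h : herm (u + (t : ℂ) • b) (u + (t : ℂ) • b) =
      herm u u + t * (herm b u + conj (herm b u)) + t ^ 2 * herm b b := by
    rw [herm_add_left, herm_add_right, herm_add_right, herm_smul_left, herm_smul_left,
      herm_smul_right, herm_smul_right, conj_herm, Complex.conj_ofReal]
    ring
  rw [Complex.add_conj, herm_self, herm_self, herm_self] at h
  have e : t • b = (t : ℂ) • b := by ext i; simp
  rw [e]
  exact_mod_cast h

theorem hasDerivAt_nsq {k : ℕ} (u b : Fin k → ℂ) :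
    HasDerivAt (fun t : ℝ => nsq (u + t • b)) (2 * (herm b u).re) 0 := by
  simp only [nsq_add_smul]
  have h1 : HasDerivAt (fun t : ℝ => t * (2 * (herm b u).re)) (1 * (2 * (herm b u).re)) 0 :=
    (hasDerivAt_id (0 : ℝ)).mul_const _
  have h2 : HasDerivAt (fun t : ℝ => t ^ 2 * nsq b) ((2 : ℕ) * (0 : ℝ) ^ (2 - 1) * nsq b) 0 :=
    (hasDerivAt_pow 2 (0 : ℝ)).mul_const _
  have h := (h1.const_add (nsq u)).add h2
  refine h.congr_deriv ?_
  simp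

section FubiniStudy

variable {n : ℕ} (A : (Fin (n + 1) → ℂ) ≃ₗ[ℂ] (Fin (n + 1) → ℂ))

theorem affineVec_add_smul (z h : Fin n → ℂ) (t : ℝ) :
    affineVec (z + t • h) = affineVec z + t • (Fin.cons 0 h : Fin (n + 1) → ℂ) := by
  ext i
  refine Fin.cases ?_ (fun j => ?_) i <;> simp [affineVec]

theorem map_affineVec_add_smul (z h : Fin n → ℂ) (t : ℝ) :
    A (affineVec (z + t • h)) = A (affineVec z) + t • A (Fin.cons 0 h) := by
  have : ∀ v : Fin (n + 1) → ℂ, t • v = (t : ℂ) • v := fun v => by ext i; simp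
  rw [affineVec_add_smul, map_add, this, this, map_smul]

theorem cons_single (k : Fin n) (c : ℂ) :
    (Fin.cons 0 (Pi.single k c) : Fin (n + 1) → ℂ) = c • Pi.single k.succ 1 := by
  ext i
  refine Fin.cases ?_ (fun j => ?_) i
  · simp
  · simp only [Fin.cons_succ, Pi.smul_apply, Pi.single_apply, Fin.succ_inj]
    split_ifs <;> simp

theorem differentiable_map_affineVec : Differentiable ℝ fun z : Fin n → ℂ => A (affineVec z) := by
  have hA : Differentiable ℂ A := (LinearMap.toContinuousLinearMap
    (A : (Fin (n + 1) → ℂ) →ₗ[ℂ] (Fin (n + 1) → ℂ))).differentiable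
  have hv : Differentiable ℝ (affineVec : (Fin n → ℂ) → Fin (n + 1) → ℂ) := by
    refine differentiable_pi.2 fun i => ?_
    refine Fin.cases ?_ (fun j => ?_) i
    · simp [affineVec]
    · simp only [affineVec, Fin.cons_succ]; fun_prop
  exact (hA.restrictScalars ℝ).comp hv

theorem differentiable_nsq {k : ℕ} : Differentiable ℝ (nsq : (Fin k → ℂ) → ℝ) := by
  unfold nsq
  refine Differentiable.fun_sum fun i _ => ?_
  exact Differentiable.norm_sq ℝ (by fun_prop)

theorem nsq_map_affineVec_pos (z : Fin n → ℂ) : 0 < nsq (A (affineVec z)) :=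
  nsq_pos (by simpa using affineVec_ne_zero z)

theorem differentiable_nsq_map_affineVec :
    Differentiable ℝ fun z : Fin n → ℂ => nsq (A (affineVec z)) :=
  differentiable_nsq.comp (differentiable_map_affineVec A)

theorem hasDerivAt_nsq_map_affineVec (z h : Fin n → ℂ) :
    HasDerivAt (fun t : ℝ => nsq (A (affineVec (z + t • h))))
      (2 * (herm (A (Fin.cons 0 h)) (A (affineVec z))).re) 0 := by
  simp only [map_affineVec_add_smul]
  exact hasDerivAt_nsq _ _

theorem dzbar_log_nsq (k : Fin n) (z : Fin n → ℂ) :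
    dzbar k (fun z => ((Real.log (nsq (A (affineVec z))) : ℝ) : ℂ)) z =
      herm (A (affineVec z)) (A (Pi.single k.succ 1)) / nsq (A (affineVec z)) := by
  have hr := nsq_map_affineVec_pos A z
  have hdiff : DifferentiableAt ℝ (fun z => ((Real.log (nsq (A (affineVec z))) : ℝ) : ℂ)) z :=
    Complex.ofRealCLM.differentiableAt.comp z
      ((differentiable_nsq_map_affineVec A z).log hr.ne')
  have hd : ∀ h : Fin n → ℂ,
      fderiv ℝ (fun z => ((Real.log (nsq (A (affineVec z))) : ℝ) : ℂ)) z h =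
        ((2 * (herm (A (Fin.cons 0 h)) (A (affineVec z))).re / nsq (A (affineVec z)) : ℝ) : ℂ) := by
    intro h
    refine fderiv_eq_of_hasDerivAt hdiff (HasDerivAt.ofReal_comp ?_)
    have := (hasDerivAt_nsq_map_affineVec A z h).log (by simpa using hr.ne')
    simpa using this
  rw [dzbar, hd, hd, cons_single, cons_single, map_smul, map_smul, herm_smul_left, herm_smul_left,
    one_mul, ← conj_herm (A (Pi.single k.succ 1)) (A (affineVec z))]
  have hr' : (nsq (A (affineVec z)) : ℂ) ≠ 0 := by exact_mod_cast hr.ne'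
  generalize herm (A (Pi.single k.succ 1)) (A (affineVec z)) = g
  push_cast
  field_simp
  apply Complex.ext <;> simp

theorem dz_dzbar_log_nsq (j k : Fin n) (z : Fin n → ℂ) :
    dz j (dzbar k (fun z => ((Real.log (nsq (A (affineVec z))) : ℝ) : ℂ))) z =
      (herm (A (Pi.single j.succ 1)) (A (Pi.single k.succ 1)) -
        herm (A (Pi.single j.succ 1)) (A (affineVec z)) / nsq (A (affineVec z)) *
        herm (A (affineVec z)) (A (Pi.single k.succ 1))) / nsq (A (affineVec z)) := by
  rw [funext (dzbar_log_nsq A k)]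
  have hr := nsq_map_affineVec_pos A z
  have hr' : (nsq (A (affineVec z)) : ℂ) ≠ 0 := by exact_mod_cast hr.ne'
  have hN : Differentiable ℝ fun z => herm (A (affineVec z)) (A (Pi.single k.succ 1)) := by
    unfold herm
    refine Differentiable.fun_sum fun i _ => ?_
    exact (differentiable_pi.1 (differentiable_map_affineVec A) i).mul_const _
  have hR : Differentiable ℝ fun z => (nsq (A (affineVec z)) : ℂ) :=
    Complex.ofRealCLM.differentiable.comp (differentiable_nsq_map_affineVec A)
  have hdiff : DifferentiableAt ℝ (fun z => herm (A (affineVec z)) (A (Pi.single k.succ 1)) /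
      (nsq (A (affineVec z)) : ℂ)) z := by
    simp only [div_eq_mul_inv]
    exact (hN z).mul ((hR z).inv hr')
  have hd : ∀ h : Fin n → ℂ, fderiv ℝ (fun z => herm (A (affineVec z)) (A (Pi.single k.succ 1)) /
      (nsq (A (affineVec z)) : ℂ)) z h =
      (herm (A (Fin.cons 0 h)) (A (Pi.single k.succ 1)) * nsq (A (affineVec z)) -
        herm (A (affineVec z)) (A (Pi.single k.succ 1)) *
          ((2 * (herm (A (Fin.cons 0 h)) (A (affineVec z))).re : ℝ) : ℂ)) /
        (nsq (A (affineVec z)) : ℂ) ^ 2 := by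
    intro h
    refine fderiv_eq_of_hasDerivAt hdiff ?_
    have h1 : HasDerivAt (fun t : ℝ => herm (A (affineVec (z + t • h))) (A (Pi.single k.succ 1)))
        (herm (A (Fin.cons 0 h)) (A (Pi.single k.succ 1))) 0 := by
      have e : ∀ t : ℝ, herm (A (affineVec (z + t • h))) (A (Pi.single k.succ 1)) =
          herm (A (affineVec z)) (A (Pi.single k.succ 1)) +
            (t : ℂ) * herm (A (Fin.cons 0 h)) (A (Pi.single k.succ 1)) := by
        intro t
        rw [map_affineVec_add_smul, herm_add_left, ← herm_smul_left]
        congr 2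
      simp only [e]
      have := ((Complex.ofRealCLM.hasDerivAt (x := (0 : ℝ))).mul_const
        (herm (A (Fin.cons 0 h)) (A (Pi.single k.succ 1)))).const_add
          (herm (A (affineVec z)) (A (Pi.single k.succ 1)))
      simpa using this
    have h2 := (hasDerivAt_nsq_map_affineVec A z h).ofReal_comp
    have h3 := h1.div h2 (by simpa using hr')
    refine h3.congr_deriv ?_
    simp
  rw [dz, hd, hd, cons_single, cons_single, map_smul, map_smul, herm_smul_left, herm_smul_left,
    herm_smul_left, herm_smul_left, one_mul, one_mul]
  generalize herm (A (Pi.single j.succ 1)) (A (affineVec z)) = g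
  generalize herm (A (Pi.single j.succ 1)) (A (Pi.single k.succ 1)) = b
  generalize herm (A (affineVec z)) (A (Pi.single k.succ 1)) = e
  -- Combining the derivatives in the directions 1 and i extracts the complex-linear part:
  -- ∂|Av|²/∂z_j = ⟨Ae_j, Av⟩.
  have hg : g = ((2 * g.re : ℝ) - Complex.I * ((2 * (Complex.I * g).re : ℝ) : ℂ)) / 2 := by
    apply Complex.ext <;> simp
  generalize ((2 * (Complex.I * g).re : ℝ) : ℂ) = p at *
  generalize ((2 * g.re : ℝ) : ℂ) = q at *
  rw [hg]
  field_simp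
  linear_combination (-b * nsq (A (affineVec z))) * Complex.I_sq

/-- Up to the factor |Av|², the metric matrix is the Schur complement of the top left entry in the
Gram matrix of Av, Ae_1, …, Ae_n. That Gram determinant is |det A|², because v, e_1, …, e_n form a
unimodular matrix, and elimination writes it as |Av|² · |Av|^(2n) times the metric determinant. -/
theorem det_dz_dzbar_log_nsq (z : Fin n → ℂ) :
    (Matrix.of fun j k => dz j (dzbar k
        (fun z => ((Real.log (nsq (A (affineVec z))) : ℝ) : ℂ))) z).det =
      ((Complex.normSq (LinearMap.det (A : (Fin (n + 1) → ℂ) →ₗ[ℂ] (Fin (n + 1) → ℂ))) /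
        nsq (A (affineVec z)) ^ (n + 1) : ℝ) : ℂ) := by
  set v := affineVec z with hv
  have hr := nsq_map_affineVec_pos A z
  have hr' : (nsq (A v) : ℂ) ≠ 0 := by exact_mod_cast hr.ne'
  set M := LinearMap.toMatrix' (A : (Fin (n + 1) → ℂ) →ₗ[ℂ] (Fin (n + 1) → ℂ)) with hM
  let U : Matrix (Fin (n + 1)) (Fin (n + 1)) ℂ := Matrix.updateRow 1 0 v
  have hUdet : U.det = 1 := by
    rw [Matrix.det_of_isUpperTriangular]
    · rw [Fin.prod_univ_succ]
      simp [U, hv, affineVec, Matrix.updateRow_apply]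
    · intro i j hij
      have hi : i ≠ 0 := by rintro rfl; exact absurd hij (Fin.not_lt_zero _)
      have hne : i ≠ j := (ne_of_lt hij).symm
      simp [U, Matrix.updateRow_apply, hi, hne]
  let G : Matrix (Fin (n + 1)) (Fin (n + 1)) ℂ :=
    Matrix.of fun j k => herm (A (U j)) (A (U k))
  have hAM : ∀ (u : Fin (n + 1) → ℂ) i, A u i = ∑ l, u l * M i l := by
    intro u i
    have := LinearMap.toMatrix'_mulVec (A : (Fin (n + 1) → ℂ) →ₗ[ℂ] (Fin (n + 1) → ℂ)) u
    rw [← hM] at this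
    have h2 := congrFun this i
    rw [Matrix.mulVec, dotProduct] at h2
    exact (h2.symm).trans (Finset.sum_congr rfl fun l _ => mul_comm _ _)
  have hG : G = (U * M.transpose) * (U * M.transpose).conjTranspose := by
    ext j k
    simp [G, herm, hAM, Matrix.mul_apply, mul_comm]
  have hdetM : M.det = LinearMap.det (A : (Fin (n + 1) → ℂ) →ₗ[ℂ] (Fin (n + 1) → ℂ)) := by
    rw [hM, LinearMap.det_toMatrix']
  have hGdet : G.det = (Complex.normSq M.det : ℂ) := by
    rw [hG, Matrix.det_mul, Matrix.det_conjTranspose, Matrix.det_mul, hUdet, one_mul,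
      Matrix.det_transpose, ← Complex.mul_conj]
    rfl
  have hU0 : U 0 = v := by simp [U]
  have hUs : ∀ j : Fin n, U j.succ = Pi.single j.succ 1 := by
    intro j
    ext l
    simp [U, Matrix.updateRow_apply, Matrix.one_apply, Pi.single_apply, eq_comm]
  -- Subtracting c_j times row 0 from row j clears the first column below its top entry.
  let c : Fin (n + 1) → ℂ := Fin.cons 0 fun j =>
    herm (A (Pi.single j.succ 1)) (A v) / nsq (A v)
  let B : Matrix (Fin (n + 1)) (Fin (n + 1)) ℂ := Matrix.of fun j k => G j k - c j * G 0 k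
  have hB0 : ∀ k, B 0 k = G 0 k := fun k => by simp [B, c]
  have hGB : G.det = B.det := by
    refine Matrix.det_eq_of_forall_row_eq_smul_add_const c 0 (by simp [c]) fun j k => ?_
    rw [hB0]
    simp [B]
  have hG00 : G 0 0 = nsq (A v) := by simp only [G, Matrix.of_apply, hU0, herm_self]
  have hBs0 : ∀ j : Fin n, B j.succ 0 = 0 := by
    intro j
    have : G j.succ 0 = herm (A (Pi.single j.succ 1)) (A v) := by
      simp only [G, Matrix.of_apply, hU0, hUs]
    simp only [B, Matrix.of_apply, hG00, this, c, Fin.cons_succ]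
    field_simp
    ring
  have hBdet : B.det = nsq (A v) * (B.submatrix Fin.succ Fin.succ).det := by
    rw [Matrix.det_succ_column_zero, Fin.sum_univ_succ]
    simp only [hBs0, hB0, hG00]
    simp
  have hsub : B.submatrix Fin.succ Fin.succ = (nsq (A v) : ℂ) •
      (Matrix.of fun j k => dz j (dzbar k
        (fun z => ((Real.log (nsq (A (affineVec z))) : ℝ) : ℂ))) z) := by
    ext j k
    simp only [Matrix.submatrix_apply, B, G, Matrix.of_apply, hU0, hUs, c, Fin.cons_succ,
      Matrix.smul_apply, smul_eq_mul, dz_dzbar_log_nsq, ← hv]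
    field_simp
  rw [hsub, Matrix.det_smul, Fintype.card_fin, ← hGB, hGdet, hdetM] at hBdet
  push_cast
  rw [hBdet, pow_succ]
  field_simp

end FubiniStudy

/-! ### The Fubini–Study measure as an image of the Gaussian. -/

theorem gauss_singleton_zero (n : ℕ) : gauss (n + 1) {0} = 0 :=
  withDensity_absolutelyContinuous _ _ (measure_singleton 0)

theorem ae_gauss_ne_zero (n : ℕ) : ∀ᵐ u ∂(gauss (n + 1)), u ≠ 0 := by
  rw [ae_iff]
  simpa using gauss_singleton_zero n

theorem gauss_pos_of_isOpen {k : ℕ} {U : Set (Fin k → ℂ)} (hU : IsOpen U) (hne : U.Nonempty) :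
    0 < gauss k U := by
  rw [pos_iff_ne_zero, gauss]
  intro h
  rw [withDensity_apply_eq_zero] at h
  · have h1 : {v : Fin k → ℂ | ENNReal.ofReal (Real.exp (-nsq v) / Real.pi ^ k) ≠ 0} ∩ U = U := by
      refine Set.inter_eq_right.2 fun v _ => ?_
      have : 0 < Real.exp (-nsq v) / Real.pi ^ k := by positivity
      simpa using this
    rw [h1] at h
    exact (hU.measure_pos volume hne).ne' h
  · exact (ENNReal.continuous_ofReal.comp
      ((Real.continuous_exp.comp continuous_nsq.neg).div_const _)).measurable

section Projection

variable {n : ℕ} (Φ : Fin (n + 1) → H0 n 1) (A : (Fin (n + 1) → ℂ) ≃ₗ[ℂ] (Fin (n + 1) → ℂ))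

theorem measurable_linearEquiv (L : (Fin (n + 1) → ℂ) ≃ₗ[ℂ] (Fin (n + 1) → ℂ)) : Measurable L :=
  (LinearMap.continuous_of_finiteDimensional
    (L : (Fin (n + 1) → ℂ) →ₗ[ℂ] (Fin (n + 1) → ℂ))).measurable

theorem det_fsMatrix (hA : ∀ v i, H0val (Φ i) v = A v i) (z : Fin n → ℂ) :
    (fsMatrix Φ z).det.re =
      Complex.normSq (LinearMap.det (A : (Fin (n + 1) → ℂ) →ₗ[ℂ] (Fin (n + 1) → ℂ))) /
        nsq (A (affineVec z)) ^ (n + 1) := by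
  have : fsPotential Φ = fun z => ((Real.log (nsq (A (affineVec z))) : ℝ) : ℂ) := by
    funext z
    simp only [fsPotential, hA, nsq]
  rw [fsMatrix, this, det_dz_dzbar_log_nsq, Complex.ofReal_re]

theorem measurable_fsDensity (C : ℝ) (j : ℕ) :
    Measurable fun z : Fin n → ℂ => ENNReal.ofReal (C / nsq (A (affineVec z)) ^ j) :=
  (measurable_const.div ((continuous_nsq.measurable.comp ((measurable_linearEquiv A).comp
    continuous_affineVec.measurable)).pow_const _)).ennreal_ofReal

/-- The Fubini–Study measure is the image of a Gaussian measure. -/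
theorem fubiniStudy_eq_map (hA : ∀ v i, H0val (Φ i) v = A v i) :
    fubiniStudy Φ = (gauss (n + 1)).map fun u => projMap (A.symm u) := by
  have hpm : Measurable fun u => projMap (A.symm u) :=
    measurable_projMap.comp (measurable_linearEquiv A.symm)
  set c := Complex.normSq (LinearMap.det (A : (Fin (n + 1) → ℂ) →ₗ[ℂ] (Fin (n + 1) → ℂ))) with hc
  have hcpos : 0 < c := Complex.normSq_pos.2 (LinearEquiv.isUnit_det' A).ne_zero
  -- Integrating along the lines c(1, z) leaves a multiple of |A(1,z)|^(-2(n+1)), the same density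
  -- as the metric determinant up to a constant. The constant never has to be evaluated, since the
  -- Gaussian has mass 1 and Ω is normalized.
  obtain ⟨K, hK⟩ : ∃ K : ENNReal,
      (gauss (n + 1)).map (fun u => projMap (A.symm u)) = K • fsVolume Φ := by
    refine ⟨ENNReal.ofReal (Real.pi ^ (n + 1))⁻¹ * (ENNReal.ofReal (Complex.normSq (LinearMap.det
      (A.symm : (Fin (n + 1) → ℂ) →ₗ[ℂ] (Fin (n + 1) → ℂ))))⁻¹ *
        ENNReal.ofReal (Real.pi * n ! / c)), Measure.ext_of_lintegral _ fun f hf => ?_⟩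
    have hAm := measurable_linearEquiv A
    have hm : Measurable fun v : Fin (n + 1) → ℂ =>
        f (projMap v) * ENNReal.ofReal (Real.exp (-nsq (A v))) :=
      (hf.comp measurable_projMap).mul (ENNReal.measurable_ofReal.comp
        (Real.measurable_exp.comp (continuous_nsq.measurable.comp hAm).neg))
    have h1 := lintegral_homogeneous_mul_exp 0 (fun v => f (projMap v))
      (hf.comp measurable_projMap) (fun c v hc => by rw [projMap_smul hc])
      (fun v => nsq (A v)) (continuous_nsq.measurable.comp hAm)
      (fun c v => by rw [map_smul, nsq_smul]) (nsq_map_affineVec_pos A)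
    simp only [mul_zero, pow_zero, one_mul, add_zero, projMap_affineVec] at h1
    have h2 : ∫⁻ u, f (projMap (A.symm u)) * ENNReal.ofReal (Real.exp (-nsq u)) =
        ∫⁻ v, f (projMap v) * ENNReal.ofReal (Real.exp (-nsq (A v)))
          ∂(Measure.map A.symm volume) := by
      rw [lintegral_map hm (measurable_linearEquiv A.symm)]
      exact lintegral_congr fun u => by rw [A.apply_symm_apply]
    have h3 : ∫⁻ x, f x ∂(fsVolume Φ) = ∫⁻ z, ENNReal.ofReal (c / nsq (A (affineVec z)) ^ (n + 1)) *
        f (affineChart z) := by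
      have hch := measurableEmbedding_affineChart (n := n)
      rw [fsVolume, lintegral_map hf hch.measurable]
      simp only [det_fsMatrix Φ A hA]
      exact lintegral_withDensity_eq_lintegral_mul _ (measurable_fsDensity A c (n + 1))
        (hf.comp hch.measurable)
    rw [lintegral_map hf hpm, lintegral_gauss (fun u => f (projMap (A.symm u))) (hf.comp hpm), h2, map_linearEquiv_volume,
      lintegral_smul_measure, lintegral_smul_measure, h1, h3, smul_eq_mul, smul_eq_mul, mul_assoc,
      mul_assoc, ← lintegral_const_mul (ENNReal.ofReal (Real.pi * n ! / c))]
    · congr 2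
      refine lintegral_congr fun z => ?_
      have := nsq_map_affineVec_pos A z
      rw [← mul_assoc, ← ENNReal.ofReal_mul (by positivity), mul_comm]
      congr 2
      field_simp
    · exact (measurable_fsDensity A _ _).mul (hf.comp measurableEmbedding_affineChart.measurable)
  have h1 : K * fsVolume Φ Set.univ = 1 := by
    have h := congrArg (fun μ : Measure (CPn n) => μ Set.univ) hK
    simp only [Measure.smul_apply, smul_eq_mul] at h
    rw [← h, Measure.map_apply hpm MeasurableSet.univ]
    simp
  rw [hK, ENNReal.eq_inv_of_mul_eq_one_left h1]
  rfl

theorem isProbabilityMeasure_fubiniStudy (hA : ∀ v i, H0val (Φ i) v = A v i) :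
    IsProbabilityMeasure (fubiniStudy Φ) := by
  rw [fubiniStudy_eq_map Φ A hA]
  exact Measure.isProbabilityMeasure_map
    (measurable_projMap.comp (measurable_linearEquiv A.symm)).aemeasurable

/-- As Ω is carried by the chart, measurability on P^n and on P^n × P^n can be checked in
coordinates. -/
theorem exists_fubiniStudy_eq_map_affineChart (hA : ∀ v i, H0val (Φ i) v = A v i) :
    ∃ ν : Measure (Fin n → ℂ), IsFiniteMeasure ν ∧ fubiniStudy Φ = ν.map affineChart := by
  have hch := measurableEmbedding_affineChart (n := n)
  have := isProbabilityMeasure_fubiniStudy Φ A hA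
  have e : fubiniStudy Φ = ((fsVolume Φ Set.univ)⁻¹ • (volume : Measure (Fin n → ℂ)).withDensity
      fun z => ENNReal.ofReal (fsMatrix Φ z).det.re).map affineChart := by
    rw [Measure.map_smul]; rfl
  refine ⟨_, ⟨?_⟩, e⟩
  have h : fubiniStudy Φ Set.univ < ⊤ := measure_lt_top _ _
  rwa [e, Measure.map_apply hch.measurable MeasurableSet.univ, Set.preimage_univ] at h

theorem aestronglyMeasurable_fubiniStudy (hA : ∀ v i, H0val (Φ i) v = A v i) {F : CPn n → ℂ}
    (hF : Measurable fun z => F (affineChart z)) : AEStronglyMeasurable F (fubiniStudy Φ) := by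
  obtain ⟨ν, -, hν⟩ := exists_fubiniStudy_eq_map_affineChart Φ A hA
  rw [hν, measurableEmbedding_affineChart.aestronglyMeasurable_map_iff]
  exact hF.aestronglyMeasurable

theorem aestronglyMeasurable_fubiniStudy_prod (hA : ∀ v i, H0val (Φ i) v = A v i)
    {F : CPn n × CPn n → ℂ}
    (hF : Measurable fun q : (Fin n → ℂ) × (Fin n → ℂ) => F (affineChart q.1, affineChart q.2)) :
    AEStronglyMeasurable F ((fubiniStudy Φ).prod (fubiniStudy Φ)) := by
  obtain ⟨ν, hfin, hν⟩ := exists_fubiniStudy_eq_map_affineChart Φ A hA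
  have hch := measurableEmbedding_affineChart (n := n)
  rw [hν, Measure.map_prod_map _ _ hch.measurable hch.measurable,
    (hch.prodMap hch).aestronglyMeasurable_map_iff]
  exact hF.aestronglyMeasurable

end Projection

/-! ### Transfer of the forms from projective space to Gaussian integrals. -/

section Transfer

variable {n d : ℕ} (a : (Fin (n + 1) → ℕ) → (Fin (n + 1) → ℕ) → ℂ)

theorem innerFun_smul (m : ℕ) {S₁ S₂ : (Fin (n + 1) → ℂ) → ℂ} (h₁ : IsHomogHol (m + d) S₁)
    (h₂ : IsHomogHol (m + d) S₂) {c : ℂ} (hc : c ≠ 0) (x : Fin (n + 1) → ℂ) :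
    innerFun a d m S₁ S₂ (c • x) = innerFun a d m S₁ S₂ x := by
  have hcc : conj c ≠ 0 := by simpa using hc
  rw [innerFun, innerFun, h₁.smul' hc, h₂.smul' hc, rpk_smul_left, rpk_smul_right, map_mul,
    map_pow, mul_mul_mul_comm, ← mul_assoc (c ^ (m + d)),
    mul_div_mul_left _ _ (mul_ne_zero (pow_ne_zero _ hc) (pow_ne_zero _ hcc))]

theorem kernelFun_smul (m : ℕ) {S₁ S₂ : (Fin (n + 1) → ℂ) → ℂ} (h₁ : IsHomogHol (m + d) S₁)
    (h₂ : IsHomogHol (m + d) S₂) {c e : ℂ} (hc : c ≠ 0) (he : e ≠ 0) (x y : Fin (n + 1) → ℂ) :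
    kernelFun a d m S₁ S₂ (c • x) (e • y) = kernelFun a d m S₁ S₂ x y := by
  have hcc : conj c ≠ 0 := by simpa using hc
  rw [kernelFun_eq, kernelFun_eq, opIntegrand_smul_right a m h₁ he, opIntegrand_smul_left,
    h₂.smul' hc, rpk_smul_left, rpk_smul_right, map_mul, map_pow]
  have h1 : c ^ (m + d) ≠ 0 := pow_ne_zero _ hc
  have h2 : conj c ^ (m + d) ≠ 0 := pow_ne_zero _ hcc
  rw [mul_left_comm (c ^ (m + d)) (conj c ^ (m + d)), mul_div_mul_left _ _ h2, ← mul_assoc]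
  congr 1
  by_cases hx : rpk d a m x x = 0
  · simp [hx]
  · field_simp

variable {Φ : Fin (n + 1) → H0 n 1} {A : (Fin (n + 1) → ℂ) ≃ₗ[ℂ] (Fin (n + 1) → ℂ)}

theorem rpPol_eq (hA : ∀ v i, H0val (Φ i) v = A v i) (m : ℕ) (v w : Fin (n + 1) → ℂ) :
    rpPol d Φ a m v w = rpk d a m (A v) (A w) := by
  simp only [rpPol, rpk, rPol, herm, pPol, biPol, monomialVal, monom, hA]

/-- The chosen representative is a nonzero multiple of v, and the integrand has degree 0. -/
theorem innerIntegrand_projMap (hA : ∀ v i, H0val (Φ i) v = A v i) (m : ℕ) (s₁ s₂ : H0 n (m + d))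
    {v : Fin (n + 1) → ℂ} (hv : v ≠ 0) :
    innerIntegrand Φ a m s₁ s₂ (projMap v) = innerFun a d m (fun u => H0val s₁ (A.symm u))
      (fun u => H0val s₂ (A.symm u)) (A v) := by
  obtain ⟨c, hc, h⟩ := exists_rep_projMap hv
  rw [← innerFun_smul a m (isHomogHol_H0val s₁ A.symm) (isHomogHol_H0val s₂ A.symm) hc,
    ← map_smul, ← h, innerIntegrand, innerFun, rpPol_eq a hA]
  simp only [LinearEquiv.symm_apply_apply]

theorem kernelIntegrand_projMap (hA : ∀ v i, H0val (Φ i) v = A v i) (m : ℕ)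
    (s₁ s₂ : H0 n (m + d)) {v w : Fin (n + 1) → ℂ} (hv : v ≠ 0) (hw : w ≠ 0) :
    kernelIntegrand Φ a m s₁ s₂ (projMap v) (projMap w) =
      kernelFun a d m (fun u => H0val s₁ (A.symm u))
        (fun u => H0val s₂ (A.symm u)) (A v) (A w) := by
  obtain ⟨c, hc, h⟩ := exists_rep_projMap hv
  obtain ⟨e, he, h'⟩ := exists_rep_projMap hw
  rw [← kernelFun_smul a m (isHomogHol_H0val s₁ A.symm) (isHomogHol_H0val s₂ A.symm) hc he,
    ← map_smul, ← map_smul, ← h, ← h', kernelIntegrand, kernelFun, rpPol_eq a hA, rpPol_eq a hA,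
    rpPol_eq a hA]
  simp only [LinearEquiv.symm_apply_apply]

theorem aestronglyMeasurable_innerIntegrand (hA : ∀ v i, H0val (Φ i) v = A v i) (m : ℕ)
    (s₁ s₂ : H0 n (m + d)) :
    AEStronglyMeasurable (innerIntegrand Φ a m s₁ s₂) (fubiniStudy Φ) := by
  refine aestronglyMeasurable_fubiniStudy Φ A hA ?_
  simp only [← projMap_affineVec, innerIntegrand_projMap a hA m s₁ s₂ (affineVec_ne_zero _)]
  exact (measurable_innerFun a m (isHomogHol_H0val s₁ A.symm).measurable
    (isHomogHol_H0val s₂ A.symm).measurable).comp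
      ((measurable_linearEquiv A).comp continuous_affineVec.measurable)

theorem aestronglyMeasurable_kernelIntegrand (hA : ∀ v i, H0val (Φ i) v = A v i) (m : ℕ)
    (s₁ s₂ : H0 n (m + d)) :
    AEStronglyMeasurable (fun q : CPn n × CPn n => kernelIntegrand Φ a m s₁ s₂ q.1 q.2)
      ((fubiniStudy Φ).prod (fubiniStudy Φ)) := by
  have key : ∀ z w : Fin n → ℂ, kernelIntegrand Φ a m s₁ s₂ (affineChart z) (affineChart w) =
      kernelFun a d m (fun u => H0val s₁ (A.symm u)) (fun u => H0val s₂ (A.symm u))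
        (A (affineVec z)) (A (affineVec w)) := fun z w => by
    rw [← projMap_affineVec, ← projMap_affineVec,
      kernelIntegrand_projMap a hA m s₁ s₂ (affineVec_ne_zero z) (affineVec_ne_zero w)]
  refine aestronglyMeasurable_fubiniStudy_prod Φ A hA ?_
  simp only [key]
  have h : Measurable fun z : Fin n → ℂ => A (affineVec z) :=
    (measurable_linearEquiv A).comp continuous_affineVec.measurable
  have hk := measurable_kernelFun (d := d) a m (isHomogHol_H0val s₁ A.symm).measurable
    (isHomogHol_H0val s₂ A.symm).measurable
  have hp : Measurable fun q : (Fin n → ℂ) × (Fin n → ℂ) =>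
      (A (affineVec q.1), A (affineVec q.2)) :=
    (h.comp measurable_fst).prodMk (h.comp measurable_snd)
  simpa only [Function.comp_def] using hk.comp hp

theorem ae_innerIntegrand_eq (hA : ∀ v i, H0val (Φ i) v = A v i) (m : ℕ) (s₁ s₂ : H0 n (m + d)) :
    (fun u => innerIntegrand Φ a m s₁ s₂ (projMap (A.symm u))) =ᵐ[gauss (n + 1)]
      innerFun a d m (fun u => H0val s₁ (A.symm u)) (fun u => H0val s₂ (A.symm u)) := by
  filter_upwards [ae_gauss_ne_zero n] with u hu
  rw [innerIntegrand_projMap a hA m s₁ s₂ (by simpa using hu), LinearEquiv.apply_symm_apply]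

theorem ae_kernelIntegrand_eq (hA : ∀ v i, H0val (Φ i) v = A v i) (m : ℕ) (s₁ s₂ : H0 n (m + d)) :
    (fun q : (Fin (n + 1) → ℂ) × (Fin (n + 1) → ℂ) =>
        kernelIntegrand Φ a m s₁ s₂ (projMap (A.symm q.1)) (projMap (A.symm q.2)))
      =ᵐ[(gauss (n + 1)).prod (gauss (n + 1))]
      fun q => kernelFun a d m (fun u => H0val s₁ (A.symm u)) (fun u => H0val s₂ (A.symm u))
        q.1 q.2 := by
  have h1 := Measure.quasiMeasurePreserving_fst (μ := gauss (n + 1)) (ν := gauss (n + 1)) |>.ae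
    (ae_gauss_ne_zero n)
  have h2 := Measure.quasiMeasurePreserving_snd (μ := gauss (n + 1)) (ν := gauss (n + 1)) |>.ae
    (ae_gauss_ne_zero n)
  filter_upwards [h1, h2] with q hq1 hq2
  rw [kernelIntegrand_projMap a hA m s₁ s₂ (by simpa using hq1) (by simpa using hq2),
    LinearEquiv.apply_symm_apply, LinearEquiv.apply_symm_apply]

theorem integrable_innerIntegrand (hA : ∀ v i, H0val (Φ i) v = A v i)
    (hpos : ∀ v : Fin (n + 1) → ℂ, v ≠ 0 → 0 < biPol d a v v) (m : ℕ) (s₁ s₂ : H0 n (m + d)) :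
    Integrable (innerIntegrand Φ a m s₁ s₂) (fubiniStudy Φ) := by
  have hpm : Measurable fun u => (projMap (A.symm u) : CPn n) :=
    measurable_projMap.comp (measurable_linearEquiv A.symm)
  have hm := aestronglyMeasurable_innerIntegrand a hA m s₁ s₂
  rw [fubiniStudy_eq_map Φ A hA] at hm ⊢
  rw [integrable_map_measure hm hpm.aemeasurable]
  exact (integrable_innerFun a hpos m (isHomogHol_H0val s₁ A.symm)
    (isHomogHol_H0val s₂ A.symm)).congr (ae_innerIntegrand_eq a hA m s₁ s₂).symm

theorem sectionInner_eq (hA : ∀ v i, H0val (Φ i) v = A v i) (m : ℕ) (s₁ s₂ : H0 n (m + d)) :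
    sectionInner Φ a m s₁ s₂ = ∫ u, innerFun a d m (fun u => H0val s₁ (A.symm u))
      (fun u => H0val s₂ (A.symm u)) u ∂(gauss (n + 1)) := by
  have hpm : Measurable fun u => (projMap (A.symm u) : CPn n) :=
    measurable_projMap.comp (measurable_linearEquiv A.symm)
  have hm := aestronglyMeasurable_innerIntegrand a hA m s₁ s₂
  rw [sectionInner]
  rw [fubiniStudy_eq_map Φ A hA] at hm ⊢
  rw [integral_map hpm.aemeasurable hm]
  exact integral_congr_ae (ae_innerIntegrand_eq a hA m s₁ s₂)

theorem fubiniStudy_prod_eq_map (hA : ∀ v i, H0val (Φ i) v = A v i) :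
    (fubiniStudy Φ).prod (fubiniStudy Φ) = ((gauss (n + 1)).prod (gauss (n + 1))).map
      (Prod.map (fun u => projMap (A.symm u)) fun u => projMap (A.symm u)) := by
  have hpm : Measurable fun u => (projMap (A.symm u) : CPn n) :=
    measurable_projMap.comp (measurable_linearEquiv A.symm)
  rw [fubiniStudy_eq_map Φ A hA, Measure.map_prod_map _ _ hpm hpm]

theorem integrable_kernelIntegrand (hA : ∀ v i, H0val (Φ i) v = A v i)
    (hpos : ∀ v : Fin (n + 1) → ℂ, v ≠ 0 → 0 < biPol d a v v) (m : ℕ) (s₁ s₂ : H0 n (m + d)) :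
    Integrable (fun q : CPn n × CPn n => kernelIntegrand Φ a m s₁ s₂ q.1 q.2)
      ((fubiniStudy Φ).prod (fubiniStudy Φ)) := by
  have hpm : Measurable fun u => (projMap (A.symm u) : CPn n) :=
    measurable_projMap.comp (measurable_linearEquiv A.symm)
  have hm := aestronglyMeasurable_kernelIntegrand a hA m s₁ s₂
  rw [fubiniStudy_prod_eq_map hA] at hm ⊢
  rw [integrable_map_measure hm (hpm.prodMap hpm).aemeasurable]
  exact (integrable_kernelFun a hpos m (isHomogHol_H0val s₁ A.symm)
    (isHomogHol_H0val s₂ A.symm)).congr (ae_kernelIntegrand_eq a hA m s₁ s₂).symm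

/-- Integrability on the product permits Fubini, so the iterated integral can be pulled back along
the product of the two projections. -/
theorem kernelForm_eq (hA : ∀ v i, H0val (Φ i) v = A v i)
    (hpos : ∀ v : Fin (n + 1) → ℂ, v ≠ 0 → 0 < biPol d a v v) (m : ℕ) (s₁ s₂ : H0 n (m + d)) :
    kernelForm Φ a m s₁ s₂ = ∫ q, kernelFun a d m (fun u => H0val s₁ (A.symm u))
      (fun u => H0val s₂ (A.symm u)) q.1 q.2 ∂((gauss (n + 1)).prod (gauss (n + 1))) := by
  have hpm : Measurable fun u => (projMap (A.symm u) : CPn n) :=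
    measurable_projMap.comp (measurable_linearEquiv A.symm)
  have hm := aestronglyMeasurable_kernelIntegrand a hA m s₁ s₂
  have := isProbabilityMeasure_fubiniStudy Φ A hA
  rw [kernelForm, ← integral_prod (fun q : CPn n × CPn n => kernelIntegrand Φ a m s₁ s₂ q.1 q.2)
    (integrable_kernelIntegrand a hA hpos m s₁ s₂)]
  rw [fubiniStudy_prod_eq_map hA] at hm ⊢
  rw [integral_map (hpm.prodMap hpm).aemeasurable hm]
  exact integral_congr_ae (ae_kernelIntegrand_eq a hA m s₁ s₂)

end Transfer

/-! ### Positivity and Hermitian symmetry of P. -/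

/-- An element of a fibre of `O(d)` with value `1` at a given vector. -/
theorem exists_OFibre_eq_one {n : ℕ} (d : ℕ) {v : Fin (n + 1) → ℂ} (hv : v ≠ 0) :
    ∃ s : OFibre d (Projectivization.mk ℂ v hv), s.1 ⟨v, CPn.mem_submodule_mk v hv⟩ = 1 := by
  obtain ⟨j, hj⟩ := Function.ne_iff.1 hv
  have hj' : v j ≠ 0 := hj
  refine ⟨⟨fun w => (w.1 j / v j) ^ d, fun c w => ?_⟩, ?_⟩
  · simp only [Submodule.coe_smul, Pi.smul_apply, smul_eq_mul, mul_div_assoc, mul_pow]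
  · simp [hj']

/-- The fibre element with value 1 at v has squared norm 1/P(v,v̄). -/
theorem HermitianMetric.IsGlobalizedBy.pPol_pos {n d : ℕ} {p : HermitianMetric n d}
    {Φ : Fin (n + 1) → H0 n 1} {a : (Fin (n + 1) → ℕ) → (Fin (n + 1) → ℕ) → ℂ}
    (hp : p.IsGlobalizedBy Φ a) {v : Fin (n + 1) → ℂ} (hv : v ≠ 0) : 0 < pPol d Φ a v v := by
  obtain ⟨s, hs⟩ := exists_OFibre_eq_one d hv
  have hs0 : s ≠ 0 := by
    rintro rfl
    exact zero_ne_one hs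
  have h := p.pos _ s hs0
  rw [hp v hv s, hs] at h
  simpa using h

theorem HermitianMetric.IsGlobalizedBy.biPol_pos {n d : ℕ} {p : HermitianMetric n d}
    {Φ : Fin (n + 1) → H0 n 1} {a : (Fin (n + 1) → ℕ) → (Fin (n + 1) → ℕ) → ℂ}
    (hp : p.IsGlobalizedBy Φ a) {A : (Fin (n + 1) → ℂ) ≃ₗ[ℂ] (Fin (n + 1) → ℂ)}
    (hA : ∀ v i, H0val (Φ i) v = A v i) (u : Fin (n + 1) → ℂ) (hu : u ≠ 0) :
    0 < biPol d a u u := by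
  have h := hp.pPol_pos (v := A.symm u) (by simpa using hu)
  simpa only [biPol, monom, pPol, monomialVal, hA, LinearEquiv.apply_symm_apply] using h

/-- Polarization: with u = x + iy, the hypothesis says that a polynomial in (x, y) vanishes at all
real points, so it is the zero polynomial. Evaluating it at complex (x, y) makes v and w̄
independent variables. -/
theorem sum_monom_conj_eq_zero {n : ℕ} (d : ℕ)
    (b : (Fin (n + 1) → ℕ) → (Fin (n + 1) → ℕ) → ℂ) (h : ∀ u, biPol d b u u = 0)
    (v w : Fin (n + 1) → ℂ) : biPol d b v w = 0 := by
  let X : Fin (n + 1) → MvPolynomial (Fin (n + 1) ⊕ Fin (n + 1)) ℂ :=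
    fun i => MvPolynomial.X (Sum.inl i) + MvPolynomial.C Complex.I * MvPolynomial.X (Sum.inr i)
  let Y : Fin (n + 1) → MvPolynomial (Fin (n + 1) ⊕ Fin (n + 1)) ℂ :=
    fun i => MvPolynomial.X (Sum.inl i) - MvPolynomial.C Complex.I * MvPolynomial.X (Sum.inr i)
  let P : MvPolynomial (Fin (n + 1) ⊕ Fin (n + 1)) ℂ := ∑ α ∈ multiIndices n d,
    ∑ β ∈ multiIndices n d, MvPolynomial.C (b α β) * (∏ i, X i ^ α i) * ∏ i, Y i ^ β i
  have hev : ∀ v w x, (∀ i, x (Sum.inl i) + Complex.I * x (Sum.inr i) = v i) →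
      (∀ i, x (Sum.inl i) - Complex.I * x (Sum.inr i) = conj (w i)) →
      MvPolynomial.eval x P = biPol d b v w := by
    intro v w x hv hw
    simp [P, X, Y, biPol, monom, hv, hw]
  have hP : P = 0 := by
    refine MvPolynomial.funext_set (fun _ => Set.range Complex.ofReal)
      (fun _ => Set.infinite_range_of_injective Complex.ofReal_injective) fun x hx => ?_
    have hx' : ∀ i, conj (x i) = x i := by
      intro i
      obtain ⟨r, hr⟩ := hx i (Set.mem_univ i)
      rw [← hr, Complex.conj_ofReal]
    rw [hev (fun i => x (Sum.inl i) + Complex.I * x (Sum.inr i))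
      (fun i => x (Sum.inl i) + Complex.I * x (Sum.inr i)) x (fun i => rfl) fun i => ?_, h, map_zero]
    rw [map_add, map_mul, hx', hx', Complex.conj_I]
    ring
  -- The solution of x + iy = v and x − iy = w̄.
  have := hev v w (Sum.elim (fun i => (v i + conj (w i)) / 2)
    fun i => -Complex.I * (v i - conj (w i)) / 2)
    (fun i => by
      simp only [Sum.elim_inl, Sum.elim_inr]
      linear_combination (-(v i - conj (w i)) / 2) * Complex.I_sq)
    (fun i => by
      simp only [Sum.elim_inl, Sum.elim_inr]
      linear_combination ((v i - conj (w i)) / 2) * Complex.I_sq)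
  rw [← this, hP, map_zero]

/-- Positivity makes the diagonal real, so the form with coefficients a_{αβ} − conj(a_{βα}) vanishes
on the diagonal, and polarization makes it vanish everywhere. The coefficients are not assumed
Hermitian. -/
theorem conj_biPol {n d : ℕ} {a : (Fin (n + 1) → ℕ) → (Fin (n + 1) → ℕ) → ℂ}
    (hpos : ∀ v : Fin (n + 1) → ℂ, v ≠ 0 → 0 < biPol d a v v) (v w : Fin (n + 1) → ℂ) :
    conj (biPol d a v w) = biPol d a w v := by
  have hsub : ∀ v w, biPol d (fun α β => a α β - conj (a β α)) v w =
      biPol d a v w - conj (biPol d a w v) := by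
    intro v w
    simp only [biPol, map_sum, map_mul, Complex.conj_conj]
    rw [Finset.sum_comm (f := fun α β => conj (a α β) * conj (monom α w) * monom β v),
      ← Finset.sum_sub_distrib]
    refine Finset.sum_congr rfl fun α _ => ?_
    rw [← Finset.sum_sub_distrib]
    exact Finset.sum_congr rfl fun β _ => by ring
  have hreal : ∀ u, u ≠ 0 → conj (biPol d a u u) = biPol d a u u := by
    intro u hu
    exact Complex.conj_eq_iff_im.2 (Complex.pos_iff.1 (hpos u hu)).2.symm
  have hzero : ∀ u, biPol d (fun α β => a α β - conj (a β α)) u u = 0 := by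
    intro u
    by_cases hu : u = 0
    · have h1 : (Pi.single 0 1 : Fin (n + 1) → ℂ) ≠ 0 := by simp
      -- Positivity says nothing at u = 0: for d = 0 the form is constant, and for d > 0 it vanishes
      -- there.
      by_cases hd : d = 0
      · have e : ∀ x : Fin (n + 1) → ℂ, biPol d (fun α β => a α β - conj (a β α)) (0 • x) (0 • x) =
            biPol d (fun α β => a α β - conj (a β α)) x x := by
          intro x
          subst hd
          have h0 : ∀ α ∈ multiIndices n 0, ∀ x y : Fin (n + 1) → ℂ, monom α x = monom α y := by
            intro α hα x y
            have : ∀ i, α i = 0 := fun i =>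
              (Finset.sum_eq_zero_iff.1 (sum_of_mem_multiIndices hα)) i (Finset.mem_univ i)
            simp [monom, this]
          unfold biPol
          refine Finset.sum_congr rfl fun α hα => Finset.sum_congr rfl fun β hβ => ?_
          rw [h0 α hα _ x, h0 β hβ _ x]
        have h2 := e (Pi.single 0 1)
        rw [zero_smul, ← hu] at h2
        rw [h2, hsub, hreal _ h1, sub_self]
      · have h2 := biPol_smul_left (d := d) (fun α β => a α β - conj (a β α)) 0 u u
        rw [zero_smul, zero_pow hd, zero_mul] at h2
        rw [hu] at h2 ⊢
        exact h2
    · rw [hsub, hreal u hu, sub_self]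
  have h := sum_monom_conj_eq_zero d _ hzero w v
  rw [hsub, sub_eq_zero] at h
  exact h.symm

/-! ### Positivity of the weighted norm and the kernel estimate. -/

section forms

variable {n d : ℕ} {a : (Fin (n + 1) → ℕ) → (Fin (n + 1) → ℕ) → ℂ}

theorem conj_rpk (hpos : ∀ v : Fin (n + 1) → ℂ, v ≠ 0 → 0 < biPol d a v v) (m : ℕ)
    (x y : Fin (n + 1) → ℂ) : conj (rpk d a m x y) = rpk d a m y x := by
  rw [rpk, rpk, map_mul, map_pow, conj_herm, conj_biPol hpos]

theorem conj_innerFun (hpos : ∀ v : Fin (n + 1) → ℂ, v ≠ 0 → 0 < biPol d a v v) (m : ℕ)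
    (S₁ S₂ : (Fin (n + 1) → ℂ) → ℂ) (x : Fin (n + 1) → ℂ) :
    conj (innerFun a d m S₁ S₂ x) = innerFun a d m S₂ S₁ x := by
  rw [innerFun, innerFun, map_div₀, map_mul, Complex.conj_conj, conj_rpk hpos, mul_comm]

theorem conj_kernelFun (hpos : ∀ v : Fin (n + 1) → ℂ, v ≠ 0 → 0 < biPol d a v v) (m : ℕ)
    (S₁ S₂ : (Fin (n + 1) → ℂ) → ℂ) (x y : Fin (n + 1) → ℂ) :
    conj (kernelFun a d m S₁ S₂ x y) = kernelFun a d m S₂ S₁ y x := by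
  simp only [kernelFun, map_div₀, map_mul, Complex.conj_conj, conj_rpk hpos]
  ring

theorem weightedNormSq_nonneg (m : ℕ) (S : (Fin (n + 1) → ℂ) → ℂ) :
    0 ≤ weightedNormSq a d m S :=
  integral_nonneg fun x => by positivity

/-- By continuity S is nonzero on a nonempty open set, which has positive Gaussian mass. -/
theorem weightedNormSq_pos (hpos : ∀ v : Fin (n + 1) → ℂ, v ≠ 0 → 0 < biPol d a v v) (m : ℕ)
    {S : (Fin (n + 1) → ℂ) → ℂ} (hS : IsHomogHol (m + d) S) {v : Fin (n + 1) → ℂ}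
    (hv : S v ≠ 0) : 0 < weightedNormSq a d m S := by
  rw [weightedNormSq, integral_pos_iff_support_of_nonneg (fun x => by positivity)
    (integrable_weightedNormSq a hpos m hS)]
  have hU : IsOpen {x : Fin (n + 1) → ℂ | x ∈ ({0}ᶜ : Set (Fin (n + 1) → ℂ)) ∧ S x ∈ ({0}ᶜ : Set ℂ)} :=
    hS.diff.continuousOn.isOpen_inter_preimage isOpen_compl_singleton isOpen_compl_singleton
  refine (gauss_pos_of_isOpen hU ⟨v, ?_, hv⟩).trans_le (measure_mono fun x hx => ?_)
  · rintro rfl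
    exact hv hS.zero
  · have h1 : rpk d a m x x ≠ 0 := (rpk_self_pos a hpos m hx.1).ne'
    have h2 : S x ≠ 0 := hx.2
    simp [h1, h2]

theorem exists_kernel_estimate (hpos : ∀ v : Fin (n + 1) → ℂ, v ≠ 0 → 0 < biPol d a v v) :
    ∃ D : ℝ, 0 ≤ D ∧ ∀ m : ℕ, 4 * d + 2 ≤ m → ∀ S : (Fin (n + 1) → ℂ) → ℂ,
      IsHomogHol (m + d) S →
      ‖∫ q, kernelFun a d m S S q.1 q.2 ∂((gauss (n + 1)).prod (gauss (n + 1))) -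
          ((n ! / (m : ℝ) ^ n * weightedNormSq a d m S : ℝ) : ℂ)‖ ≤
        D / (m : ℝ) ^ (n + 1) * weightedNormSq a d m S := by
  obtain ⟨C, hC, h⟩ := norm_integral_kernelFun_sub_le a hpos
  refine ⟨C * (n * n ! * 4 ^ (n + 1)) + n ^ 2 * n !, by positivity, fun m hm S hS => ?_⟩
  have hm0 : 0 < m := by omega
  have hm' : (0 : ℝ) < m := by exact_mod_cast hm0
  have hN := weightedNormSq_nonneg (a := a) (d := d) m S
  -- The largest j allowed in the remainder estimate; m ≥ 4d + 2 guarantees j + 1 ≥ m/4.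
  set j := (m - 2 * d - 2) / 2 with hj
  have h1 := h m j (by omega) S hS
  have h2 : betaMoment n j - betaMoment n (j + 1) ≤ n * n ! * 4 ^ (n + 1) / (m : ℝ) ^ (n + 1) := by
    refine (betaMoment_sub_le n j).trans ?_
    have h3 : (m : ℝ) / 4 ≤ (j : ℝ) + 1 := by
      have : m ≤ 4 * (j + 1) := by omega
      have : (m : ℝ) ≤ 4 * (j + 1) := by exact_mod_cast this
      linarith
    calc _ ≤ (n * n ! : ℝ) / ((m : ℝ) / 4) ^ (n + 1) := by gcongr
      _ = _ := by rw [div_pow]; field_simp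
  have h4 := abs_betaMoment_sub_le n hm0
  rw [integral_prod _ (integrable_kernelFun a hpos m hS hS)]
  calc _ = ‖(∫ x, ∫ y, kernelFun a d m S S x y ∂(gauss (n + 1)) ∂(gauss (n + 1)) -
          betaMoment n m * weightedNormSq a d m S) +
          (((betaMoment n m - n ! / (m : ℝ) ^ n) * weightedNormSq a d m S : ℝ) : ℂ)‖ := by
        congr 1
        push_cast
        ring
    _ ≤ C * (n * n ! * 4 ^ (n + 1) / (m : ℝ) ^ (n + 1)) * weightedNormSq a d m S +
          n ^ 2 * n ! / (m : ℝ) ^ (n + 1) * weightedNormSq a d m S := by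
        refine (norm_add_le _ _).trans (add_le_add (h1.trans ?_) ?_)
        · gcongr
        · rw [Complex.norm_real, norm_mul, Real.norm_of_nonneg hN, Real.norm_eq_abs]
          gcongr
    _ = _ := by ring

end forms

/-! ### The forms on H^0(P^n, O(m+d)). -/

section sections

variable {n d : ℕ} {a : (Fin (n + 1) → ℕ) → (Fin (n + 1) → ℕ) → ℂ} {Φ : Fin (n + 1) → H0 n 1}
  {A : (Fin (n + 1) → ℂ) ≃ₗ[ℂ] (Fin (n + 1) → ℂ)}

theorem sectionInner_self (hA : ∀ v i, H0val (Φ i) v = A v i)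
    (hpos : ∀ v : Fin (n + 1) → ℂ, v ≠ 0 → 0 < biPol d a v v) (m : ℕ) (s : H0 n (m + d)) :
    sectionInner Φ a m s s = (weightedNormSq a d m (fun u => H0val s (A.symm u)) : ℂ) := by
  rw [sectionInner_eq a hA, integral_innerFun_self a hpos m (isHomogHol_H0val s A.symm)]

theorem sectionNorm_sq (hA : ∀ v i, H0val (Φ i) v = A v i)
    (hpos : ∀ v : Fin (n + 1) → ℂ, v ≠ 0 → 0 < biPol d a v v) (m : ℕ) (s : H0 n (m + d)) :
    sectionNorm Φ a m s ^ 2 = weightedNormSq a d m (fun u => H0val s (A.symm u)) := by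
  rw [sectionNorm, sectionInner_self hA hpos, Complex.ofReal_re,
    Real.sq_sqrt (weightedNormSq_nonneg _ _)]

theorem weightedNormSq_section_pos (A : (Fin (n + 1) → ℂ) ≃ₗ[ℂ] (Fin (n + 1) → ℂ))
    (hpos : ∀ v : Fin (n + 1) → ℂ, v ≠ 0 → 0 < biPol d a v v) (m : ℕ) {s : H0 n (m + d)}
    (hs : s ≠ 0) : 0 < weightedNormSq a d m (fun u => H0val s (A.symm u)) := by
  obtain ⟨v, hv⟩ : ∃ v, H0val s v ≠ 0 := by
    by_contra! h
    exact hs (H0_eq_zero fun v _ => h v)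
  refine weightedNormSq_pos hpos m (isHomogHol_H0val s A.symm) (v := A v) ?_
  simpa using hv

theorem isPosDefForm_sectionInner (hA : ∀ v i, H0val (Φ i) v = A v i)
    (hpos : ∀ v : Fin (n + 1) → ℂ, v ≠ 0 → 0 < biPol d a v v) (m : ℕ) :
    IsPosDefForm (fun s₁ s₂ : H0 n (m + d) => sectionInner Φ a m s₁ s₂) where
  add_left s₁ s₂ t := by
    have hi := fun s : H0 n (m + d) => integrable_innerFun a hpos m
      (isHomogHol_H0val s A.symm) (isHomogHol_H0val t A.symm)
    simp only [sectionInner_eq a hA]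
    rw [← integral_add (hi s₁) (hi s₂)]
    refine integral_congr_ae (ae_of_all _ fun u => ?_)
    simp only [innerFun, H0val_add]
    ring
  smul_left c s t := by
    simp only [sectionInner_eq a hA]
    rw [← integral_const_mul]
    refine integral_congr_ae (ae_of_all _ fun u => ?_)
    simp only [innerFun, H0val_smul]
    ring
  conj_symm s t := by
    simp only [sectionInner_eq a hA]
    rw [← integral_conj]
    simp only [conj_innerFun hpos]
  pos s hs := by
    rw [sectionInner_self hA hpos]
    exact_mod_cast weightedNormSq_section_pos A hpos m hs

theorem conj_kernelForm (hA : ∀ v i, H0val (Φ i) v = A v i)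
    (hpos : ∀ v : Fin (n + 1) → ℂ, v ≠ 0 → 0 < biPol d a v v) (m : ℕ) (s t : H0 n (m + d)) :
    conj (kernelForm Φ a m s t) = kernelForm Φ a m t s := by
  rw [kernelForm_eq a hA hpos, kernelForm_eq a hA hpos, ← integral_conj, ← integral_prod_swap]
  simp only [conj_kernelFun hpos, Prod.fst_swap, Prod.snd_swap]

theorem kernelForm_self_eq_re (hA : ∀ v i, H0val (Φ i) v = A v i)
    (hpos : ∀ v : Fin (n + 1) → ℂ, v ≠ 0 → 0 < biPol d a v v) (m : ℕ) (s : H0 n (m + d)) :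
    kernelForm Φ a m s s = ((kernelForm Φ a m s s).re : ℂ) :=
  (Complex.conj_eq_iff_re.1 (conj_kernelForm hA hpos m s s)).symm

theorem isPosDefForm_kernelForm (hA : ∀ v i, H0val (Φ i) v = A v i)
    (hpos : ∀ v : Fin (n + 1) → ℂ, v ≠ 0 → 0 < biPol d a v v) (m : ℕ)
    (h : ∀ s : H0 n (m + d), s ≠ 0 → 0 < (kernelForm Φ a m s s).re) :
    IsPosDefForm (fun s₁ s₂ : H0 n (m + d) => kernelForm Φ a m s₁ s₂) where
  add_left s₁ s₂ t := by
    have hi := fun s : H0 n (m + d) => integrable_kernelFun a hpos m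
      (isHomogHol_H0val s A.symm) (isHomogHol_H0val t A.symm)
    simp only [kernelForm_eq a hA hpos]
    rw [← integral_add (hi s₁) (hi s₂)]
    refine integral_congr_ae (ae_of_all _ fun u => ?_)
    simp only [kernelFun, H0val_add]
    ring
  smul_left c s t := by
    simp only [kernelForm_eq a hA hpos]
    rw [← integral_const_mul]
    refine integral_congr_ae (ae_of_all _ fun u => ?_)
    simp only [kernelFun, H0val_smul]
    ring
  conj_symm s t := conj_kernelForm hA hpos m s t
  pos s hs := by
    rw [kernelForm_self_eq_re hA hpos]
    exact_mod_cast h s hs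

theorem exists_abs_kernelForm_sub_le (hA : ∀ v i, H0val (Φ i) v = A v i)
    (hpos : ∀ v : Fin (n + 1) → ℂ, v ≠ 0 → 0 < biPol d a v v) :
    ∃ D : ℝ, 0 ≤ D ∧ ∀ m : ℕ, 4 * d + 2 ≤ m → ∀ s : H0 n (m + d),
      |(kernelForm Φ a m s s).re - n ! / (m : ℝ) ^ n * sectionNorm Φ a m s ^ 2| ≤
        D / (m : ℝ) ^ (n + 1) * sectionNorm Φ a m s ^ 2 := by
  obtain ⟨D, hD, h⟩ := exists_kernel_estimate hpos
  refine ⟨D, hD, fun m hm s => ?_⟩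
  have h1 := h m hm _ (isHomogHol_H0val s A.symm)
  rw [← kernelForm_eq a hA hpos, ← sectionNorm_sq hA hpos, kernelForm_self_eq_re hA hpos,
    ← Complex.ofReal_sub, Complex.norm_real, Real.norm_eq_abs] at h1
  exact h1

end sections

/-! ### Conclusion. -/

theorem exists_eps_of_abs_sub_le {K N c δ : ℝ} (hN : 0 ≤ N) (hδ : 0 ≤ δ)
    (h : |K - c * N| ≤ δ * N) : ∃ ε : ℝ, |ε| ≤ δ ∧ K = (c + ε) * N := by
  -- If N = 0 the bound forces K = 0, so ε = 0 serves.
  rcases hN.eq_or_lt with h0 | h0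
  · refine ⟨0, by simpa using hδ, ?_⟩
    rw [← h0] at h ⊢
    simpa using h
  · refine ⟨(K - c * N) / N, ?_, by field_simp; ring⟩
    rw [abs_div, abs_of_pos h0]
    exact (div_le_iff₀ h0).2 h

theorem mainTheorem1 (n d : ℕ) (Φ : Module.Basis (Fin (n + 1)) ℂ (H0 n 1))
    (p : HermitianMetric n d) (a : (Fin (n + 1) → ℕ) → (Fin (n + 1) → ℕ) → ℂ)
    (hp : p.IsGlobalizedBy Φ a) :
    IsProbabilityMeasure (fubiniStudy Φ) ∧
    (∀ (m : ℕ) (s₁ s₂ : H0 n (m + d)),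
      Integrable (innerIntegrand Φ a m s₁ s₂) (fubiniStudy Φ) ∧
      Integrable (fun q : CPn n × CPn n => kernelIntegrand Φ a m s₁ s₂ q.1 q.2)
        ((fubiniStudy Φ).prod (fubiniStudy Φ))) ∧
    (∀ m : ℕ, IsPosDefForm (fun s₁ s₂ : H0 n (m + d) => sectionInner Φ a m s₁ s₂)) ∧
    (∃ C : ℝ, ∀ᶠ m : ℕ in atTop, ∀ s : H0 n (m + d), ∃ ε : ℝ,
      |ε| ≤ C * (Real.log m ^ (n + 2) / (m : ℝ) ^ (n + 1)) ∧
      kernelForm Φ a m s s =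
        (((n ! : ℝ) / (m : ℝ) ^ n + ε) * sectionNorm Φ a m s ^ 2 : ℝ)) ∧
    (∀ᶠ m : ℕ in atTop,
      IsPosDefForm (fun s₁ s₂ : H0 n (m + d) => kernelForm Φ a m s₁ s₂)) := by
  obtain ⟨A, hA⟩ := exists_linearEquiv_H0val Φ
  have hpos := hp.biPol_pos hA
  obtain ⟨D, hD, h⟩ := exists_abs_kernelForm_sub_le hA hpos
  refine ⟨isProbabilityMeasure_fubiniStudy Φ A hA, fun m s₁ s₂ =>
    ⟨integrable_innerIntegrand a hA hpos m s₁ s₂, integrable_kernelIntegrand a hA hpos m s₁ s₂⟩,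
    isPosDefForm_sectionInner hA hpos, ⟨D, ?_⟩, ?_⟩
  · filter_upwards [eventually_ge_atTop (4 * d + 3)] with m hm s
    have hm' : (3 : ℝ) ≤ m := by exact_mod_cast (show 3 ≤ m by omega)
    obtain ⟨ε, hε, hK⟩ := exists_eps_of_abs_sub_le (sq_nonneg _) (by positivity)
      (h m (by omega) s)
    refine ⟨ε, hε.trans ?_, by rw [kernelForm_self_eq_re hA hpos, hK]⟩
    -- Since m ≥ 3 > e, the logarithmic factor is at least 1 and only weakens the bound D/m^(n+1).
    have hlog : 1 ≤ Real.log m := by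
      rw [Real.le_log_iff_exp_le (by linarith)]
      exact Real.exp_one_lt_three.le.trans hm'
    rw [div_eq_mul_one_div]
    gcongr
    exact one_le_pow₀ hlog
  · filter_upwards [eventually_ge_atTop (4 * d + 3), eventually_gt_atTop ⌈D⌉₊] with m hm hmD
    refine isPosDefForm_kernelForm hA hpos m fun s hs => ?_
    -- This makes n!·m > D, so the main term n!/m^n exceeds the error D/m^(n+1).
    have hmD' : D < m := Nat.lt_of_ceil_lt hmD
    have hm0 : (0 : ℝ) < m := by exact_mod_cast (show 0 < m by omega)
    have hN : 0 < sectionNorm Φ a m s ^ 2 := by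
      rw [sectionNorm_sq hA hpos]
      exact weightedNormSq_section_pos A hpos m hs
    have h1 := (abs_le.1 (h m (by omega) s)).1
    have h2 : 0 < (n ! : ℝ) / (m : ℝ) ^ n - D / (m : ℝ) ^ (n + 1) := by
      have h3 : (1 : ℝ) ≤ n ! := by exact_mod_cast Nat.one_le_iff_ne_zero.2 (Nat.factorial_ne_zero n)
      have h4 : (n ! : ℝ) / (m : ℝ) ^ n - D / (m : ℝ) ^ (n + 1) =
          (n ! * m - D) / (m : ℝ) ^ (n + 1) := by
        rw [pow_succ]; field_simp
      rw [h4]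
      refine div_pos ?_ (by positivity)
      nlinarith
    nlinarith [mul_pos h2 hN]
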